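/- **Setting.** We work in many-sorted first-order logic with equality $\simeq$ as the only predicate; carriers are nonempty. A *specification* $\Lambda=\langle\Sigma_c,\forall\bar x\exists y.F[\bar x,y]\rangle$ consists of a signature $\Sigma$, a set $\Sigma_c\subseteq\Sigma$ of *computable* symbols, and a closed first-order formula. Let $\bar\alpha$ be fresh constants (one for each variable in $\bar x$; they count as computable) and let $\mathrm{cnf}(\neg F[\bar\alpha,y])=\{C_1,\dots,C_m\}$ be the clausal normal form, in which $y$ is implicitly universally quantified; the Skolem functions that it introduces are uncomputable. All terms below are over the signature extended by these symbols, and we assume that every sort has a ground term. An expression is *computable* if it contains only computable symbols. *Program terms* are the terms (called *simple*) and all $\mathsf{ite}(l\simeq r,p,q)$ with terms $l,r$ and program terms $p,q$, read "if $l\simeq r$ then $p$ else $q$". An *answer clause* $C[p]$ is a clause $C$ (finite multiset of literals) labelled with a program term $p$ of the sort of $y$, its answer. The *initial set* is $\{C_1[y],\dots,C_m[y]\}$. **Ordering.** Let $\succ$ be a simplification order (a well-founded transitive relation on terms, closed under substitutions and contexts, with the subterm property, total on ground terms) that is *partitioned*: every ground uncomputable term is greater than every ground computable term. It is extended to literals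 by identifying $s\simeq t$ with the multiset $\{s,t\}$ and $s\not\simeq t$ with $\{s,s,t,t\}$ and taking the multiset extension, and to clauses by taking the multiset extension again. Answer clauses are compared by their clauses. In each clause all maximal literals are *selected*. **Rules.** Premises are renamed to be variable-disjoint, underlined literals are selected, equations are unordered, $\bowtie$ is $\simeq$ or $\not\simeq$, $l'$ is a non-variable subterm of $s$, and $s[r]$ arises from $s[l']$ by replacing all occurrences of $l'$ by $r$. - $\mathsf{Sup}_C$: from $(\underline{l\simeq r}\lor C)[p]$ and $(\underline{s[l']\bowtie t}\lor D)[q]$ derive $\big((s[r]\bowtie t\lor C\lor D)[\mathsf{ite}(l\simeq r,q,p)]\big)\sigma$, where $\sigma=\mathrm{mgu}(l,l')$, $r\sigma\not\succeq l\sigma$, $t\sigma\not\succeq s\sigma$, and $\mathsf{ite}(l\simeq r,q,p)\sigma$ is computable. - $\mathsf{Sup}_U$: from the same premises derive $\big((s[r]\bowtie t\lor C\lor D)[p]\big)\sigma$, where $\sigma=\mathrm{mgu}((l,p),(l',q))$, the same two order conditions hold, and $p\sigma$ is a computable simple term. - $\mathsf{EqRes}$: from $(\underline{s\not\simeq t}\lor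 C)[p]$ derive $(C[p])\sigma$, where $\sigma=\mathrm{mgu}(s,t)$ and $p\sigma$ is computable. - $\mathsf{EqFac}$: from $(\underline{s\simeq t}\lor l\simeq r\lor C)[p]$ derive $\big((s\simeq t\lor t\not\simeq r\lor C)[p]\big)\sigma$, where $\sigma=\mathrm{mgu}(s,l)$, $t\sigma\not\succeq s\sigma$, $r\sigma\not\succ t\sigma$, and $p\sigma$ is computable. - $\mathsf{Abs}$ *replaces* $(\underline{s[k]\bowtie t}\lor C)[p]$ by $(s[x]\bowtie t\lor x\not\simeq k\lor C)[p]$, where $x$ is a fresh variable, $s\not\preceq t$, $k$ is a non-variable subterm of $s$ such that for some substitution $\theta$ the term $s\theta$ is uncomputable and $k\theta$ is computable, and no proper superterm of $k$ in $s$ has this last property. A set of answer clauses is *abstracted* if $\mathsf{Abs}$ applies to none of its members. **Redundancy.** Let $S$ be a set of answer clauses and $N$ the set of ground instances of its members. A ground answer clause $C[p]$ *follows* from $N'\subseteq N$ if $C$ is a logical consequence of $\{D\mid D[p]\in N'\}$. An answer clause $A$ is *redundant* w.r.t. $S$ if each of its ground instances $A\theta$ follows from $\{B\in N\mid A\theta\succ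 B\}$. An inference with premises $A_1,\dots,A_n$, unifier $\sigma$ and conclusion $B$ is *redundant* w.r.t. $S$ if for every $\theta$ for which all $A_i\sigma\theta$ and $B\theta$ are ground, either $B\theta\succ A_i\sigma\theta$ for all $i$, or $B\theta$ follows from $\{A\in N\mid A_i\sigma\theta\succ A\text{ for some }i\}$. The set $S$ is *saturated up to redundancy* if each inference by $\mathsf{Sup}_C$, $\mathsf{Sup}_U$, $\mathsf{EqRes}$ or $\mathsf{EqFac}$ from non-redundant members of $S$ is redundant w.r.t. $S$. The set $S$ is *obtained from $\Lambda$* if it is the set of persistent answer clauses $\bigcup_i\bigcap_{j\ge i}S_j$ of a run $S_0,S_1,\dots$, where $S_0$ is the initial set and each $S_{i+1}$ either equals $S_i$, or results from $S_i$ by replacing a clause by $\mathsf{Abs}$, or, provided that $S_i$ is abstracted, results from $S_i$ by adding the conclusion of an inference from members of $S_i$ or by deleting an answer clause that is redundant w.r.t. $S_i$. **Lemma.** Let $S$ be obtained from $\Lambda$, abstracted, and saturated up to redundancy, and suppose that $S$ contains no answer clause $\square[p]$ with a computable program term $p$. Then for every ground computable program term $t$ (of the sort of $y$), the formula $\neg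 F[\bar\alpha,t]$ is satisfiable. -/

import Mathlib

noncomputable section

namespace SynSup

open scoped Classical

/-! ## Many-sorted first-order logic with equality -/

/-- A many-sorted first-order signature; predicates are function symbols into a truth-value sort. -/
structure Sig where
  /-- sorts -/
  Srt : Type
  /-- function symbols -/
  Fn : Type
  /-- argument sorts -/
  dom : Fn → List Srt
  /-- result sort -/
  cod : Fn → Srt

/-- A variable is a sort together with a name; every sort has countably many variables. -/
abbrev Var (S : Sig) : Type := S.Srt × ℕ

/-- Terms of each sort. -/
inductive Term (S : Sig) : S.Srt → Type
  | var (s : S.Srt) (n : ℕ) : Term S s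
  | app (f : S.Fn) (args : ∀ j : Fin (S.dom f).length, Term S ((S.dom f).get j)) :
      Term S (S.cod f)

/-- A term of arbitrary sort. -/
abbrev STerm (S : Sig) : Type := Σ s : S.Srt, Term S s

/-- Sort-preserving maps from variables to terms (finiteness of the support is imposed where it
matters, namely on unifiers). -/
abbrev Subst (S : Sig) : Type := ∀ s : S.Srt, ℕ → Term S s

namespace Term

variable {S : Sig}

def subst (σ : Subst S) : ∀ {s : S.Srt}, Term S s → Term S s
  | _, var s n => σ s n
  | _, app f args => app f (fun j => (args j).subst σ)

def vars : ∀ {s : S.Srt}, Term S s → Set (Var S)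
  | _, var s n => {(s, n)}
  | _, app _ args => ⋃ j, (args j).vars

def Ground {s : S.Srt} (t : Term S s) : Prop := t.vars = ∅

def IsVar : ∀ {s : S.Srt}, Term S s → Prop
  | _, var _ _ => True
  | _, app _ _ => False

/-- All function symbols of the term belong to the set `c` of computable symbols. -/
def Computable (c : Set S.Fn) : ∀ {s : S.Srt}, Term S s → Prop
  | _, var _ _ => True
  | _, app f args => f ∈ c ∧ ∀ j, (args j).Computable c

/-- `k.IsSubterm t`: the term `k` occurs in `t` (possibly `k = t`). -/
inductive IsSubterm {a : S.Srt} (k : Term S a) : ∀ {b : S.Srt}, Term S b → Prop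
  | refl : IsSubterm k k
  | arg (f : S.Fn) (args : ∀ j : Fin (S.dom f).length, Term S ((S.dom f).get j))
      (j : Fin (S.dom f).length) (h : IsSubterm k (args j)) : IsSubterm k (app f args)

/-- `Term.replace k r t`: all occurrences of `k` in `t` are replaced by `r`. -/
def replace {a : S.Srt} (k r : Term S a) : ∀ {b : S.Srt}, Term S b → Term S b
  | _, var s n =>
      if h : (⟨a, k⟩ : STerm S) = ⟨s, var s n⟩ then cast (congrArg (fun u => Term S u.1) h) r
      else var s n
  | _, app f args =>
      if h : (⟨a, k⟩ : STerm S) = ⟨S.cod f, app f args⟩ then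
        cast (congrArg (fun u => Term S u.1) h) r
      else app f (fun j => replace k r (args j))

end Term

/-- First-order formulas with named bound variables. -/
inductive Formula (S : Sig) : Type
  | falsum : Formula S
  | eq {s : S.Srt} (l r : Term S s) : Formula S
  | neg (φ : Formula S) : Formula S
  | and (φ ψ : Formula S) : Formula S
  | or (φ ψ : Formula S) : Formula S
  | imp (φ ψ : Formula S) : Formula S
  | all (s : S.Srt) (n : ℕ) (φ : Formula S) : Formula S
  | ex (s : S.Srt) (n : ℕ) (φ : Formula S) : Formula S

/-- Free variables. -/
def Formula.fv {S : Sig} : Formula S → Set (Var S)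
  | .falsum => ∅
  | .eq l r => l.vars ∪ r.vars
  | .neg φ => φ.fv
  | .and φ ψ => φ.fv ∪ ψ.fv
  | .or φ ψ => φ.fv ∪ ψ.fv
  | .imp φ ψ => φ.fv ∪ ψ.fv
  | .all s n φ => φ.fv \ {(s, n)}
  | .ex s n φ => φ.fv \ {(s, n)}

/-- Interpretations, with nonempty carriers. -/
structure Interp (S : Sig) where
  carrier : S.Srt → Type
  nonempty : ∀ s, Nonempty (carrier s)
  fn : ∀ f : S.Fn, (∀ j : Fin (S.dom f).length, carrier ((S.dom f).get j)) → carrier (S.cod f)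

abbrev Interp.Val {S : Sig} (I : Interp S) : Type := ∀ s : S.Srt, ℕ → I.carrier s

def Interp.eval {S : Sig} (I : Interp S) (v : I.Val) : ∀ {s : S.Srt}, Term S s → I.carrier s
  | _, .var s n => v s n
  | _, .app f args => I.fn f (fun j => I.eval v (args j))

/-- Change a family indexed by variables at the variable `(s, n)`. -/
def updateVar {T : Type} {A : T → Type} (v : ∀ s : T, ℕ → A s) (s : T) (n : ℕ) (a : A s) :
    ∀ s : T, ℕ → A s :=
  Function.update v s (Function.update (v s) n a)

def Formula.Sat {S : Sig} (I : Interp S) : I.Val → Formula S → Prop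
  | _, .falsum => False
  | v, .eq l r => I.eval v l = I.eval v r
  | v, .neg φ => ¬ φ.Sat I v
  | v, .and φ ψ => φ.Sat I v ∧ ψ.Sat I v
  | v, .or φ ψ => φ.Sat I v ∨ ψ.Sat I v
  | v, .imp φ ψ => φ.Sat I v → ψ.Sat I v
  | v, .all s n φ => ∀ a : I.carrier s, φ.Sat I (updateVar v s n a)
  | v, .ex s n φ => ∃ a : I.carrier s, φ.Sat I (updateVar v s n a)

/-! ## Program terms, clauses, answer clauses -/

/-- Program terms: simple terms, closed under `if l ≃ r then p else q`. -/
inductive PTerm (S : Sig) : S.Srt → Type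
  | simple {s : S.Srt} (t : Term S s) : PTerm S s
  | ite {s a : S.Srt} (l r : Term S a) (p q : PTerm S s) : PTerm S s

namespace PTerm

variable {S : Sig}

def subst (σ : Subst S) : ∀ {s : S.Srt}, PTerm S s → PTerm S s
  | _, simple t => simple (t.subst σ)
  | _, ite l r p q => ite (l.subst σ) (r.subst σ) (p.subst σ) (q.subst σ)

def vars : ∀ {s : S.Srt}, PTerm S s → Set (Var S)
  | _, simple t => t.vars
  | _, ite l r p q => l.vars ∪ r.vars ∪ p.vars ∪ q.vars

def Ground {s : S.Srt} (p : PTerm S s) : Prop := p.vars = ∅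

def Computable (c : Set S.Fn) : ∀ {s : S.Srt}, PTerm S s → Prop
  | _, simple t => t.Computable c
  | _, ite l r p q => l.Computable c ∧ r.Computable c ∧ p.Computable c ∧ q.Computable c

def IsSimple {s : S.Srt} (p : PTerm S s) : Prop := ∃ t : Term S s, p = simple t

def eval (I : Interp S) (v : I.Val) : ∀ {s : S.Srt}, PTerm S s → I.carrier s
  | _, simple t => I.eval v t
  | _, ite l r p q => if I.eval v l = I.eval v r then p.eval I v else q.eval I v

end PTerm

/-- A literal `l ≃ r` (`pos = true`) or `l ≄ r` (`pos = false`); sides are unordered. -/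
structure Lit (S : Sig) where
  sort : S.Srt
  pos : Bool
  atom : Sym2 (Term S sort)

namespace Lit

variable {S : Sig}

def subst (σ : Subst S) (L : Lit S) : Lit S :=
  ⟨L.sort, L.pos, L.atom.map (Term.subst σ)⟩

def vars (L : Lit S) : Set (Var S) := {x | ∃ u ∈ L.atom, x ∈ u.vars}

def Holds (I : Interp S) (v : I.Val) (L : Lit S) : Prop :=
  L.pos = true ↔ (L.atom.map (I.eval v)).IsDiag

/-- The bag `{l, r}` of `l ≃ r` and the bag `{l, l, r, r}` of `l ≄ r`. -/
def bag (L : Lit S) : Multiset (STerm S) :=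
  let m : Multiset (STerm S) := L.atom.toMultiset.map (fun u => ⟨L.sort, u⟩)
  if L.pos = true then m else m + m

end Lit

/-- Clauses are finite multisets of literals; the empty clause is `0`. -/
abbrev Clause (S : Sig) : Type := Multiset (Lit S)

namespace Clause

variable {S : Sig}

def subst (σ : Subst S) (C : Clause S) : Clause S := Multiset.map (Lit.subst σ) C

def vars (C : Clause S) : Set (Var S) := {x | ∃ L ∈ C, x ∈ L.vars}

/-- Truth of the universal closure of a clause. -/
def TrueIn (I : Interp S) (C : Clause S) : Prop := ∀ v : I.Val, ∃ L ∈ C, L.Holds I v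

end Clause

/-- An answer clause `C[p]`, whose answer `p` has the sort `o`. -/
structure AnsClause (S : Sig) (o : S.Srt) where
  cl : Clause S
  ans : PTerm S o

namespace AnsClause

variable {S : Sig} {o : S.Srt}

def subst (σ : Subst S) (A : AnsClause S o) : AnsClause S o := ⟨A.cl.subst σ, A.ans.subst σ⟩

def vars (A : AnsClause S o) : Set (Var S) := A.cl.vars ∪ A.ans.vars

def Ground (A : AnsClause S o) : Prop := A.vars = ∅

/-- `B` is a variant of `A`: the result of a bijective sort-preserving renaming of variables. -/
def IsVariant (B A : AnsClause S o) : Prop :=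
  ∃ π : S.Srt → Equiv.Perm ℕ, B = A.subst (fun s n => .var s (π s n))

end AnsClause

/-! ## Orderings -/

/-- The bag extension of an ordering `gt`: the smallest transitive relation that relates a bag to
each bag obtained by replacing one element `x` by finitely many elements below `x`. -/
def BagGt {α : Type} (gt : α → α → Prop) (M N : Multiset α) : Prop :=
  Relation.TransGen (Relation.CutExpand (fun a b => gt b a)) N M

variable {S : Sig}

def LitGt (gt : STerm S → STerm S → Prop) (L K : Lit S) : Prop := BagGt gt L.bag K.bag

def ClauseGt (gt : STerm S → STerm S → Prop) (C D : Clause S) : Prop := BagGt (LitGt gt) C D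

/-- Partitioned simplification orders on the terms of all sorts: reduction orders with the subterm
property that are total on ground terms and in which every ground uncomputable term is greater
than every ground computable term. -/
structure IsPartitionedSimplificationOrder (c : Set S.Fn) (gt : STerm S → STerm S → Prop) :
    Prop where
  trans : ∀ t u w, gt t u → gt u w → gt t w
  wf : WellFounded (fun t u => gt u t)
  subst : ∀ (σ : Subst S) (a b : S.Srt) (t : Term S a) (u : Term S b),
    gt ⟨a, t⟩ ⟨b, u⟩ → gt ⟨a, t.subst σ⟩ ⟨b, u.subst σ⟩
  context : ∀ (f : S.Fn) (args : ∀ j : Fin (S.dom f).length, Term S ((S.dom f).get j))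
    (j : Fin (S.dom f).length) (u : Term S ((S.dom f).get j)),
    gt ⟨_, args j⟩ ⟨_, u⟩ → gt ⟨_, .app f args⟩ ⟨_, .app f (Function.update args j u)⟩
  subterm : ∀ (f : S.Fn) (args : ∀ j : Fin (S.dom f).length, Term S ((S.dom f).get j))
    (j : Fin (S.dom f).length), gt ⟨_, .app f args⟩ ⟨_, args j⟩
  total : ∀ t u : STerm S, t.2.Ground → u.2.Ground → gt t u ∨ t = u ∨ gt u t
  partitioned : ∀ t u : STerm S, t.2.Ground → u.2.Ground →
    ¬ t.2.Computable c → u.2.Computable c → gt t u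

/-- `t ⪰ u` for terms of the same sort. -/
def TermGe (gt : STerm S → STerm S → Prop) {a : S.Srt} (t u : Term S a) : Prop :=
  gt ⟨a, t⟩ ⟨a, u⟩ ∨ t = u

/-- `L` is a maximal, hence selected, literal of the clause `L ∨ C`. -/
def Selected (gt : STerm S → STerm S → Prop) (L : Lit S) (C : Clause S) : Prop :=
  ∀ K ∈ C, ¬ LitGt gt K L

/-! ## The calculus -/

/-- `σ` is a most general element of the set `U` of unifiers of some expressions: it has finite
support, and each unifier `θ` is of the form `στ` (first `σ`, then `τ`). -/
def IsMgu (U : Subst S → Prop) (σ : Subst S) : Prop :=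
  {x : Var S | σ x.1 x.2 ≠ .var x.1 x.2}.Finite ∧ U σ ∧
    ∀ θ, U θ → ∃ τ : Subst S, ∀ s n, θ s n = (σ s n).subst τ

/-- The inference rules. `Inference c gt Ps σ A` says that `A` is derived from the list `Ps` of
premises by a rule application with most general unifier `σ`. -/
inductive Inference (c : Set S.Fn) (gt : STerm S → STerm S → Prop) {o : S.Srt} :
    List (AnsClause S o) → Subst S → AnsClause S o → Prop
  | supC {a b : S.Srt} (l r k : Term S a) (s t : Term S b) (pos : Bool) (C D : Clause S)
      (p q : PTerm S o) (σ : Subst S)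
      (disj : Disjoint (AnsClause.vars ⟨⟨a, true, s(l, r)⟩ ::ₘ C, p⟩)
        (AnsClause.vars ⟨⟨b, pos, s(s, t)⟩ ::ₘ D, q⟩))
      (sel₁ : Selected gt ⟨a, true, s(l, r)⟩ C)
      (sel₂ : Selected gt ⟨b, pos, s(s, t)⟩ D)
      (occ : k.IsSubterm s) (nonvar : ¬ k.IsVar)
      (mgu : IsMgu (fun θ => l.subst θ = k.subst θ) σ)
      (ord₁ : ¬ TermGe gt (r.subst σ) (l.subst σ))
      (ord₂ : ¬ TermGe gt (t.subst σ) (s.subst σ))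
      (comp : ((PTerm.ite l r q p).subst σ).Computable c) :
      Inference c gt
        [⟨⟨a, true, s(l, r)⟩ ::ₘ C, p⟩, ⟨⟨b, pos, s(s, t)⟩ ::ₘ D, q⟩] σ
        (AnsClause.subst σ ⟨⟨b, pos, s(Term.replace k r s, t)⟩ ::ₘ (C + D), .ite l r q p⟩)
  | supU {a b : S.Srt} (l r k : Term S a) (s t : Term S b) (pos : Bool) (C D : Clause S)
      (p q : PTerm S o) (σ : Subst S)
      (disj : Disjoint (AnsClause.vars ⟨⟨a, true, s(l, r)⟩ ::ₘ C, p⟩)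
        (AnsClause.vars ⟨⟨b, pos, s(s, t)⟩ ::ₘ D, q⟩))
      (sel₁ : Selected gt ⟨a, true, s(l, r)⟩ C)
      (sel₂ : Selected gt ⟨b, pos, s(s, t)⟩ D)
      (occ : k.IsSubterm s) (nonvar : ¬ k.IsVar)
      (mgu : IsMgu (fun θ => l.subst θ = k.subst θ ∧ p.subst θ = q.subst θ) σ)
      (ord₁ : ¬ TermGe gt (r.subst σ) (l.subst σ))
      (ord₂ : ¬ TermGe gt (t.subst σ) (s.subst σ))
      (comp : (p.subst σ).Computable c) (simple : (p.subst σ).IsSimple) :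
      Inference c gt
        [⟨⟨a, true, s(l, r)⟩ ::ₘ C, p⟩, ⟨⟨b, pos, s(s, t)⟩ ::ₘ D, q⟩] σ
        (AnsClause.subst σ ⟨⟨b, pos, s(Term.replace k r s, t)⟩ ::ₘ (C + D), p⟩)
  | eqRes {a : S.Srt} (s t : Term S a) (C : Clause S) (p : PTerm S o) (σ : Subst S)
      (sel : Selected gt ⟨a, false, s(s, t)⟩ C)
      (mgu : IsMgu (fun θ => s.subst θ = t.subst θ) σ)
      (comp : (p.subst σ).Computable c) :
      Inference c gt [⟨⟨a, false, s(s, t)⟩ ::ₘ C, p⟩] σ (AnsClause.subst σ ⟨C, p⟩)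
  | eqFac {a : S.Srt} (s t l r : Term S a) (C : Clause S) (p : PTerm S o) (σ : Subst S)
      (sel : Selected gt ⟨a, true, s(s, t)⟩ (⟨a, true, s(l, r)⟩ ::ₘ C))
      (mgu : IsMgu (fun θ => s.subst θ = l.subst θ) σ)
      (ord₁ : ¬ TermGe gt (t.subst σ) (s.subst σ))
      (ord₂ : ¬ gt ⟨a, r.subst σ⟩ ⟨a, t.subst σ⟩)
      (comp : (p.subst σ).Computable c) :
      Inference c gt [⟨⟨a, true, s(s, t)⟩ ::ₘ ⟨a, true, s(l, r)⟩ ::ₘ C, p⟩] σ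
        (AnsClause.subst σ ⟨⟨a, true, s(s, t)⟩ ::ₘ ⟨a, false, s(t, r)⟩ ::ₘ C, p⟩)

/-- Some instance makes `s` uncomputable and `k` computable. -/
def Separable (c : Set S.Fn) {a b : S.Srt} (s : Term S b) (k : Term S a) : Prop :=
  ∃ θ : Subst S, ¬ (s.subst θ).Computable c ∧ (k.subst θ).Computable c

/-- The abstraction rule: `Abs c gt A B` says that `A` is replaced by `B`. -/
inductive Abs (c : Set S.Fn) (gt : STerm S → STerm S → Prop) {o : S.Srt} :
    AnsClause S o → AnsClause S o → Prop
  | mk {a b : S.Srt} (k : Term S a) (s t : Term S b) (pos : Bool) (C : Clause S)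
      (p : PTerm S o) (x : ℕ)
      (sel : Selected gt ⟨b, pos, s(s, t)⟩ C)
      (occ : k.IsSubterm s)
      (ord : ¬ TermGe gt t s)
      (sep : Separable c s k)
      (max : ∀ (a' : S.Srt) (u : Term S a'), u.IsSubterm s → k.IsSubterm u →
        (⟨a', u⟩ : STerm S) ≠ ⟨a, k⟩ → ¬ Separable c s u)
      (nonvar : ¬ k.IsVar)
      (fresh : (a, x) ∉ AnsClause.vars ⟨⟨b, pos, s(s, t)⟩ ::ₘ C, p⟩) :
      Abs c gt ⟨⟨b, pos, s(s, t)⟩ ::ₘ C, p⟩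
        ⟨⟨b, pos, s(Term.replace k (.var a x) s, t)⟩ ::ₘ ⟨a, false, s(.var a x, k)⟩ ::ₘ C, p⟩

/-- The abstraction rule applies to no clause of the set. -/
def Abstracted (c : Set S.Fn) (gt : STerm S → STerm S → Prop) {o : S.Srt}
    (N : Set (AnsClause S o)) : Prop :=
  ∀ A ∈ N, ∀ B, ¬ Abs c gt A B

/-! ## Redundancy and saturation -/

/-- The ground instances of the answer clauses in a set. -/
def groundInstances {o : S.Srt} (N : Set (AnsClause S o)) : Set (AnsClause S o) :=
  {B | B.Ground ∧ ∃ A ∈ N, ∃ θ : Subst S, B = A.subst θ}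

/-- The ground answer clause `A = C[p]` follows from a set of ground answer clauses. Answers are
labels: `C` is a logical consequence of the clauses `D` with `D[p]` in the set. -/
def Follows {o : S.Srt} (N : Set (AnsClause S o)) (A : AnsClause S o) : Prop :=
  ∀ I : Interp S, (∀ B ∈ N, B.ans = A.ans → B.cl.TrueIn I) → A.cl.TrueIn I

def Redundant (gt : STerm S → STerm S → Prop) {o : S.Srt} (N : Set (AnsClause S o))
    (A : AnsClause S o) : Prop :=
  ∀ θ : Subst S, (A.subst θ).Ground →
    Follows {B ∈ groundInstances N | ClauseGt gt (A.subst θ).cl B.cl} (A.subst θ)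

/-- Redundancy of the inference with premises `Ps`, unifier `σ` and conclusion `A`; the ground
instances of the inference are those given by the substitutions `σθ`. -/
def RedundantInference (gt : STerm S → STerm S → Prop) {o : S.Srt} (N : Set (AnsClause S o))
    (Ps : List (AnsClause S o)) (σ : Subst S) (A : AnsClause S o) : Prop :=
  ∀ θ : Subst S, (∀ P ∈ Ps, ((P.subst σ).subst θ).Ground) → (A.subst θ).Ground →
    (∀ P ∈ Ps, ClauseGt gt (A.subst θ).cl ((P.subst σ).subst θ).cl) ∨
    Follows {B ∈ groundInstances N | ∃ P ∈ Ps, ClauseGt gt ((P.subst σ).subst θ).cl B.cl}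
      (A.subst θ)

/-- Every inference from (variants of) non-redundant members of the set is redundant. -/
def SaturatedUpToRedundancy (c : Set S.Fn) (gt : STerm S → STerm S → Prop) {o : S.Srt}
    (N : Set (AnsClause S o)) : Prop :=
  ∀ Ps σ A, Inference c gt Ps σ A →
    (∀ P ∈ Ps, ∃ Q ∈ N, P.IsVariant Q ∧ ¬ Redundant gt N Q) → RedundantInference gt N Ps σ A

/-- One step of the saturation procedure. Abstraction replaces its premise and has to be applied
exhaustively before anything else; the other steps add the conclusion of an inference or delete a
redundant clause. The step `idle` lets finite runs be continued. -/
inductive Step (c : Set S.Fn) (gt : STerm S → STerm S → Prop) {o : S.Srt}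
    (N : Set (AnsClause S o)) : Set (AnsClause S o) → Prop
  | abs (A B : AnsClause S o) (hA : A ∈ N) (h : Abs c gt A B) : Step c gt N (insert B (N \ {A}))
  | infer (Ps : List (AnsClause S o)) (σ : Subst S) (A : AnsClause S o)
      (habs : Abstracted c gt N) (hPs : ∀ P ∈ Ps, ∃ Q ∈ N, P.IsVariant Q)
      (h : Inference c gt Ps σ A) : Step c gt N (insert A N)
  | delete (A : AnsClause S o) (habs : Abstracted c gt N) (hA : A ∈ N)
      (h : Redundant gt N A) : Step c gt N (N \ {A})
  | idle : Step c gt N N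

/-- `N` is the limit (the set of persistent clauses) of a run of the saturation procedure that
starts from `N₀`. -/
def IsLimitFrom (c : Set S.Fn) (gt : STerm S → STerm S → Prop) {o : S.Srt}
    (N₀ N : Set (AnsClause S o)) : Prop :=
  ∃ run : ℕ → Set (AnsClause S o), run 0 = N₀ ∧ (∀ i, Step c gt (run i) (run (i + 1))) ∧
    N = {A | ∃ i, ∀ j, i ≤ j → A ∈ run j}

/-! ## Clausal normal form -/

/-- Skolem symbols of a formula: its occurrences of quantifiers of existential force. Here `b` is
the polarity of the formula and `Γ` lists the sorts of the universal variables in scope. -/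
inductive SkSym (S : Sig) : Bool → List S.Srt → Formula S → Type
  | hereEx {Γ : List S.Srt} {s : S.Srt} {n : ℕ} {φ : Formula S} : SkSym S true Γ (.ex s n φ)
  | hereAll {Γ : List S.Srt} {s : S.Srt} {n : ℕ} {φ : Formula S} : SkSym S false Γ (.all s n φ)
  | inEx {Γ : List S.Srt} {s : S.Srt} {n : ℕ} {φ : Formula S} :
      SkSym S true Γ φ → SkSym S true Γ (.ex s n φ)
  | inAll {Γ : List S.Srt} {s : S.Srt} {n : ℕ} {φ : Formula S} :
      SkSym S false Γ φ → SkSym S false Γ (.all s n φ)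
  | underAll {Γ : List S.Srt} {s : S.Srt} {n : ℕ} {φ : Formula S} :
      SkSym S true (s :: Γ) φ → SkSym S true Γ (.all s n φ)
  | underEx {Γ : List S.Srt} {s : S.Srt} {n : ℕ} {φ : Formula S} :
      SkSym S false (s :: Γ) φ → SkSym S false Γ (.ex s n φ)
  | neg {b : Bool} {Γ : List S.Srt} {φ : Formula S} : SkSym S (!b) Γ φ → SkSym S b Γ (.neg φ)
  | andL {b : Bool} {Γ : List S.Srt} {φ ψ : Formula S} : SkSym S b Γ φ → SkSym S b Γ (.and φ ψ)
  | andR {b : Bool} {Γ : List S.Srt} {φ ψ : Formula S} : SkSym S b Γ ψ → SkSym S b Γ (.and φ ψ)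
  | orL {b : Bool} {Γ : List S.Srt} {φ ψ : Formula S} : SkSym S b Γ φ → SkSym S b Γ (.or φ ψ)
  | orR {b : Bool} {Γ : List S.Srt} {φ ψ : Formula S} : SkSym S b Γ ψ → SkSym S b Γ (.or φ ψ)
  | impL {b : Bool} {Γ : List S.Srt} {φ ψ : Formula S} :
      SkSym S (!b) Γ φ → SkSym S b Γ (.imp φ ψ)
  | impR {b : Bool} {Γ : List S.Srt} {φ ψ : Formula S} : SkSym S b Γ ψ → SkSym S b Γ (.imp φ ψ)

/-- The arguments of a Skolem function are the universal variables in scope. -/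
def SkSym.dom : ∀ {b : Bool} {Γ : List S.Srt} {φ : Formula S}, SkSym S b Γ φ → List S.Srt
  | _, Γ, _, .hereEx => Γ
  | _, Γ, _, .hereAll => Γ
  | _, _, _, .inEx i => i.dom
  | _, _, _, .inAll i => i.dom
  | _, _, _, .underAll i => i.dom
  | _, _, _, .underEx i => i.dom
  | _, _, _, .neg i => i.dom
  | _, _, _, .andL i => i.dom
  | _, _, _, .andR i => i.dom
  | _, _, _, .orL i => i.dom
  | _, _, _, .orR i => i.dom
  | _, _, _, .impL i => i.dom
  | _, _, _, .impR i => i.dom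

def SkSym.cod : ∀ {b : Bool} {Γ : List S.Srt} {φ : Formula S}, SkSym S b Γ φ → S.Srt
  | _, _, _, .hereEx (s := s) => s
  | _, _, _, .hereAll (s := s) => s
  | _, _, _, .inEx i => i.cod
  | _, _, _, .inAll i => i.cod
  | _, _, _, .underAll i => i.cod
  | _, _, _, .underEx i => i.cod
  | _, _, _, .neg i => i.cod
  | _, _, _, .andL i => i.cod
  | _, _, _, .andR i => i.cod
  | _, _, _, .orL i => i.cod
  | _, _, _, .orR i => i.cod
  | _, _, _, .impL i => i.cod
  | _, _, _, .impR i => i.cod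

/-- The signature `S` extended by new function symbols with given arities. -/
abbrev Sig.extend (S : Sig) (A : Type) (dA : A → List S.Srt) (cA : A → S.Srt) : Sig where
  Srt := S.Srt
  Fn := S.Fn ⊕ A
  dom := Sum.elim S.dom dA
  cod := Sum.elim S.cod cA

section Clausify

variable {A : Type} {dA : A → List S.Srt} {cA : A → S.Srt}

/-- Translate a term to the extended signature, replacing variables according to `ρ`. -/
def Term.lift (ρ : Subst (S.extend A dA cA)) :
    ∀ {s : S.Srt}, Term S s → Term (S.extend A dA cA) s
  | _, .var s n => ρ s n
  | _, .app f args =>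
      Term.app (S := S.extend A dA cA) (Sum.inl f) (fun j => (args j).lift ρ)

/-- The disjunction of two clause sets, by distributivity. -/
def clauseProd {T : Sig} (cs ds : List (Clause T)) : List (Clause T) :=
  cs.flatMap (fun C => ds.map (fun D => C + D))

/-- Clausal normal form of `φ` (if `b = true`) or of `¬ φ` (if `b = false`): negations are pushed
inwards, quantifiers of universal force are dropped after giving each bound variable a fresh name
(the last argument is the next unused name, and the next unused name afterwards is returned with
the clauses), quantifiers of existential force are skolemized by `sk`, and disjunctions are
distributed over conjunctions. Here `args` are the universal variables in scope and `ρ` says by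
which term each variable of `φ` is replaced. -/
def clausify : (φ : Formula S) → (b : Bool) → (Γ : List S.Srt) →
    (args : ∀ j : Fin Γ.length, Term (S.extend A dA cA) (Γ.get j)) →
    (sk : ∀ i : SkSym S b Γ φ,
      (∀ j : Fin i.dom.length, Term (S.extend A dA cA) (i.dom.get j)) →
        Term (S.extend A dA cA) i.cod) →
    (ρ : Subst (S.extend A dA cA)) → ℕ → List (Clause (S.extend A dA cA)) × ℕ
  | .falsum, b, _, _, _, _, k => (if b = true then [0] else [], k)
  | .eq (s := s) l r, b, _, _, _, ρ, k => ([{⟨s, b, s(l.lift ρ, r.lift ρ)⟩}], k)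
  | .neg φ, b, Γ, args, sk, ρ, k => clausify φ (!b) Γ args (fun i => sk (.neg i)) ρ k
  | .and φ ψ, b, Γ, args, sk, ρ, k =>
      let X := clausify φ b Γ args (fun i => sk (.andL i)) ρ k
      let Y := clausify ψ b Γ args (fun i => sk (.andR i)) ρ X.2
      (if b = true then X.1 ++ Y.1 else clauseProd X.1 Y.1, Y.2)
  | .or φ ψ, b, Γ, args, sk, ρ, k =>
      let X := clausify φ b Γ args (fun i => sk (.orL i)) ρ k
      let Y := clausify ψ b Γ args (fun i => sk (.orR i)) ρ X.2
      (if b = true then clauseProd X.1 Y.1 else X.1 ++ Y.1, Y.2)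
  | .imp φ ψ, b, Γ, args, sk, ρ, k =>
      let X := clausify φ (!b) Γ args (fun i => sk (.impL i)) ρ k
      let Y := clausify ψ b Γ args (fun i => sk (.impR i)) ρ X.2
      (if b = true then clauseProd X.1 Y.1 else X.1 ++ Y.1, Y.2)
  | .all s n φ, true, Γ, args, sk, ρ, k =>
      clausify φ true (s :: Γ) (Fin.cases (Term.var (S := S.extend A dA cA) s k) args)
        (fun i => sk (.underAll i))
        (updateVar ρ s n (Term.var (S := S.extend A dA cA) s k)) (k + 1)
  | .all s n φ, false, Γ, args, sk, ρ, k =>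
      clausify φ false Γ args (fun i => sk (.inAll i)) (updateVar ρ s n (sk .hereAll args)) k
  | .ex s n φ, true, Γ, args, sk, ρ, k =>
      clausify φ true Γ args (fun i => sk (.inEx i)) (updateVar ρ s n (sk .hereEx args)) k
  | .ex s n φ, false, Γ, args, sk, ρ, k =>
      clausify φ false (s :: Γ) (Fin.cases (Term.var (S := S.extend A dA cA) s k) args)
        (fun i => sk (.underEx i))
        (updateVar ρ s n (Term.var (S := S.extend A dA cA) s k)) (k + 1)

end Clausify

/-! ## Synthesis specifications -/

/-- A specification: computable symbols and the closed formula `∀ x̄ ∃ y. F[x̄, y]`. -/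
structure Spec where
  /-- the signature -/
  base : Sig
  /-- the computable symbols -/
  compFn : Set base.Fn
  /-- the input variables `x̄` -/
  inputs : Finset (Var base)
  /-- the output variable `y` -/
  output : Var base
  /-- the matrix `F` -/
  F : Formula base
  output_notMem : output ∉ inputs
  closed : F.fv ⊆ insert output (inputs : Set (Var base))

namespace Spec

variable (Λ : Spec)

/-- The sort of the output. -/
abbrev osort : Λ.base.Srt := Λ.output.1

/-- The new symbols: a Skolem constant `α` for each input variable, and the Skolem functions of the
clausal normal form of `∀ y. ¬ F[ᾱ, y]`. -/
abbrev NewFn : Type := {x : Var Λ.base // x ∈ Λ.inputs} ⊕ SkSym Λ.base false [Λ.osort] Λ.F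

abbrev newDom : Λ.NewFn → List Λ.base.Srt := Sum.elim (fun _ => []) SkSym.dom

abbrev newCod : Λ.NewFn → Λ.base.Srt := Sum.elim (fun x => x.1.1) SkSym.cod

/-- The signature extended by the new symbols. -/
abbrev sig : Sig := Λ.base.extend Λ.NewFn Λ.newDom Λ.newCod

/-- The computable symbols of the extended signature: those of the specification and the constants
`ᾱ`, but not the Skolem functions. -/
def comp : Set Λ.sig.Fn :=
  {f | (∃ g ∈ Λ.compFn, f = Sum.inl g) ∨
    ∃ x : {x : Var Λ.base // x ∈ Λ.inputs}, f = Sum.inr (Sum.inl x)}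

/-- The constant `α` for the input variable `x`. -/
def inputConst (x : {x : Var Λ.base // x ∈ Λ.inputs}) : Term Λ.sig x.1.1 :=
  Term.app (S := Λ.sig) (Sum.inr (Sum.inl x)) (fun j => j.elim0)

/-- Input variables are replaced by the constants `ᾱ`. -/
def env : Subst Λ.sig := fun s n =>
  if h : (s, n) ∈ Λ.inputs then Λ.inputConst ⟨(s, n), h⟩ else Term.var (S := Λ.sig) s n

/-- The output variable `y` as a term. -/
def outputTerm : Term Λ.sig Λ.osort := Term.var (S := Λ.sig) Λ.output.1 Λ.output.2

/-- The clausal normal form of `¬ F[ᾱ, y]`, in which `y` is implicitly universally quantified. -/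
def cnf : List (Clause Λ.sig) :=
  (clausify Λ.F false [Λ.osort] (Fin.cases Λ.outputTerm (fun j => j.elim0))
    (fun i args => Term.app (S := Λ.sig) (Sum.inr (Sum.inr i)) args) Λ.env (Λ.output.2 + 1)).1

/-- The initial set: all clauses of the clausal normal form, with the answer `y`. -/
def initial : Set (AnsClause Λ.sig Λ.osort) :=
  {A | A.cl ∈ Λ.cnf ∧ A.ans = .simple Λ.outputTerm}

/-- The restriction of an interpretation to the signature of the specification. -/
def reduct (I : Interp Λ.sig) : Interp Λ.base where
  carrier := I.carrier
  nonempty := I.nonempty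
  fn f args := I.fn (Sum.inl f) args

/-- Satisfiability of `¬ F[ᾱ, t]` for a ground program term `t`: in some interpretation, `F` is
false when the inputs are interpreted as `ᾱ` and `y` is interpreted as `t`. -/
def NegSatisfiable (t : PTerm Λ.sig Λ.osort) : Prop :=
  ∃ (I : Interp Λ.sig) (v : I.Val),
    (∀ x : {x : Var Λ.base // x ∈ Λ.inputs}, v x.1.1 x.1.2 = I.eval v (Λ.inputConst x)) ∧
    v Λ.output.1 Λ.output.2 = t.eval I v ∧
    ¬ Λ.F.Sat (Λ.reduct I) v

end Spec

end SynSup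

end

noncomputable section

namespace SynSup

open scoped Classical

variable {S : Sig} {o : S.Srt} {c : Set S.Fn}

/-! ## Substitutions -/

namespace Term

/-! The theorem holds because a superposition model can be built from only those ground instances
that matter for one answer. Call a ground instance relevant (`Admissible`) if its clause and its
answer are both computable, or if its answer is one fixed computable ground term `z`. In a
partitioned order, ground clauses below a computable ground clause are computable. Hence relevance
passes to smaller clauses with the same answer, and arguments by redundancy stay among relevant
clauses.

The carriers consist of normal forms of ground terms, obtained by a single well-founded recursion on
terms (`normalize`) instead of adding rules clause by clause. A clause `l ≃ r ∨ D` defines `l → r`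
if each literal of `D` either lies below `l` and is false, or is some `l ≃ t` with `t` smaller than
`r` and of a different normal form. This test inspects normal forms only below `l`, so the recursion
makes sense. Among the rules for `l`, one with a least right-hand side is used.

By `trueUnder_of_admissible`, all relevant instances are true in this model if `z` is irreducible.
In a minimal false one, the substitution is normal on the variables of the clause, and
irreducibility of `z` keeps the label fixed under normalization. Equality resolution, equality
factoring or superposition then has a smaller false conclusion, which saturation makes true. The
delicate point is to keep the conclusion of a superposition relevant. If the main clause is
computable, so is the smaller clause that defines the rule, and `supC` applies. Otherwise the main
clause has label `z` and the greater side of its maximal literal is uncomputable. As the set is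
abstracted, the overlapped subterm is uncomputable as well (`not_computable_of_abstracted`). So the
rule comes from an uncomputable clause, which also has label `z`, and `supU` applies.

To choose `z`, note that normal forms of computable terms depend only on the computable clauses
(`normalize_congr_of_computable`), which are the same for every label. Built without any label, the
model already decides the conditions in a program term `t` and gives it the value of one computable
term (`exists_term_eval_eq`); `z` is the normal form of that term. Adding the clauses with label `z`
changes no normal form of a computable term, so `z` stays irreducible and is the value of `t`.

Finally, ground instances of the initial clauses with answer `z` follow from those of the limit with
answer `z` (`IsLimitFrom.follows`). So the clausal normal form is true at `y = z`, and it entails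
the negated matrix there (`clausifies_clausify`). -/

theorem subst_subst (σ τ : Subst S) {s : S.Srt} (t : Term S s) :
    (t.subst σ).subst τ = t.subst (fun s n => (σ s n).subst τ) := by
  induction t with
  | var s n => rfl
  | app f args ih => simp only [subst, ih]

theorem subst_var {s : S.Srt} (t : Term S s) : t.subst (fun s n => .var s n) = t := by
  induction t with
  | var s n => rfl
  | app f args ih => simp only [subst, ih]

theorem subst_congr {σ τ : Subst S} {s : S.Srt} {t : Term S s}
    (h : ∀ x ∈ t.vars, σ x.1 x.2 = τ x.1 x.2) : t.subst σ = t.subst τ := by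
  induction t with
  | var s n => exact h (s, n) rfl
  | app f args ih =>
    simp only [subst]
    congr 1
    funext j
    exact ih j fun x hx => h x (Set.mem_iUnion.2 ⟨j, hx⟩)

theorem mem_vars_subst {σ : Subst S} {s : S.Srt} {t : Term S s} {x : Var S} :
    x ∈ (t.subst σ).vars ↔ ∃ y ∈ t.vars, x ∈ (σ y.1 y.2).vars := by
  induction t with
  | var s n => simp [subst, vars]
  | app f args ih =>
    simp only [subst, vars, Set.mem_iUnion, ih]
    exact ⟨fun ⟨j, y, h, h'⟩ => ⟨y, ⟨j, h⟩, h'⟩, fun ⟨y, ⟨j, h⟩, h'⟩ => ⟨j, y, h, h'⟩⟩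

theorem ground_subst_iff {σ : Subst S} {s : S.Srt} {t : Term S s} :
    (t.subst σ).Ground ↔ ∀ y ∈ t.vars, (σ y.1 y.2).Ground := by
  simp only [Ground, Set.eq_empty_iff_forall_notMem, mem_vars_subst, not_exists, not_and]
  exact ⟨fun h y hy x => h x y hy, fun h x y hy => h y hy x⟩

theorem ground_app_iff {f : S.Fn} {args : ∀ j : Fin (S.dom f).length, Term S ((S.dom f).get j)} :
    (app f args).Ground ↔ ∀ j, (args j).Ground := by
  simp [Ground, vars]

theorem not_ground_var (s : S.Srt) (n : ℕ) : ¬ (var s n : Term S s).Ground := by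
  simp [Ground, vars]

theorem Ground.subst_eq {s : S.Srt} {t : Term S s} (h : t.Ground) (σ : Subst S) :
    t.subst σ = t := by
  conv_rhs => rw [← subst_var t]
  exact subst_congr fun x hx => by rw [h] at hx; exact hx.elim

theorem vars_finite {s : S.Srt} (t : Term S s) : t.vars.Finite := by
  induction t with
  | var s n => exact Set.finite_singleton _
  | app f args ih => exact Set.finite_iUnion ih

theorem computable_subst_iff {σ : Subst S} {s : S.Srt} {t : Term S s} :
    (t.subst σ).Computable c ↔ t.Computable c ∧ ∀ y ∈ t.vars, (σ y.1 y.2).Computable c := by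
  induction t with
  | var s n => simp [subst, vars, Computable]
  | app f args ih =>
    simp only [subst, vars, Computable, ih, Set.mem_iUnion, forall_exists_index]
    exact ⟨fun h => ⟨⟨h.1, fun j => (h.2 j).1⟩, fun y j hy => (h.2 j).2 y hy⟩,
      fun h => ⟨h.1.1, fun j => ⟨h.1.2 j, fun y hy => h.2 y j hy⟩⟩⟩

/-- The topmost function symbol of a term with its arguments. -/
def _root_.SynSup.STerm.top : STerm S →
    Option (Σ f : S.Fn, ∀ j : Fin (S.dom f).length, Term S ((S.dom f).get j))
  | ⟨_, var _ _⟩ => none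
  | ⟨_, app f args⟩ => some ⟨f, args⟩

/-- The index `S.cod f` is not a variable, so `cases` cannot take apart an equation between
applications; `STerm.top` turns it into an equation between symbols with their arguments. -/
theorem sigma_app_inj {f g : S.Fn} {args : ∀ j : Fin (S.dom f).length, Term S ((S.dom f).get j)}
    {args' : ∀ j : Fin (S.dom g).length, Term S ((S.dom g).get j)}
    (h : (⟨_, app f args⟩ : STerm S) = ⟨_, app g args'⟩) :
    (⟨f, args⟩ : Σ f : S.Fn, ∀ j : Fin (S.dom f).length, Term S ((S.dom f).get j)) = ⟨g, args'⟩ :=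
  Option.some.inj (congrArg STerm.top h)

theorem IsSubterm.of_app {a : S.Srt} {k : Term S a} {f : S.Fn}
    {args : ∀ j : Fin (S.dom f).length, Term S ((S.dom f).get j)} (h : k.IsSubterm (app f args)) :
    (⟨a, k⟩ : STerm S) = ⟨_, app f args⟩ ∨ ∃ j, k.IsSubterm (args j) := by
  suffices ∀ (b : S.Srt) (w : Term S b), k.IsSubterm w → (⟨b, w⟩ : STerm S) = ⟨_, app f args⟩ →
      (⟨a, k⟩ : STerm S) = ⟨_, app f args⟩ ∨ ∃ j, k.IsSubterm (args j) from this _ _ h rfl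
  intro b w hw he
  cases hw with
  | refl => exact .inl he
  | arg g args' j h' => cases sigma_app_inj he; exact .inr ⟨j, h'⟩

theorem IsSubterm.trans {a b d : S.Srt} {k : Term S a} {t : Term S b} {u : Term S d}
    (h : k.IsSubterm t) (h' : t.IsSubterm u) : k.IsSubterm u := by
  induction h' with
  | refl => exact h
  | arg f args j _ ih => exact .arg f args j ih

theorem IsSubterm.vars_subset {a b : S.Srt} {k : Term S a} {t : Term S b}
    (h : k.IsSubterm t) : k.vars ⊆ t.vars := by
  induction h with
  | refl => exact subset_rfl
  | arg f args j _ ih => exact ih.trans (Set.subset_iUnion (fun j => (args j).vars) j)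

theorem IsSubterm.ground {a b : S.Srt} {k : Term S a} {t : Term S b}
    (h : k.IsSubterm t) (ht : t.Ground) : k.Ground :=
  Set.subset_eq_empty h.vars_subset ht

theorem IsSubterm.subst {a b : S.Srt} {k : Term S a} {t : Term S b}
    (h : k.IsSubterm t) (σ : Subst S) : (k.subst σ).IsSubterm (t.subst σ) := by
  induction h with
  | refl => exact .refl
  | arg f args j _ ih => exact .arg f (fun j => (args j).subst σ) j ih

theorem isSubterm_of_mem_vars {b : S.Srt} {t : Term S b} {x : Var S} (h : x ∈ t.vars) :
    (var x.1 x.2 : Term S x.1).IsSubterm t := by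
  induction t with
  | var s n => cases h; exact .refl
  | app f args ih =>
    obtain ⟨j, hj⟩ := Set.mem_iUnion.1 h
    exact .arg f args j (ih j hj)

/-- A subterm of an instance of `t` is an instance of a non-variable subterm of `t` or a subterm
of a term substituted for a variable. -/
theorem IsSubterm.of_subst {a b : S.Srt} {k : Term S a} {t : Term S b} {σ : Subst S}
    (h : k.IsSubterm (t.subst σ)) :
    (∃ u : Term S a, u.IsSubterm t ∧ ¬ u.IsVar ∧ u.subst σ = k) ∨
      ∃ x ∈ t.vars, k.IsSubterm (σ x.1 x.2) := by
  induction t with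
  | var s n => exact .inr ⟨(s, n), rfl, h⟩
  | app f args ih =>
    rcases h.of_app with h | ⟨j, h⟩
    · refine .inl ?_
      cases h
      exact ⟨app f args, .refl, id, rfl⟩
    · rcases ih j h with ⟨u, h₁, h₂⟩ | ⟨x, h₁, h₂⟩
      · exact .inl ⟨u, .arg f args j h₁, h₂⟩
      · exact .inr ⟨x, Set.mem_iUnion.2 ⟨j, h₁⟩, h₂⟩

theorem IsSubterm.not_isVar {a b : S.Srt} {k : Term S a} {t : Term S b} (h : k.IsSubterm t)
    (hk : ¬ k.IsVar) : ¬ t.IsVar := by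
  cases h with
  | refl => exact hk
  | arg => exact id

/-- The number of function symbols. -/
def size : ∀ {s : S.Srt}, Term S s → ℕ
  | _, var _ _ => 0
  | _, app _ args => 1 + ∑ j, (args j).size

theorem IsSubterm.size_le {a b : S.Srt} {k : Term S a} {t : Term S b} (h : k.IsSubterm t) :
    k.size ≤ t.size := by
  induction h with
  | refl => exact le_rfl
  | arg f args j _ ih =>
    have := Finset.single_le_sum (f := fun j => (args j).size) (fun _ _ => Nat.zero_le _)
      (Finset.mem_univ j)
    simp only [size] at *
    omega

theorem IsSubterm.eq_or_size_lt {a b : S.Srt} {k : Term S a} {t : Term S b}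
    (h : k.IsSubterm t) : (⟨a, k⟩ : STerm S) = ⟨b, t⟩ ∨ k.size < t.size := by
  cases h with
  | refl => exact .inl rfl
  | arg f args j h =>
    have := Finset.single_le_sum (f := fun j => (args j).size) (fun _ _ => Nat.zero_le _)
      (Finset.mem_univ j)
    have := h.size_le
    simp only [size] at *
    omega

theorem size_pos {s : S.Srt} {t : Term S s} (h : ¬ t.IsVar) : 0 < t.size := by
  cases t with
  | var => exact (h trivial).elim
  | app f args => simp only [size]; omega

/-! ### Replacement -/

theorem replace_self {a : S.Srt} (k r : Term S a) : replace k r k = r := by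
  cases k <;> simp [replace]

theorem replace_app_of_ne {a : S.Srt} {k r : Term S a} {f : S.Fn}
    {args : ∀ j : Fin (S.dom f).length, Term S ((S.dom f).get j)}
    (h : (⟨a, k⟩ : STerm S) ≠ ⟨_, app f args⟩) :
    replace k r (app f args) = app f (fun j => replace k r (args j)) := by
  simp [replace, h]

theorem replace_var_of_ne {a : S.Srt} {k r : Term S a} {s : S.Srt} {n : ℕ}
    (h : (⟨a, k⟩ : STerm S) ≠ ⟨s, var s n⟩) : replace k r (var s n) = var s n := by
  simp [replace, h]

/-- Induction on the result of a replacement. -/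
theorem replace_induction {a : S.Srt} {k r : Term S a}
    {P : ∀ {b : S.Srt}, Term S b → Term S b → Prop} (self : P k r)
    (var : ∀ s n, P (.var s n) (.var s n))
    (app : ∀ f args args', (∀ j, P (args j) (args' j)) → P (.app f args) (.app f args'))
    {b : S.Srt} (t : Term S b) : P t (replace k r t) := by
  induction t with
  | var s n =>
    by_cases h : (⟨a, k⟩ : STerm S) = ⟨s, .var s n⟩
    · cases h; rw [replace_self]; exact self
    · rw [replace_var_of_ne h]; exact var s n
  | app f args ih =>
    by_cases h : (⟨a, k⟩ : STerm S) = ⟨_, .app f args⟩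
    · cases h; rw [replace_self]; exact self
    · rw [replace_app_of_ne h]; exact app _ _ _ ih

theorem replace_subst_eq {a : S.Srt} {k r : Term S a} {σ : Subst S}
    (h : r.subst σ = k.subst σ) {b : S.Srt} (t : Term S b) :
    (replace k r t).subst σ = t.subst σ := by
  refine replace_induction (P := fun t t' => t'.subst σ = t.subst σ) h (fun _ _ => rfl) ?_ t
  intro f args args' ih
  exact congrArg (app f) (funext ih)

theorem vars_replace_subset {a : S.Srt} (k r : Term S a) {b : S.Srt} (t : Term S b) :
    (replace k r t).vars ⊆ t.vars ∪ r.vars := by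
  refine replace_induction (P := fun t t' => t'.vars ⊆ t.vars ∪ r.vars)
    Set.subset_union_right (fun _ _ => Set.subset_union_left) ?_ t
  intro f args args' ih x hx
  obtain ⟨j, hj⟩ := Set.mem_iUnion.1 hx
  exact (ih j hj).imp_left fun h => Set.mem_iUnion.2 ⟨j, h⟩

theorem size_replace_le {a : S.Srt} (k : Term S a) (n : ℕ) {b : S.Srt} (t : Term S b) :
    (replace k (var a n) t).size ≤ t.size := by
  refine replace_induction (P := fun t t' => t'.size ≤ t.size) (Nat.zero_le _)
    (fun _ _ => le_rfl) ?_ t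
  intro f args args' ih
  simp only [size]
  have := Finset.sum_le_sum (s := Finset.univ) fun j _ => ih j
  omega

/-- The occurrence in argument `j` alone saves `k.size`, and the other arguments do not grow because
a variable has size 0. -/
theorem IsSubterm.size_replace_add_le {a b : S.Srt} {k : Term S a} {t : Term S b}
    (h : k.IsSubterm t) (n : ℕ) : (replace k (var a n) t).size + k.size ≤ t.size := by
  induction h with
  | refl => rw [replace_self]; simp [size]
  | arg f args j h ih =>
    by_cases he : (⟨a, k⟩ : STerm S) = ⟨_, .app f args⟩
    · cases he; rw [replace_self]; simp [size]
    · rw [replace_app_of_ne he]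
      simp only [size]
      have h₁ := Finset.add_sum_erase Finset.univ (fun j => (args j).size) (Finset.mem_univ j)
      have h₂ := Finset.add_sum_erase Finset.univ
        (fun j => (replace k (var a n) (args j)).size) (Finset.mem_univ j)
      have h₃ := Finset.sum_le_sum (s := Finset.univ.erase j)
        fun i _ => size_replace_le k n (args i)
      omega

end Term

/-! ### Substitution into program terms, literals and clauses -/

namespace PTerm

theorem subst_subst (σ τ : Subst S) {s : S.Srt} (p : PTerm S s) :
    (p.subst σ).subst τ = p.subst (fun s n => (σ s n).subst τ) := by
  induction p with
  | simple t => simp only [subst, Term.subst_subst]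
  | ite l r p q ihp ihq => simp only [subst, Term.subst_subst, ihp, ihq]

theorem subst_var {s : S.Srt} (p : PTerm S s) : p.subst (fun s n => .var s n) = p := by
  induction p with
  | simple t => simp only [subst, Term.subst_var]
  | ite l r p q ihp ihq => simp only [subst, Term.subst_var, ihp, ihq]

theorem subst_congr {σ τ : Subst S} {s : S.Srt} {p : PTerm S s}
    (h : ∀ x ∈ p.vars, σ x.1 x.2 = τ x.1 x.2) : p.subst σ = p.subst τ := by
  induction p with
  | simple t =>
    simp only [vars] at h
    simp only [subst, Term.subst_congr h]
  | ite l r p q ihp ihq =>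
    simp only [vars, Set.mem_union] at h
    simp only [subst]
    rw [Term.subst_congr fun x hx => h x (.inl (.inl (.inl hx))),
      Term.subst_congr fun x hx => h x (.inl (.inl (.inr hx))),
      ihp fun x hx => h x (.inl (.inr hx)), ihq fun x hx => h x (.inr hx)]

theorem mem_vars_subst {σ : Subst S} {s : S.Srt} {p : PTerm S s} {x : Var S} :
    x ∈ (p.subst σ).vars ↔ ∃ y ∈ p.vars, x ∈ (σ y.1 y.2).vars := by
  induction p with
  | simple t => simp only [subst, vars, Term.mem_vars_subst]
  | ite l r p q ihp ihq =>
    simp only [subst, vars, Set.mem_union, Term.mem_vars_subst, ihp, ihq, or_and_right, exists_or]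

theorem vars_finite {s : S.Srt} (p : PTerm S s) : p.vars.Finite := by
  induction p with
  | simple t => simpa only [vars] using t.vars_finite
  | ite l r p q ihp ihq =>
    simpa only [vars] using ((l.vars_finite.union r.vars_finite).union ihp).union ihq

theorem computable_subst_iff {σ : Subst S} {s : S.Srt} {p : PTerm S s} :
    (p.subst σ).Computable c ↔ p.Computable c ∧ ∀ y ∈ p.vars, (σ y.1 y.2).Computable c := by
  induction p with
  | simple t => simp only [subst, vars, Computable, Term.computable_subst_iff]
  | ite l r p q ihp ihq =>
    simp only [subst, vars, Computable, Term.computable_subst_iff, ihp, ihq, Set.mem_union,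
      or_imp, forall_and]
    tauto

theorem Computable.of_subst {σ : Subst S} {s : S.Srt} {p : PTerm S s}
    (h : (p.subst σ).Computable c) : p.Computable c :=
  (computable_subst_iff.1 h).1

end PTerm

namespace Lit

theorem exists_eq (L : Lit S) : ∃ (a : S.Srt) (b : Bool) (u v : Term S a), L = ⟨a, b, s(u, v)⟩ := by
  obtain ⟨a, b, m⟩ := L
  induction m with
  | _ u v => exact ⟨a, b, u, v, rfl⟩

theorem vars_mk {a : S.Srt} (b : Bool) (u v : Term S a) :
    vars ⟨a, b, s(u, v)⟩ = u.vars ∪ v.vars := by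
  ext x; simp [vars]

theorem subst_mk (σ : Subst S) {a : S.Srt} (b : Bool) (u v : Term S a) :
    subst σ ⟨a, b, s(u, v)⟩ = ⟨a, b, s(u.subst σ, v.subst σ)⟩ := rfl

theorem subst_subst (σ τ : Subst S) (L : Lit S) :
    (L.subst σ).subst τ = L.subst (fun s n => (σ s n).subst τ) := by
  obtain ⟨a, b, u, v, rfl⟩ := L.exists_eq
  simp only [subst_mk, Term.subst_subst]

theorem subst_var (L : Lit S) : L.subst (fun s n => .var s n) = L := by
  obtain ⟨a, b, u, v, rfl⟩ := L.exists_eq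
  simp only [subst_mk, Term.subst_var]

theorem subst_congr {σ τ : Subst S} {L : Lit S}
    (h : ∀ x ∈ L.vars, σ x.1 x.2 = τ x.1 x.2) : L.subst σ = L.subst τ := by
  obtain ⟨a, b, u, v, rfl⟩ := L.exists_eq
  rw [vars_mk] at h
  simp only [subst_mk]
  rw [Term.subst_congr fun x hx => h x (.inl hx), Term.subst_congr fun x hx => h x (.inr hx)]

theorem mem_vars_subst {σ : Subst S} {L : Lit S} {x : Var S} :
    x ∈ (L.subst σ).vars ↔ ∃ y ∈ L.vars, x ∈ (σ y.1 y.2).vars := by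
  obtain ⟨a, b, u, v, rfl⟩ := L.exists_eq
  simp only [subst_mk, vars_mk, Set.mem_union, Term.mem_vars_subst, or_and_right, exists_or]

theorem vars_finite (L : Lit S) : L.vars.Finite := by
  obtain ⟨a, b, u, v, rfl⟩ := L.exists_eq
  rw [vars_mk]
  exact u.vars_finite.union v.vars_finite

theorem bag_mk_true {a : S.Srt} (u v : Term S a) :
    bag ⟨a, true, s(u, v)⟩ = {⟨a, u⟩, ⟨a, v⟩} := rfl

theorem bag_mk_false {a : S.Srt} (u v : Term S a) :
    bag ⟨a, false, s(u, v)⟩ = {⟨a, u⟩, ⟨a, v⟩} + {⟨a, u⟩, ⟨a, v⟩} := rfl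

theorem mem_bag_mk {a : S.Srt} {b : Bool} {u v : Term S a} {w : STerm S} :
    w ∈ bag ⟨a, b, s(u, v)⟩ ↔ w = ⟨a, u⟩ ∨ w = ⟨a, v⟩ := by
  cases b
  · rw [bag_mk_false]; simp
  · rw [bag_mk_true]; simp

/-- Substitution on terms of arbitrary sort. -/
def _root_.SynSup.STerm.subst (σ : Subst S) (t : STerm S) : STerm S := ⟨t.1, t.2.subst σ⟩

theorem bag_subst (σ : Subst S) (L : Lit S) : (L.subst σ).bag = L.bag.map (STerm.subst σ) := by
  obtain ⟨a, b, u, v, rfl⟩ := L.exists_eq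
  cases b
  · simp [subst_mk, bag_mk_false, STerm.subst]
  · simp [subst_mk, bag_mk_true, STerm.subst]

/-- All sides of the literal are computable. -/
def Computable (c : Set S.Fn) (L : Lit S) : Prop := ∀ w ∈ L.bag, w.2.Computable c

theorem computable_mk {a : S.Srt} {b : Bool} {u v : Term S a} :
    Computable c ⟨a, b, s(u, v)⟩ ↔ u.Computable c ∧ v.Computable c := by
  simp [Computable, mem_bag_mk]

theorem ground_mk {a : S.Srt} {b : Bool} {u v : Term S a} :
    vars ⟨a, b, s(u, v)⟩ = ∅ ↔ u.Ground ∧ v.Ground := by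
  rw [vars_mk, Set.union_empty_iff]; rfl

theorem ground_iff_bag {L : Lit S} : L.vars = ∅ ↔ ∀ w ∈ L.bag, w.2.Ground := by
  obtain ⟨a, b, u, v, rfl⟩ := L.exists_eq
  simp [ground_mk, mem_bag_mk]

end Lit

namespace Clause

theorem subst_subst (σ τ : Subst S) (C : Clause S) :
    (C.subst σ).subst τ = C.subst (fun s n => (σ s n).subst τ) := by
  simp only [subst, Multiset.map_map, Function.comp_def, Lit.subst_subst]

theorem subst_var (C : Clause S) : C.subst (fun s n => .var s n) = C := by
  simp only [subst, Lit.subst_var, Multiset.map_id']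

theorem subst_congr {σ τ : Subst S} {C : Clause S}
    (h : ∀ x ∈ C.vars, σ x.1 x.2 = τ x.1 x.2) : C.subst σ = C.subst τ :=
  Multiset.map_congr rfl fun L hL => Lit.subst_congr fun x hx => h x ⟨L, hL, hx⟩

theorem mem_vars_subst {σ : Subst S} {C : Clause S} {x : Var S} :
    x ∈ (C.subst σ).vars ↔ ∃ y ∈ C.vars, x ∈ (σ y.1 y.2).vars := by
  simp only [subst, vars, Multiset.mem_map, Set.mem_ofPred_eq]
  constructor
  · rintro ⟨_, ⟨L, hL, rfl⟩, hx⟩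
    obtain ⟨y, hy, hx⟩ := Lit.mem_vars_subst.1 hx
    exact ⟨y, ⟨L, hL, hy⟩, hx⟩
  · rintro ⟨y, ⟨L, hL, hy⟩, hx⟩
    exact ⟨_, ⟨L, hL, rfl⟩, Lit.mem_vars_subst.2 ⟨y, hy, hx⟩⟩

theorem vars_cons (L : Lit S) (C : Clause S) : vars (L ::ₘ C) = L.vars ∪ C.vars := by
  ext x; simp [vars]

theorem vars_add (C D : Clause S) : vars (C + D) = C.vars ∪ D.vars := by
  ext x; simp [vars, or_and_right, exists_or]

theorem vars_finite (C : Clause S) : C.vars.Finite := by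
  induction C using Multiset.induction with
  | empty => simp [vars]
  | cons L C ih => rw [vars_cons]; exact L.vars_finite.union ih

theorem subst_cons (σ : Subst S) (L : Lit S) (C : Clause S) :
    subst σ (L ::ₘ C) = L.subst σ ::ₘ subst σ C := Multiset.map_cons _ _ _

theorem subst_add (σ : Subst S) (C D : Clause S) : subst σ (C + D) = subst σ C + subst σ D :=
  Multiset.map_add _ _ _

/-- All literals of the clause are computable. -/
def Computable (c : Set S.Fn) (C : Clause S) : Prop := ∀ L ∈ C, L.Computable c

end Clause

namespace AnsClause

theorem subst_subst (σ τ : Subst S) (A : AnsClause S o) :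
    (A.subst σ).subst τ = A.subst (fun s n => (σ s n).subst τ) := by
  simp only [subst, Clause.subst_subst, PTerm.subst_subst]

theorem subst_var (A : AnsClause S o) : A.subst (fun s n => .var s n) = A := by
  simp only [subst, Clause.subst_var, PTerm.subst_var]

theorem subst_congr {σ τ : Subst S} {A : AnsClause S o}
    (h : ∀ x ∈ A.vars, σ x.1 x.2 = τ x.1 x.2) : A.subst σ = A.subst τ := by
  simp only [subst]
  rw [Clause.subst_congr fun x hx => h x (.inl hx), PTerm.subst_congr fun x hx => h x (.inr hx)]

theorem mem_vars_subst {σ : Subst S} {A : AnsClause S o} {x : Var S} :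
    x ∈ (A.subst σ).vars ↔ ∃ y ∈ A.vars, x ∈ (σ y.1 y.2).vars := by
  simp only [subst, vars, Set.mem_union, Clause.mem_vars_subst, PTerm.mem_vars_subst,
    or_and_right, exists_or]

theorem ground_subst_iff {σ : Subst S} {A : AnsClause S o} :
    (A.subst σ).Ground ↔ ∀ y ∈ A.vars, (σ y.1 y.2).Ground := by
  simp only [Ground, Term.Ground, Set.eq_empty_iff_forall_notMem, mem_vars_subst, not_exists,
    not_and]
  exact ⟨fun h y hy x => h x y hy, fun h x y hy => h y hy x⟩

theorem vars_finite (A : AnsClause S o) : A.vars.Finite :=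
  A.cl.vars_finite.union A.ans.vars_finite

theorem isVariant_refl (A : AnsClause S o) : A.IsVariant A :=
  ⟨fun _ => 1, A.subst_var.symm⟩

/-- Two answer clauses have variable-disjoint variants, of which the second is unchanged, and
instances of them can be taken by a single substitution. -/
theorem exists_variant (A B : AnsClause S o) (θ₁ θ₂ : Subst S) :
    ∃ (π : S.Srt → Equiv.Perm ℕ) (θ : Subst S),
      Disjoint (A.subst (fun s n => .var s (π s n))).vars B.vars ∧
      (∀ x ∈ A.vars, θ x.1 (π x.1 x.2) = θ₁ x.1 x.2) ∧
      ∀ x ∈ B.vars, θ x.1 x.2 = θ₂ x.1 x.2 := by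
  obtain ⟨K, hK⟩ := ((A.vars_finite.union B.vars_finite).image Prod.snd).bddAbove
  have hK' : ∀ x ∈ A.vars ∪ B.vars, x.2 < K + 1 := fun x hx =>
    Nat.lt_succ_of_le (hK ⟨x, hx, rfl⟩)
  generalize K + 1 = K at hK'
  -- The names below `K`, which include all names in `A` and `B`, are swapped with those in `[K,
  -- 2K)`.
  let f : ℕ → ℕ := fun n => if n < K then n + K else if n < 2 * K then n - K else n
  have hf : Function.Involutive f := by
    intro n
    simp only [f]
    split_ifs <;> omega
  have hfK : ∀ n < K, f n = n + K := fun n hn => if_pos hn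
  refine ⟨fun _ => hf.toPerm, fun s n => if n < K then θ₂ s n else θ₁ s (f n), ?_, ?_, ?_⟩
  · rw [Set.disjoint_left]
    intro x hx hx'
    obtain ⟨y, hy, hxy⟩ := mem_vars_subst.1 hx
    obtain rfl : x = (y.1, f y.2) := hxy
    have := hK' _ (.inl hy)
    have := hK' _ (.inr hx')
    simp only [hfK _ (hK' _ (.inl hy))] at this
    omega
  · intro x hx
    have hx := hK' _ (.inl hx)
    have h1 : ¬ f x.2 < K := by rw [hfK _ hx]; omega
    change (if f x.2 < K then _ else _) = _
    rw [if_neg h1]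
    exact congrArg (θ₁ x.1) (hf x.2)
  · intro x hx
    exact if_pos (hK' _ (.inr hx))

end AnsClause

end SynSup

end

noncomputable section

namespace SynSup

open scoped Classical

variable {S : Sig} {o : S.Srt} {c : Set S.Fn}

/-! ## Unification -/

theorem updateVar_same {T : Type} {A : T → Type} (v : ∀ s : T, ℕ → A s) (s : T) (n : ℕ) (a : A s) :
    updateVar v s n a s n = a := by
  simp [updateVar]

theorem updateVar_of_ne {T : Type} {A : T → Type} (v : ∀ s : T, ℕ → A s) {s : T} {n : ℕ} (a : A s)
    {s' : T} {n' : ℕ} (h : ((s', n') : T × ℕ) ≠ (s, n)) : updateVar v s n a s' n' = v s' n' := by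
  unfold updateVar
  by_cases hs : s' = s
  · subst hs
    have hn : n' ≠ n := fun hn => h (by rw [hn])
    simp [hn]
  · simp [hs]

theorem Term.subst_updateVar_of_notMem {σ : Subst S} {x : Var S} {u : Term S x.1} {a : S.Srt}
    {t : Term S a} (h : x ∉ t.vars) : t.subst (updateVar σ x.1 x.2 u) = t.subst σ :=
  subst_congr fun y hy => updateVar_of_ne _ _ fun he => h ((show y = x from he) ▸ hy)

/-- The number of occurrences of function symbols and variables. -/
def Term.length : ∀ {s : S.Srt}, Term S s → ℕ
  | _, .var _ _ => 1
  | _, .app _ args => 1 + ∑ j, (args j).length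

/-- A system of equations between terms. -/
abbrev EqSystem (S : Sig) : Type := List (STerm S × STerm S)

namespace EqSystem

def vars (E : EqSystem S) : Set (Var S) := {x | ∃ e ∈ E, x ∈ e.1.2.vars ∪ e.2.2.vars}

def length (E : EqSystem S) : ℕ := (E.map fun e => e.1.2.length + e.2.2.length).sum

def Solves (E : EqSystem S) (θ : Subst S) : Prop := ∀ e ∈ E, STerm.subst θ e.1 = STerm.subst θ e.2

def subst (σ : Subst S) (E : EqSystem S) : EqSystem S :=
  E.map fun e => (STerm.subst σ e.1, STerm.subst σ e.2)

theorem vars_finite (E : EqSystem S) : E.vars.Finite := by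
  have : E.vars = ⋃ e ∈ {e | e ∈ E}, (e.1.2.vars ∪ e.2.2.vars) := by ext x; simp [vars]
  rw [this]
  exact (List.finite_toSet E).biUnion fun e _ => e.1.2.vars_finite.union e.2.2.vars_finite

theorem solves_subst {σ θ : Subst S} {E : EqSystem S} :
    (E.subst σ).Solves θ ↔ E.Solves (fun s n => (σ s n).subst θ) := by
  simp only [Solves, subst, List.forall_mem_map, STerm.subst, Term.subst_subst]

theorem solves_cons {e : STerm S × STerm S} {E : EqSystem S} {θ : Subst S} :
    Solves (e :: E) θ ↔ STerm.subst θ e.1 = STerm.subst θ e.2 ∧ E.Solves θ := by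
  simp [Solves]

end EqSystem

theorem IsMgu.congr {U U' : Subst S → Prop} (h : ∀ θ, U θ ↔ U' θ) {σ : Subst S} (hσ : IsMgu U σ) :
    IsMgu U' σ := by
  have : U = U' := funext fun θ => propext (h θ)
  exact this ▸ hσ

/-- The occurs check: `θ x` is a proper subterm of the instance of `u`, hence has fewer function
symbols. -/
theorem Term.subst_var_ne_of_mem_vars {x : Var S} {u : Term S x.1} (hx : x ∈ u.vars)
    (hu : u ≠ .var x.1 x.2) (θ : Subst S) : θ x.1 x.2 ≠ u.subst θ := by
  obtain ⟨s, n⟩ := x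
  suffices (θ s n).size < (u.subst θ).size from fun h => by
    have h : θ s n = u.subst θ := h
    rw [← h] at this
    exact this.false
  generalize hs : (⟨s, u⟩ : STerm S) = w
  obtain ⟨b, w⟩ := w
  have hw : (s, n) ∈ w.vars := by cases hs; exact hx
  have hw' : (⟨b, w⟩ : STerm S) ≠ ⟨s, .var s n⟩ := by
    rw [← hs]; intro h; cases h; exact hu rfl
  suffices (θ s n).size < (w.subst θ).size by cases hs; exact this
  cases w with
  | var s' n' => cases hw; exact (hw' rfl).elim
  | app f args =>
    obtain ⟨j, hj⟩ := Set.mem_iUnion.1 hw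
    have h₁ := ((Term.isSubterm_of_mem_vars hj).subst θ).size_le
    have h₂ := Finset.single_le_sum (f := fun j => ((args j).subst θ).size)
      (fun _ _ => Nat.zero_le _) (Finset.mem_univ j)
    simp only [Term.subst, size] at *
    omega

namespace EqSystem

/-- Elimination of a variable. -/
theorem exists_mgu_of_elim {x : Var S} {u : Term S x.1} (hx : x ∉ u.vars) {E : EqSystem S}
    (h : ∃ σ, IsMgu (E.subst (updateVar (fun s n => .var s n) x.1 x.2 u)).Solves σ) :
    ∃ σ, IsMgu (Solves ((⟨x.1, .var x.1 x.2⟩, ⟨x.1, u⟩) :: E)) σ := by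
  obtain ⟨σ, hfin, hσ, hmg⟩ := h
  set ρ : Subst S := updateVar (fun s n => .var s n) x.1 x.2 u with hρ
  have hρu : u.subst ρ = u := by rw [hρ, Term.subst_updateVar_of_notMem hx, Term.subst_var]
  have hρx : ρ x.1 x.2 = u := updateVar_same _ _ _ _
  refine ⟨fun s n => (ρ s n).subst σ, ?_, ?_, ?_⟩
  · refine (hfin.union (Set.finite_singleton x)).subset fun y hy => ?_
    by_cases hyx : y = x
    · exact .inr hyx
    · refine .inl ?_
      have : ρ y.1 y.2 = .var y.1 y.2 := updateVar_of_ne _ _ hyx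
      simpa only [Set.mem_ofPred_eq, this, Term.subst] using hy
  · refine solves_cons.2 ⟨?_, solves_subst.1 hσ⟩
    simp only [STerm.subst, Term.subst, ← Term.subst_subst, hρu, hρx]
  · intro θ hθ
    obtain ⟨h₁, h₂⟩ := solves_cons.1 hθ
    have h₁ : θ x.1 x.2 = u.subst θ := by simpa [STerm.subst, Term.subst] using h₁
    -- A substitution that solves `x ≃ u` absorbs the elimination `ρ`.
    have hθρ : ∀ s n, (ρ s n).subst θ = θ s n := by
      intro s n
      by_cases hsn : ((s, n) : Var S) = x
      · subst hsn; rw [hρx, h₁]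
      · rw [hρ, updateVar_of_ne _ _ hsn]; rfl
    obtain ⟨τ, hτ⟩ := hmg θ (solves_subst.2 (by simpa only [hθρ] using h₂))
    refine ⟨τ, fun s n => ?_⟩
    rw [Term.subst_subst, ← hθρ s n]
    exact Term.subst_congr fun y _ => hτ y.1 y.2

/-- A trivial equation is dropped, which shortens the system without adding variables. Otherwise the
occurs check allows elimination of `x`, which lowers the number of variables, whatever happens to
the length. -/
theorem exists_mgu_cons_var (x : Var S) (u : STerm S) (E : EqSystem S)
    (ih : ∀ E' : EqSystem S, E'.vars.ncard < (vars ((⟨x.1, .var x.1 x.2⟩, u) :: E)).ncard ∨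
      E'.vars.ncard ≤ (vars ((⟨x.1, .var x.1 x.2⟩, u) :: E)).ncard ∧
        E'.length < length ((⟨x.1, .var x.1 x.2⟩, u) :: E) →
      (∃ θ, E'.Solves θ) → ∃ σ, IsMgu E'.Solves σ)
    (h : ∃ θ, Solves ((⟨x.1, .var x.1 x.2⟩, u) :: E) θ) :
    ∃ σ, IsMgu (Solves ((⟨x.1, .var x.1 x.2⟩, u) :: E)) σ := by
  obtain ⟨θ, hθ⟩ := h
  obtain ⟨h₁, h₂⟩ := solves_cons.1 hθ
  obtain ⟨s, u⟩ := u
  obtain rfl : x.1 = s := congrArg Sigma.fst h₁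
  by_cases hux : u = .var x.1 x.2
  · subst hux
    obtain ⟨σ, hσ⟩ := ih E (.inr ⟨Set.ncard_le_ncard
      (fun y ⟨e, he, hy⟩ => ⟨e, List.mem_cons_of_mem _ he, hy⟩) (vars_finite _), by
        simp [length, Term.length]⟩) ⟨θ, h₂⟩
    exact ⟨σ, hσ.congr fun θ => by simp [solves_cons]⟩
  · have h₁ : θ x.1 x.2 = u.subst θ := by simpa [STerm.subst, Term.subst] using h₁
    have hx : x ∉ u.vars := fun hx => Term.subst_var_ne_of_mem_vars hx hux θ h₁
    refine exists_mgu_of_elim hx (ih _ (.inl ?_) ⟨θ, solves_subst.2 ?_⟩)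
    · refine Set.ncard_lt_ncard ⟨?_, fun hsub => ?_⟩ (vars_finite _)
      · rintro y ⟨_, he', hy⟩
        obtain ⟨e, he, rfl⟩ := List.mem_map.1 he'
        simp only [STerm.subst, Set.mem_union, Term.mem_vars_subst, ← or_and_right,
          ← exists_or] at hy
        obtain ⟨z, hz, hy⟩ := hy
        by_cases hzx : z = x
        · subst hzx
          rw [updateVar_same] at hy
          exact ⟨_, List.mem_cons_self, .inr hy⟩
        · rw [updateVar_of_ne _ _ hzx] at hy
          cases hy
          exact ⟨e, List.mem_cons_of_mem _ he, hz⟩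
      · obtain ⟨_, he, hy⟩ := @hsub x ⟨_, List.mem_cons_self, .inl rfl⟩
        obtain ⟨e, he, rfl⟩ := List.mem_map.1 he
        simp only [STerm.subst, Set.mem_union, Term.mem_vars_subst, ← or_and_right,
          ← exists_or] at hy
        obtain ⟨z, hz, hy⟩ := hy
        by_cases hzx : z = x
        · subst hzx
          rw [updateVar_same] at hy
          exact hx hy
        · rw [updateVar_of_ne _ _ hzx] at hy
          cases hy
          exact hzx rfl
    · convert h₂ using 3 with s n
      by_cases hsn : ((s, n) : Var S) = x
      · subst hsn; rw [updateVar_same]; exact h₁.symm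
      · rw [updateVar_of_ne _ _ hsn]; rfl

/-- Solvable systems of equations have most general solutions. -/
theorem exists_mgu (E : EqSystem S) (h : ∃ θ, E.Solves θ) : ∃ σ, IsMgu E.Solves σ := by
  -- Lexicographic induction: first on the number of variables, then on the length.
  induction hN : E.vars.ncard using Nat.strong_induction_on generalizing E with
  | _ N ihN =>
  induction hM : E.length using Nat.strong_induction_on generalizing E with
  | _ M ihM =>
  subst hN hM
  have ih : ∀ E' : EqSystem S, E'.vars.ncard < E.vars.ncard ∨
      E'.vars.ncard ≤ E.vars.ncard ∧ E'.length < E.length →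
      (∃ θ, E'.Solves θ) → ∃ σ, IsMgu E'.Solves σ := by
    rintro E' (h | ⟨h, h'⟩) hE'
    · exact ihN _ h E' hE' rfl
    · rcases h.lt_or_eq with h | h
      · exact ihN _ h E' hE' rfl
      · exact ihM _ h' E' hE' h rfl
  clear ihN ihM
  match E, h, ih with
  | [], _, _ =>
    exact ⟨fun s n => .var s n, by simp, by simp [Solves], fun θ _ => ⟨θ, fun _ _ => rfl⟩⟩
  | (⟨_, .var s n⟩, u) :: E, h, ih => exact exists_mgu_cons_var (s, n) u E ih h
  | (u, ⟨_, .var s n⟩) :: E, h, ih =>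
    have hs : ∀ θ, Solves ((⟨s, .var s n⟩, u) :: E) θ ↔ Solves ((u, ⟨s, .var s n⟩) :: E) θ :=
      fun θ => by simp only [solves_cons]; tauto
    have hv : vars ((⟨s, .var s n⟩, u) :: E) = vars ((u, ⟨s, .var s n⟩) :: E) := by
      ext x; simp [vars, or_comm]
    have hl : length ((⟨s, .var s n⟩, u) :: E) = length ((u, ⟨s, .var s n⟩) :: E) := by
      simp [length, add_comm]
    obtain ⟨σ, hσ⟩ := exists_mgu_cons_var (s, n) u E (by rw [hv, hl]; exact ih)
      (h.imp fun θ => (hs θ).2)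
    exact ⟨σ, hσ.congr hs⟩
  | (⟨_, .app f as⟩, ⟨_, .app g bs⟩) :: E, ⟨θ, hθ⟩, ih =>
    have h₁ := (solves_cons.1 hθ).1
    simp only [STerm.subst, Term.subst] at h₁
    cases congrArg Sigma.fst (Term.sigma_app_inj h₁)
    have hs : ∀ θ, Solves (List.ofFn (fun j => ((⟨_, as j⟩, ⟨_, bs j⟩) : STerm S × STerm S)) ++ E) θ
        ↔ Solves ((⟨_, .app f as⟩, ⟨_, .app f bs⟩) :: E) θ := by
      intro θ
      simp only [Solves, List.mem_append, List.mem_cons, or_imp, forall_and, List.mem_ofFn,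
        forall_exists_index, forall_apply_eq_imp_iff, forall_eq]
      refine and_congr_left fun _ => ?_
      simp [STerm.subst, Term.subst, funext_iff]
    -- Decomposition keeps the variables and removes the two occurrences of `f`.
    refine (ih _ (.inr ⟨Set.ncard_le_ncard ?_ (vars_finite _), ?_⟩) ⟨θ, (hs θ).2 hθ⟩).imp
      fun σ hσ => hσ.congr hs
    · rintro y ⟨e, he, hy⟩
      rcases List.mem_append.1 he with he | he
      · obtain ⟨j, rfl⟩ := List.mem_ofFn.1 he
        exact ⟨_, List.mem_cons_self, hy.imp (fun h => Set.mem_iUnion.2 ⟨j, h⟩)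
          fun h => Set.mem_iUnion.2 ⟨j, h⟩⟩
      · exact ⟨e, List.mem_cons_of_mem _ he, hy⟩
    · simp only [length, List.map_append, List.map_ofFn, List.sum_append, List.sum_ofFn,
        List.map_cons, List.sum_cons, Function.comp_def, Term.length, Finset.sum_add_distrib]
      omega

end EqSystem

theorem exists_mgu_term {a : S.Srt} {l k : Term S a} {θ : Subst S} (h : l.subst θ = k.subst θ) :
    ∃ σ, IsMgu (fun θ => l.subst θ = k.subst θ) σ := by
  have hs : ∀ θ, EqSystem.Solves [(⟨a, l⟩, ⟨a, k⟩)] θ ↔ l.subst θ = k.subst θ := by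
    simp [EqSystem.Solves, STerm.subst]
  obtain ⟨σ, hσ⟩ := EqSystem.exists_mgu _ ⟨θ, (hs θ).2 h⟩
  exact ⟨σ, hσ.congr hs⟩

theorem exists_mgu_term_simple {a : S.Srt} {l k : Term S a} {p q : Term S o} {θ : Subst S}
    (h : l.subst θ = k.subst θ) (h' : p.subst θ = q.subst θ) :
    ∃ σ, IsMgu (fun θ => l.subst θ = k.subst θ ∧
      (PTerm.simple p).subst θ = (PTerm.simple q).subst θ) σ := by
  have hs : ∀ θ, EqSystem.Solves [(⟨a, l⟩, ⟨a, k⟩), (⟨o, p⟩, ⟨o, q⟩)] θ ↔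
      l.subst θ = k.subst θ ∧ (PTerm.simple p).subst θ = (PTerm.simple q).subst θ := by
    simp [EqSystem.Solves, STerm.subst, PTerm.subst]
  obtain ⟨σ, hσ⟩ := EqSystem.exists_mgu _ ⟨θ, (hs θ).2 ⟨h, by simp [PTerm.subst, h']⟩⟩
  exact ⟨σ, hσ.congr hs⟩

end SynSup

end

noncomputable section

namespace SynSup

open scoped Classical

variable {S : Sig} {o : S.Srt} {c : Set S.Fn}

/-! ## Bag extensions -/

section Bag

variable {α β : Type} {R : α → α → Prop}

theorem BagGt.trans {M N P : Multiset α} (h : BagGt R M N) (h' : BagGt R N P) : BagGt R M P :=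
  Relation.TransGen.trans h' h

theorem bagGt_wf (h : WellFounded (fun a b => R b a)) :
    WellFounded (fun M N : Multiset α => BagGt R N M) :=
  h.cutExpand.transGen

theorem BagGt.add_left {M N : Multiset α} (h : BagGt R M N) (X : Multiset α) :
    BagGt R (X + M) (X + N) :=
  Relation.TransGen.lift (X + ·) (fun _ _ h => (Relation.cutExpand_add_left X).2 h) _ _ h

theorem BagGt.add_right {M N : Multiset α} (h : BagGt R M N) (X : Multiset α) :
    BagGt R (M + X) (N + X) := by
  simpa only [add_comm] using h.add_left X

/-- The elements of `Z` are expanded one after another: each turns into the elements of `Y` still to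
be produced that lie below it, and the last one has to produce all that remain. -/
theorem bagGt_of_forall {Z Y : Multiset α} (hZ : Z ≠ 0) (h : ∀ y ∈ Y, ∃ z ∈ Z, R z y) :
    BagGt R Z Y := by
  induction Z using Multiset.induction generalizing Y with
  | empty => exact (hZ rfl).elim
  | cons z Z ih =>
    by_cases hZ' : Z = 0
    · subst hZ'
      exact .single (Relation.cutExpand_singleton (x := z) fun y hy => by simpa using h y hy)
    · have h₁ : BagGt R (z ::ₘ Z) (Y.filter (R z) + Z) := by
        rw [← Multiset.singleton_add]
        refine BagGt.add_right (.single (Relation.cutExpand_singleton (x := z) fun y hy => ?_)) Z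
        exact (Multiset.mem_filter.1 hy).2
      refine h₁.trans ?_
      conv =>
        arg 3
        rw [← Multiset.filter_add_not (R z) Y]
      refine BagGt.add_left (ih hZ' fun y hy => ?_) _
      obtain ⟨hy, hzy⟩ := Multiset.mem_filter.1 hy
      obtain ⟨z', hz', hR⟩ := h y hy
      rcases Multiset.mem_cons.1 hz' with rfl | hz'
      · exact (hzy hR).elim
      · exact ⟨z', hz', hR⟩

theorem bagGt_cons_of_forall {x : α} {Y : Multiset α} (X : Multiset α) (h : ∀ y ∈ Y, R x y) :
    BagGt R (x ::ₘ X) (Y + X) := by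
  rw [← Multiset.singleton_add]
  exact (bagGt_of_forall (Multiset.singleton_ne_zero x) fun y hy =>
    ⟨x, Multiset.mem_singleton_self x, h y hy⟩).add_right X

/-- Each expansion step adds only elements below the one it removes, and such bounds compose by
transitivity. -/
theorem BagGt.exists_ge (hirr : ∀ a, ¬ R a a) (hR : ∀ a b d, R a b → R b d → R a d)
    {M N : Multiset α} (h : BagGt R M N) : ∀ y ∈ N, ∃ x ∈ M, x = y ∨ R x y := by
  have : Std.Irrefl (fun a b => R b a) := ⟨hirr⟩
  induction h with
  | single h =>
    obtain ⟨t, a, ht, ha, rfl⟩ := Relation.cutExpand_iff.1 h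
    intro y hy
    rcases Multiset.mem_add.1 hy with hy | hy
    · exact ⟨y, Multiset.mem_of_mem_erase hy, .inl rfl⟩
    · exact ⟨a, ha, .inr (ht y hy)⟩
  | tail _ h ih =>
    obtain ⟨t, a, ht, ha, rfl⟩ := Relation.cutExpand_iff.1 h
    intro y hy
    obtain ⟨x, hx, hxy⟩ := ih y hy
    rcases Multiset.mem_add.1 hx with hx | hx
    · exact ⟨x, Multiset.mem_of_mem_erase hx, hxy⟩
    · refine ⟨a, ha, .inr ?_⟩
      rcases hxy with rfl | hxy
      · exact ht _ hx
      · exact hR _ _ _ (ht _ hx) hxy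

theorem BagGt.map {R' : β → β → Prop} (f : α → β) (hf : ∀ a b, R a b → R' (f a) (f b))
    {M N : Multiset α} (h : BagGt R M N) : BagGt R' (M.map f) (N.map f) := by
  refine Relation.TransGen.lift (Multiset.map f) ?_ _ _ h
  rintro _ _ ⟨t, a, ht, he⟩
  refine ⟨t.map f, f a, ?_, ?_⟩
  · intro b hb
    obtain ⟨a', ha', rfl⟩ := Multiset.mem_map.1 hb
    exact hf _ _ (ht a' ha')
  · simpa using congrArg (Multiset.map f) he

/-- The induction needs both conclusions: the weak one for the tail when the head decreases, the
strict one when the decrease occurs in the tail. -/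
theorem map_eq_or_bagGt {R' : β → β → Prop} {f g : α → β} {M : Multiset α}
    (h : ∀ x ∈ M, f x = g x ∨ R' (f x) (g x)) :
    (M.map f = M.map g ∨ BagGt R' (M.map f) (M.map g)) ∧
      ((∃ x ∈ M, R' (f x) (g x)) → BagGt R' (M.map f) (M.map g)) := by
  induction M using Multiset.induction with
  | empty => simp
  | cons a M ih =>
    obtain ⟨ih₁, ih₂⟩ := ih fun x hx => h x (Multiset.mem_cons_of_mem hx)
    simp only [Multiset.map_cons]
    have key : R' (f a) (g a) → BagGt R' (f a ::ₘ M.map f) (g a ::ₘ M.map g) := by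
      intro hR
      have h₁ : BagGt R' (f a ::ₘ M.map f) (g a ::ₘ M.map f) := by
        rw [← Multiset.singleton_add (g a)]
        exact bagGt_cons_of_forall _ (by simpa using hR)
      rcases ih₁ with ih₁ | ih₁
      · rw [← ih₁]; exact h₁
      · refine h₁.trans ?_
        simpa only [Multiset.singleton_add] using ih₁.add_left {g a}
    rcases h a (Multiset.mem_cons_self a M) with he | hR
    · rw [he]
      have lift : BagGt R' (M.map f) (M.map g) →
          BagGt R' (g a ::ₘ M.map f) (g a ::ₘ M.map g) := fun h => by
        simpa only [Multiset.singleton_add] using h.add_left {g a}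
      refine ⟨ih₁.imp (fun h => by rw [h]) lift, ?_⟩
      rintro ⟨x, hx, hxR⟩
      rcases Multiset.mem_cons.1 hx with rfl | hx
      · exact he ▸ key hxR
      · exact lift (ih₂ ⟨x, hx, hxR⟩)
    · exact ⟨.inr (key hR), fun _ => key hR⟩

theorem exists_maximal_mem (hirr : ∀ a, ¬ R a a) (hR : ∀ a b d, R a b → R b d → R a d)
    {M : Multiset α} (hM : M ≠ 0) : ∃ x ∈ M, ∀ y ∈ M, ¬ R y x := by
  induction M using Multiset.induction with
  | empty => exact (hM rfl).elim
  | cons a M ih =>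
    by_cases hM' : M = 0
    · subst hM'
      exact ⟨a, by simp, by simpa using hirr a⟩
    · obtain ⟨x, hx, hmax⟩ := ih hM'
      by_cases hax : R a x
      · refine ⟨a, Multiset.mem_cons_self a M, fun y hy hya => ?_⟩
        rcases Multiset.mem_cons.1 hy with rfl | hy
        · exact hirr _ hya
        · exact hmax y hy (hR _ _ _ hya hax)
      · refine ⟨x, Multiset.mem_cons_of_mem hx, fun y hy hyx => ?_⟩
        rcases Multiset.mem_cons.1 hy with rfl | hy
        · exact hax hyx
        · exact hmax y hy hyx

end Bag

/-! ## Simplification orders -/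

theorem Clause.ground_of_mem {C : Clause S} (h : C.vars = ∅) {L : Lit S} (hL : L ∈ C) :
    L.vars = ∅ :=
  Set.eq_empty_iff_forall_notMem.2 fun x hx =>
    Set.eq_empty_iff_forall_notMem.1 h x ⟨L, hL, hx⟩

namespace IsPartitionedSimplificationOrder

variable {gt : STerm S → STerm S → Prop}

theorem irrefl (hgt : IsPartitionedSimplificationOrder c gt) (t : STerm S) : ¬ gt t t := fun h =>
  hgt.wf.asymmetric _ _ h h

theorem asymm (hgt : IsPartitionedSimplificationOrder c gt) {t u : STerm S} (h : gt t u) :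
    ¬ gt u t := fun h' =>
  hgt.wf.asymmetric _ _ h h'

/-- This is the partition condition read backwards: an uncomputable `u` would exceed `t`. It makes
computability of ground terms a downward closed property. -/
theorem computable_of_gt (hgt : IsPartitionedSimplificationOrder c gt) {t u : STerm S}
    (ht : t.2.Ground) (hu : u.2.Ground)
    (htc : t.2.Computable c) (h : gt t u) : u.2.Computable c := by
  by_contra huc
  exact hgt.asymm h (hgt.partitioned u t hu ht huc htc)

/-- `context` changes a single argument. The arguments are therefore exchanged one by one along a
finite set `T`, and the mixed terms form a weakly decreasing chain. -/
theorem gt_app (hgt : IsPartitionedSimplificationOrder c gt) {f : S.Fn}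
    {args args' : ∀ j : Fin (S.dom f).length, Term S ((S.dom f).get j)}
    (h : ∀ j, args' j = args j ∨ gt ⟨_, args j⟩ ⟨_, args' j⟩) (hne : args' ≠ args) :
    gt ⟨_, .app f args⟩ ⟨_, .app f args'⟩ := by
  have key : ∀ T : Finset (Fin (S.dom f).length), (∀ j ∈ T, args' j = args j) ∨
      gt ⟨_, .app f args⟩ ⟨_, .app f (fun j => if j ∈ T then args' j else args j)⟩ := by
    intro T
    induction T using Finset.induction with
    | empty => exact .inl (by simp)
    | insert i T hi ih =>
      have hup : (fun j => if j ∈ insert i T then args' j else args j) =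
          Function.update (fun j => if j ∈ T then args' j else args j) i (args' i) := by
        funext j
        by_cases hj : j = i
        · subst hj; simp
        · simp [hj]
      have hmix : (fun j => if j ∈ T then args' j else args j) i = args i := if_neg hi
      have step : gt ⟨_, args i⟩ ⟨_, args' i⟩ →
          gt ⟨_, .app f (fun j => if j ∈ T then args' j else args j)⟩
            ⟨_, .app f (fun j => if j ∈ insert i T then args' j else args j)⟩ := by
        intro hg
        rw [hup]
        exact hgt.context f _ i _ (by simpa only [hi, if_false] using hg)
      rcases ih with ih | ih
      · rcases h i with hi' | hi'
        · refine .inl fun j hj => ?_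
          rcases Finset.mem_insert.1 hj with rfl | hj
          · exact hi'
          · exact ih j hj
        · refine .inr ?_
          have := step hi'
          rwa [show (fun j => if j ∈ T then args' j else args j) = args from funext fun j => by
            split_ifs with hj
            · exact ih j hj
            · rfl] at this
      · rcases h i with hi' | hi'
        · refine .inr ?_
          rw [hup, hi', ← hmix, Function.update_eq_self]
          exact ih
        · exact .inr (hgt.trans _ _ _ ih (step hi'))
  rcases key Finset.univ with h | h
  · exact (hne (funext fun j => h j (Finset.mem_univ j))).elim
  · simpa using h

theorem gt_of_isSubterm (hgt : IsPartitionedSimplificationOrder c gt) {a b : S.Srt} {k : Term S a}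
    {t : Term S b} (h : k.IsSubterm t) :
    (⟨a, k⟩ : STerm S) = ⟨b, t⟩ ∨ gt ⟨b, t⟩ ⟨a, k⟩ := by
  induction h with
  | refl => exact .inl rfl
  | arg f args j _ ih =>
    refine .inr ?_
    rcases ih with ih | ih
    · rw [ih]; exact hgt.subterm f args j
    · exact hgt.trans _ _ _ (hgt.subterm f args j) ih

theorem subst_ge (hgt : IsPartitionedSimplificationOrder c gt) {θ θ' : Subst S} {a : S.Srt}
    {t : Term S a}
    (h : ∀ x ∈ t.vars, θ' x.1 x.2 = θ x.1 x.2 ∨ gt ⟨_, θ x.1 x.2⟩ ⟨_, θ' x.1 x.2⟩) :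
    (t.subst θ' = t.subst θ ∨ gt ⟨a, t.subst θ⟩ ⟨a, t.subst θ'⟩) ∧
      ((∃ x ∈ t.vars, gt ⟨_, θ x.1 x.2⟩ ⟨_, θ' x.1 x.2⟩) →
        gt ⟨a, t.subst θ⟩ ⟨a, t.subst θ'⟩) := by
  induction t with
  | var s n =>
    refine ⟨h (s, n) rfl, ?_⟩
    rintro ⟨x, rfl, hx⟩
    exact hx
  | app f args ih =>
    have ih := fun j => ih j fun x hx => h x (Set.mem_iUnion.2 ⟨j, hx⟩)
    simp only [Term.subst]
    constructor
    · by_cases he : (fun j => (args j).subst θ') = fun j => (args j).subst θ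
      · exact .inl (congrArg _ he)
      · exact .inr (hgt.gt_app (fun j => (ih j).1) he)
    · rintro ⟨x, hx, hxg⟩
      obtain ⟨j, hj⟩ := Set.mem_iUnion.1 hx
      have hj := (ih j).2 ⟨x, hj, hxg⟩
      refine hgt.gt_app (fun j => (ih j).1) fun he => ?_
      rw [congrFun he j] at hj
      exact hgt.irrefl _ hj

theorem replace_ge (hgt : IsPartitionedSimplificationOrder c gt) {θ : Subst S} {a : S.Srt}
    {k r : Term S a}
    (h : gt ⟨a, k.subst θ⟩ ⟨a, r.subst θ⟩) {b : S.Srt} (t : Term S b) :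
    (Term.replace k r t).subst θ = t.subst θ ∨
      gt ⟨b, t.subst θ⟩ ⟨b, (Term.replace k r t).subst θ⟩ := by
  refine Term.replace_induction
    (P := fun {b} t t' => t'.subst θ = t.subst θ ∨ gt ⟨b, t.subst θ⟩ ⟨b, t'.subst θ⟩)
    (.inr h) (fun _ _ => .inl rfl) ?_ t
  intro f args args' ih
  simp only [Term.subst]
  by_cases he : (fun j => (args' j).subst θ) = fun j => (args j).subst θ
  · exact .inl (congrArg _ he)
  · exact .inr (hgt.gt_app ih he)

/-- Replacement acts on all occurrences, so several arguments may decrease at once; the argument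
containing the given occurrence makes the decrease strict. -/
theorem replace_gt (hgt : IsPartitionedSimplificationOrder c gt) {θ : Subst S} {a : S.Srt}
    {k r : Term S a}
    (h : gt ⟨a, k.subst θ⟩ ⟨a, r.subst θ⟩) {b : S.Srt} {t : Term S b} (ht : k.IsSubterm t) :
    gt ⟨b, t.subst θ⟩ ⟨b, (Term.replace k r t).subst θ⟩ := by
  induction ht with
  | refl => rw [Term.replace_self]; exact h
  | arg f args j _ ih =>
    by_cases he : (⟨a, k⟩ : STerm S) = ⟨_, .app f args⟩
    · cases he; rw [Term.replace_self]; exact h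
    · rw [Term.replace_app_of_ne he]
      simp only [Term.subst]
      refine hgt.gt_app (fun j => hgt.replace_ge h (args j)) fun he => ?_
      rw [← congrFun he j] at ih
      exact hgt.irrefl _ ih

theorem litGt_irrefl (hgt : IsPartitionedSimplificationOrder c gt) (L : Lit S) : ¬ LitGt gt L L :=
    fun h =>
  (bagGt_wf hgt.wf).asymmetric _ _ h h

theorem clauseGt_wf (hgt : IsPartitionedSimplificationOrder c gt) : WellFounded
    (fun C D : Clause S => ClauseGt gt D C) :=
  bagGt_wf (R := LitGt gt) (InvImage.wf Lit.bag (bagGt_wf hgt.wf))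

theorem clauseGt_irrefl (hgt : IsPartitionedSimplificationOrder c gt) (C : Clause S) :
    ¬ ClauseGt gt C C := fun h =>
  hgt.clauseGt_wf.asymmetric _ _ h h

theorem litGt_subst (hgt : IsPartitionedSimplificationOrder c gt) {L K : Lit S} (h : LitGt gt L K)
    (σ : Subst S) :
    LitGt gt (L.subst σ) (K.subst σ) := by
  unfold LitGt
  rw [Lit.bag_subst, Lit.bag_subst]
  exact BagGt.map _ (fun a b => hgt.subst σ a.1 b.1 a.2 b.2) h

/-- Selection lifts from an instance to the clause because the literal order is stable under
substitution. -/
theorem selected_of_subst (hgt : IsPartitionedSimplificationOrder c gt) {L : Lit S} {C : Clause S}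
    {σ : Subst S}
    (h : ∀ K ∈ C.subst σ, ¬ LitGt gt K (L.subst σ)) : Selected gt L C := fun _ hK hKL =>
  h _ (Multiset.mem_map_of_mem _ hK) (hgt.litGt_subst hKL σ)

/-- Decreasing a substitution decreases a clause. -/
theorem clauseGt_subst (hgt : IsPartitionedSimplificationOrder c gt) {θ θ' : Subst S} {C : Clause S}
    (h : ∀ x ∈ C.vars, θ' x.1 x.2 = θ x.1 x.2 ∨ gt ⟨_, θ x.1 x.2⟩ ⟨_, θ' x.1 x.2⟩)
    (hlt : ∃ x ∈ C.vars, gt ⟨_, θ x.1 x.2⟩ ⟨_, θ' x.1 x.2⟩) :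
    ClauseGt gt (C.subst θ) (C.subst θ') := by
  have hL : ∀ L ∈ C, (L.subst θ = L.subst θ' ∨ LitGt gt (L.subst θ) (L.subst θ')) ∧
      ((∃ x ∈ L.vars, gt ⟨_, θ x.1 x.2⟩ ⟨_, θ' x.1 x.2⟩) →
        LitGt gt (L.subst θ) (L.subst θ')) := by
    intro L hL
    have ht : ∀ w ∈ L.bag, ∀ x ∈ w.2.vars, x ∈ L.vars := by
      obtain ⟨a, b, u, v, rfl⟩ := L.exists_eq
      intro w hw x hx
      rw [Lit.vars_mk]
      rcases Lit.mem_bag_mk.1 hw with rfl | rfl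
      · exact .inl hx
      · exact .inr hx
    have hb := map_eq_or_bagGt (R' := gt) (f := STerm.subst θ) (g := STerm.subst θ') (M := L.bag)
      fun w hw => (hgt.subst_ge fun x hx => h x ⟨L, hL, ht w hw x hx⟩).1.imp_left
        fun he => by simp [STerm.subst, he]
    have hlt : (∃ x ∈ L.vars, gt ⟨_, θ x.1 x.2⟩ ⟨_, θ' x.1 x.2⟩) →
        LitGt gt (L.subst θ) (L.subst θ') := by
      rintro ⟨x, hx, hxg⟩
      unfold LitGt
      rw [Lit.bag_subst, Lit.bag_subst]
      refine hb.2 ?_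
      obtain ⟨w, hw, hxw⟩ : ∃ w ∈ L.bag, x ∈ w.2.vars := by
        obtain ⟨a, b, u, v, rfl⟩ := L.exists_eq
        rw [Lit.vars_mk] at hx
        rcases hx with hx | hx
        · exact ⟨_, Lit.mem_bag_mk.2 (.inl rfl), hx⟩
        · exact ⟨_, Lit.mem_bag_mk.2 (.inr rfl), hx⟩
      exact ⟨w, hw, (hgt.subst_ge fun x hx => h x ⟨L, hL, ht w hw x hx⟩).2 ⟨x, hxw, hxg⟩⟩
    refine ⟨?_, hlt⟩
    by_cases hx : ∃ x ∈ L.vars, gt ⟨_, θ x.1 x.2⟩ ⟨_, θ' x.1 x.2⟩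
    · exact .inr (hlt hx)
    · push Not at hx
      exact .inl (Lit.subst_congr fun x hxL =>
        ((h x ⟨L, hL, hxL⟩).resolve_right (hx x hxL)).symm)
  obtain ⟨x, ⟨L, hLC, hx⟩, hxg⟩ := hlt
  exact (map_eq_or_bagGt (R' := LitGt gt) fun L hLC => (hL L hLC).1).2
    ⟨L, hLC, (hL L hLC).2 ⟨x, hx, hxg⟩⟩

/-- Ground clauses below a computable ground clause are computable. -/
theorem clause_computable_of_gt (hgt : IsPartitionedSimplificationOrder c gt) {C D : Clause S}
    (hC : C.vars = ∅) (hD : D.vars = ∅)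
    (hCc : C.Computable c) (h : ClauseGt gt C D) : D.Computable c := by
  intro K hK w hw
  obtain ⟨L, hL, hLK⟩ := BagGt.exists_ge hgt.litGt_irrefl
    (fun _ _ _ h h' => BagGt.trans h h') h K hK
  rcases hLK with rfl | hLK
  · exact hCc _ hL w hw
  · obtain ⟨v, hv, hvw⟩ := BagGt.exists_ge hgt.irrefl hgt.trans hLK w hw
    rcases hvw with rfl | hvw
    · exact hCc _ hL _ hv
    · exact hgt.computable_of_gt (Lit.ground_iff_bag.1 (Clause.ground_of_mem hC hL) v hv)
        (Lit.ground_iff_bag.1 (Clause.ground_of_mem hD hK) w hw) (hCc _ hL _ hv) hvw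

end IsPartitionedSimplificationOrder

end SynSup

end

noncomputable section

namespace SynSup

open scoped Classical

variable {S : Sig} {o : S.Srt} {c : Set S.Fn} {gt : STerm S → STerm S → Prop}

/-! ## Normal forms with respect to a set of ground clauses -/

/-- Sort-preserving maps on terms. -/
abbrev TermMap (S : Sig) : Type := ∀ s : S.Srt, Term S s → Term S s

/-- Truth of a literal when terms are identified if they have the same image under `g`. -/
def Lit.TrueUnder (g : TermMap S) (L : Lit S) : Prop :=
  L.pos = true ↔ (L.atom.map (g L.sort)).IsDiag

theorem Lit.trueUnder_mk {g : TermMap S} {a : S.Srt} {b : Bool} {u v : Term S a} :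
    TrueUnder g ⟨a, b, s(u, v)⟩ ↔ (b = true ↔ g a u = g a v) := by
  simp [TrueUnder]

/-- Truth of a ground clause when terms are identified if they have the same image under `g`. -/
def Clause.TrueUnder (g : TermMap S) (C : Clause S) : Prop := ∃ L ∈ C, L.TrueUnder g

/-- The literal `K` does not hinder a clause `l ≃ r ∨ K ∨ …` from defining the rule `l → r`. -/
def Inert (gt : STerm S → STerm S → Prop) (g : TermMap S) {a : S.Srt} (l r : Term S a)
    (K : Lit S) : Prop :=
  ((∀ w ∈ K.bag, gt ⟨a, l⟩ w) ∧ ¬ K.TrueUnder g) ∨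
    ∃ t : Term S a, K = ⟨a, true, s(l, t)⟩ ∧ gt ⟨a, r⟩ ⟨a, t⟩ ∧ g a r ≠ g a t

/-- Some clause of `G` defines the rule `l → r`. -/
def Defines (gt : STerm S → STerm S → Prop) (G : Set (Clause S)) (g : TermMap S) {a : S.Srt}
    (l r : Term S a) : Prop :=
  r.Ground ∧ gt ⟨a, l⟩ ⟨a, r⟩ ∧
    ∃ D : Clause S, ⟨a, true, s(l, r)⟩ ::ₘ D ∈ G ∧ ∀ K ∈ D, Inert gt g l r K

/-- The rule `l → r` is defined and has the least right-hand side. -/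
def Rule (gt : STerm S → STerm S → Prop) (G : Set (Clause S)) (g : TermMap S) {a : S.Srt}
    (l r : Term S a) : Prop :=
  Defines gt G g l r ∧ ∀ r', Defines gt G g l r' → ¬ gt ⟨a, r⟩ ⟨a, r'⟩

/-- One step of the recursion, with `g` giving the normal forms of smaller terms. The arguments, the
term with normalized arguments if it differs, and the right-hand side of a rule are all smaller than
the input. Rules are tried only when the arguments are fixed by `g`. -/
def normalizeStep (gt : STerm S → STerm S → Prop) (G : Set (Clause S)) (g : TermMap S) :
    TermMap S
  | _, .var s n => .var s n
  | _, .app f args =>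
      if (fun j => g _ (args j)) ≠ args then g _ (.app f (fun j => g _ (args j)))
      else if h : ∃ r, Rule gt G g (.app f args) r then g _ h.choose
      else .app f args

/-- The map that agrees with `g` on the terms below `t` and is the identity elsewhere. -/
def TermMap.below (gt : STerm S → STerm S → Prop) (t : STerm S) (g : TermMap S) : TermMap S :=
  fun s u => if gt t ⟨s, u⟩ then g s u else u

theorem TermMap.below_of_gt {t : STerm S} {g : TermMap S} {s : S.Srt} {u : Term S s}
    (h : gt t ⟨s, u⟩) : g.below gt t s u = g s u := if_pos h

/-- The normal form of a term. -/
def normalize (hwf : WellFounded (fun t u => gt u t)) (G : Set (Clause S)) : TermMap S :=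
  fun s t => hwf.fix (C := fun t => Term S t.1)
    (fun t ih => normalizeStep gt G (fun s u => if h : gt t ⟨s, u⟩ then ih ⟨s, u⟩ h else u) t.1 t.2)
    ⟨s, t⟩

theorem normalize_eq_below (hwf : WellFounded (fun t u => gt u t)) (G : Set (Clause S)) {s : S.Srt}
    (t : Term S s) :
    normalize hwf G s t = normalizeStep gt G ((normalize hwf G).below gt ⟨s, t⟩) s t := by
  unfold normalize
  rw [WellFounded.fix_eq]
  congr 1

theorem trueUnder_congr {g g' : TermMap S} {K : Lit S} (h : ∀ w ∈ K.bag, g w.1 w.2 = g' w.1 w.2) :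
    K.TrueUnder g ↔ K.TrueUnder g' := by
  obtain ⟨a, b, u, v, rfl⟩ := K.exists_eq
  have hu := h _ (Lit.mem_bag_mk.2 (.inl rfl))
  have hv := h _ (Lit.mem_bag_mk.2 (.inr rfl))
  simp only at hu hv
  rw [Lit.trueUnder_mk, Lit.trueUnder_mk, hu, hv]

namespace IsPartitionedSimplificationOrder

/-- Both alternatives consult the map only at terms below `l`. For this reason rules and normal
forms can be defined together by recursion on terms. -/
theorem inert_congr (hgt : IsPartitionedSimplificationOrder c gt) {g g' : TermMap S} {a : S.Srt}
    {l r : Term S a} (hlr : gt ⟨a, l⟩ ⟨a, r⟩)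
    (h : ∀ b (u : Term S b), gt ⟨a, l⟩ ⟨b, u⟩ → g b u = g' b u) (K : Lit S) :
    Inert gt g l r K ↔ Inert gt g' l r K := by
  unfold Inert
  refine or_congr (and_congr_right fun hK => not_congr (trueUnder_congr fun w hw => ?_)) ?_
  · exact h _ _ (hK w hw)
  · refine exists_congr fun t => and_congr_right fun _ => and_congr_right fun hrt => ?_
    rw [h _ _ hlr, h _ _ (hgt.trans _ _ _ hlr hrt)]

theorem defines_congr (hgt : IsPartitionedSimplificationOrder c gt) (G : Set (Clause S))
    {g g' : TermMap S} {a : S.Srt} {l : Term S a}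
    (h : ∀ b (u : Term S b), gt ⟨a, l⟩ ⟨b, u⟩ → g b u = g' b u) (r : Term S a) :
    Defines gt G g l r ↔ Defines gt G g' l r :=
  and_congr_right fun _ => and_congr_right fun hlr => exists_congr fun _ =>
    and_congr_right fun _ => forall₂_congr fun K _ => hgt.inert_congr hlr h K

theorem rule_congr {G G' : Set (Clause S)} {g g' : TermMap S} {a : S.Srt} {l : Term S a}
    (h : ∀ r, Defines gt G g l r ↔ Defines gt G' g' l r) (r : Term S a) :
    Rule gt G g l r ↔ Rule gt G' g' l r :=
  and_congr (h r) (forall_congr' fun r' => by rw [h r'])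

theorem exists_rule (hgt : IsPartitionedSimplificationOrder c gt) {G : Set (Clause S)}
    {g : TermMap S} {a : S.Srt} {l r : Term S a} (h : Defines gt G g l r) :
    ∃ r, Rule gt G g l r := by
  obtain ⟨r, hr, hmin⟩ := (InvImage.wf (fun r : Term S a => (⟨a, r⟩ : STerm S)) hgt.wf).has_min
    {r | Defines gt G g l r} ⟨r, h⟩
  exact ⟨r, hr, fun r' hr' => hmin r' hr'⟩

/-- The normalization step depends only on the given map below the term. -/
theorem normalizeStep_congr (hgt : IsPartitionedSimplificationOrder c gt) {G G' : Set (Clause S)}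
    {g g' : TermMap S} {s : S.Srt} {t : Term S s}
    (hle : ∀ b (u : Term S b), gt ⟨s, t⟩ ⟨b, u⟩ → g b u = u ∨ gt ⟨b, u⟩ ⟨b, g b u⟩)
    (h : ∀ b (u : Term S b), gt ⟨s, t⟩ ⟨b, u⟩ → g b u = g' b u)
    (hG : ∀ r, Defines gt G g t r ↔ Defines gt G' g' t r) :
    normalizeStep gt G g s t = normalizeStep gt G' g' s t := by
  cases t with
  | var s n => rfl
  | app f args =>
    have hargs : (fun j => g _ (args j)) = fun j => g' _ (args j) :=
      funext fun j => h _ _ (hgt.subterm f args j)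
    have hR : Rule gt G g (.app f args) = Rule gt G' g' (.app f args) :=
      funext fun r => propext (rule_congr hG r)
    simp only [normalizeStep]
    by_cases hne : (fun j => g _ (args j)) = args
    · have hne' : (fun j => g' _ (args j)) = args := hargs ▸ hne
      simp only [hne, hne', ne_eq, not_true_eq_false, if_false]
      by_cases hr : ∃ r, Rule gt G g (.app f args) r
      · have hr' : ∃ r, Rule gt G' g' (.app f args) r := hR ▸ hr
        -- The choice depends only on the predicate, and the two rule predicates are equal.
        have hc : hr.choose = hr'.choose := by congr 1
        rw [dif_pos hr, dif_pos hr', ← hc]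
        exact h _ _ hr.choose_spec.1.2.1
      · have hr' : ¬ ∃ r, Rule gt G' g' (.app f args) r := hR ▸ hr
        rw [dif_neg hr, dif_neg hr']
    · have hne' : (fun j => g' _ (args j)) ≠ args := hargs ▸ hne
      rw [if_pos hne, if_pos hne', ← hargs]
      exact h _ _ (hgt.gt_app (fun j => hle _ _ (hgt.subterm f args j)) hne)

theorem normalize_le (hgt : IsPartitionedSimplificationOrder c gt) (G : Set (Clause S)) {s : S.Srt}
    (t : Term S s) : normalize hgt.wf G s t = t ∨ gt ⟨s, t⟩ ⟨s, normalize hgt.wf G s t⟩ := by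
  generalize hw : (⟨s, t⟩ : STerm S) = w
  induction w using hgt.wf.induction generalizing s t with
  | _ w ih =>
  subst hw
  have ih : ∀ b (u : Term S b), gt ⟨s, t⟩ ⟨b, u⟩ →
      gt ⟨s, t⟩ ⟨b, (normalize hgt.wf G).below gt ⟨s, t⟩ b u⟩ ∧
      ((normalize hgt.wf G).below gt ⟨s, t⟩ b u = u ∨
        gt ⟨b, u⟩ ⟨b, (normalize hgt.wf G).below gt ⟨s, t⟩ b u⟩) := by
    intro b u hu
    rw [TermMap.below_of_gt hu]
    have h := ih ⟨b, u⟩ hu u rfl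
    refine ⟨?_, h⟩
    rcases h with h | h
    · rw [h]; exact hu
    · exact hgt.trans _ _ _ hu h
  rw [normalize_eq_below]
  generalize (normalize hgt.wf G).below gt ⟨s, t⟩ = g at ih
  cases t with
  | var s n => exact .inl rfl
  | app f args =>
    simp only [normalizeStep]
    split_ifs with h₁ h₂
    · exact .inr (ih _ _ (hgt.gt_app (fun j => (ih _ _ (hgt.subterm f args j)).2) h₁)).1
    · exact .inr (ih _ _ h₂.choose_spec.1.2.1).1
    · exact .inl rfl

/-- The restriction to terms below `t` can be dropped because `normalizeStep` never looks elsewhere.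
-/
theorem normalize_eq (hgt : IsPartitionedSimplificationOrder c gt) (G : Set (Clause S)) {s : S.Srt}
    (t : Term S s) : normalize hgt.wf G s t = normalizeStep gt G (normalize hgt.wf G) s t := by
  rw [normalize_eq_below]
  have h : ∀ b (u : Term S b), gt ⟨s, t⟩ ⟨b, u⟩ →
      (normalize hgt.wf G).below gt ⟨s, t⟩ b u = normalize hgt.wf G b u :=
    fun b u hu => TermMap.below_of_gt hu
  refine hgt.normalizeStep_congr (fun b u hu => ?_) h fun r => hgt.defines_congr G h r
  rw [h b u hu]
  exact hgt.normalize_le G u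

theorem normalize_app_args (hgt : IsPartitionedSimplificationOrder c gt) (G : Set (Clause S))
    (f : S.Fn) (args : ∀ j : Fin (S.dom f).length, Term S ((S.dom f).get j)) :
    (fun j => normalize hgt.wf G _ (args j)) = args ∨
      normalize hgt.wf G _ (.app f args) =
        normalize hgt.wf G _ (.app f fun j => normalize hgt.wf G _ (args j)) := by
  by_cases h : (fun j => normalize hgt.wf G _ (args j)) = args
  · exact .inl h
  · refine .inr ?_
    conv_lhs => rw [hgt.normalize_eq, normalizeStep, if_pos h]

theorem normalize_app (hgt : IsPartitionedSimplificationOrder c gt) (G : Set (Clause S))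
    (f : S.Fn) (args : ∀ j : Fin (S.dom f).length, Term S ((S.dom f).get j)) :
    normalize hgt.wf G _ (.app f fun j => normalize hgt.wf G _ (args j)) =
      normalize hgt.wf G _ (.app f args) := by
  rcases hgt.normalize_app_args G f args with h | h
  · rw [h]
  · exact h.symm

theorem normalize_app_cases (hgt : IsPartitionedSimplificationOrder c gt) (G : Set (Clause S))
    {f : S.Fn} {args : ∀ j : Fin (S.dom f).length, Term S ((S.dom f).get j)}
    (h : (fun j => normalize hgt.wf G _ (args j)) = args) :
    (∃ r, Rule gt G (normalize hgt.wf G) (.app f args) r ∧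
      normalize hgt.wf G _ (.app f args) = normalize hgt.wf G _ r) ∨
    (¬ ∃ r, Defines gt G (normalize hgt.wf G) (.app f args) r) ∧
      normalize hgt.wf G _ (.app f args) = .app f args := by
  rw [hgt.normalize_eq, normalizeStep, if_neg (not_not.2 h)]
  by_cases hr : ∃ r, Rule gt G (normalize hgt.wf G) (.app f args) r
  · rw [dif_pos hr]
    exact .inl ⟨_, hr.choose_spec, rfl⟩
  · rw [dif_neg hr]
    exact .inr ⟨fun ⟨r, h⟩ => hr (hgt.exists_rule h), rfl⟩

theorem normalize_idem (hgt : IsPartitionedSimplificationOrder c gt) (G : Set (Clause S))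
    {s : S.Srt} (t : Term S s) :
    normalize hgt.wf G s (normalize hgt.wf G s t) = normalize hgt.wf G s t := by
  generalize hw : (⟨s, t⟩ : STerm S) = w
  induction w using hgt.wf.induction generalizing s t with
  | _ w ih =>
  subst hw
  cases t with
  | var s n => simp only [hgt.normalize_eq G (.var s n), normalizeStep]
  | app f args =>
    rcases hgt.normalize_app_args G f args with h | h
    · rcases hgt.normalize_app_cases G h with ⟨r, hr, he⟩ | ⟨_, he⟩
      · rw [he]; exact ih _ hr.1.2.1 r rfl
      · rw [he, he]
    · by_cases h' : (fun j => normalize hgt.wf G _ (args j)) = args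
      · rcases hgt.normalize_app_cases G h' with ⟨r, hr, he⟩ | ⟨_, he⟩
        · rw [he]; exact ih _ hr.1.2.1 r rfl
        · rw [he, he]
      · rw [h]
        exact ih _ (hgt.gt_app (fun j => hgt.normalize_le G _) h') _ rfl

theorem normalize_ground (hgt : IsPartitionedSimplificationOrder c gt) (G : Set (Clause S))
    {s : S.Srt} {t : Term S s} (ht : t.Ground) : (normalize hgt.wf G s t).Ground := by
  generalize hw : (⟨s, t⟩ : STerm S) = w
  induction w using hgt.wf.induction generalizing s t with
  | _ w ih =>
  subst hw
  cases t with
  | var s n => exact (Term.not_ground_var s n ht).elim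
  | app f args =>
    have hargs := Term.ground_app_iff.1 ht
    by_cases h' : (fun j => normalize hgt.wf G _ (args j)) = args
    · rcases hgt.normalize_app_cases G h' with ⟨r, hr, he⟩ | ⟨_, he⟩
      · rw [he]; exact ih _ hr.1.2.1 hr.1.1 rfl
      · rw [he]; exact ht
    · rw [← hgt.normalize_app]
      exact ih _ (hgt.gt_app (fun j => hgt.normalize_le G _) h')
        (Term.ground_app_iff.2 fun j => ih _ (hgt.subterm f args j) (hargs j) rfl) rfl

/-- If an argument were reducible, normalizing the arguments would yield a smaller term with the
same normal form, so the whole term would not be its own normal form. -/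
theorem normalize_eq_of_isSubterm (hgt : IsPartitionedSimplificationOrder c gt)
    (G : Set (Clause S)) {a b : S.Srt} {k : Term S a} {t : Term S b} (h : k.IsSubterm t)
    (ht : normalize hgt.wf G b t = t) : normalize hgt.wf G a k = k := by
  induction h with
  | refl => exact ht
  | arg f args j _ ih =>
    refine ih ?_
    by_contra hj
    have hne : (fun j => normalize hgt.wf G _ (args j)) ≠ args := fun h => hj (congrFun h j)
    have h₁ := hgt.gt_app (fun j => hgt.normalize_le G (args j)) hne
    have h₂ := hgt.normalize_le G (.app f fun j => normalize hgt.wf G _ (args j))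
    rw [hgt.normalize_app, ht] at h₂
    rcases h₂ with h₂ | h₂
    · rw [← h₂] at h₁; exact hgt.irrefl _ h₁
    · exact hgt.asymm h₁ h₂

/-- A ground term that is reducible or the left-hand side of a rule contains the left-hand side of
a rule that is used by normalization. -/
theorem exists_redex (hgt : IsPartitionedSimplificationOrder c gt) (G : Set (Clause S)) {s : S.Srt}
    {t : Term S s} (ht : t.Ground)
    (h : normalize hgt.wf G s t ≠ t ∨ ∃ r, Defines gt G (normalize hgt.wf G) t r) :
    ∃ (a : S.Srt) (l r : Term S a), l.IsSubterm t ∧ Rule gt G (normalize hgt.wf G) l r ∧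
      normalize hgt.wf G a l = normalize hgt.wf G a r := by
  induction t with
  | var s n => exact (Term.not_ground_var s n ht).elim
  | app f args ih =>
    by_cases h' : (fun j => normalize hgt.wf G _ (args j)) = args
    · rcases hgt.normalize_app_cases G h' with ⟨r, hr, he⟩ | ⟨hr, he⟩
      · exact ⟨_, _, r, .refl, hr, he⟩
      · exact (h.elim (fun h => h he) hr).elim
    · obtain ⟨j, hj⟩ := Function.ne_iff.1 h'
      obtain ⟨a, l, r, hl, hr⟩ := ih j (Term.ground_app_iff.1 ht j) (.inl hj)
      exact ⟨a, l, r, .arg f args j hl, hr⟩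

/-- All sides of a defining clause are at most its left-hand side, so a computable left-hand side
makes the whole clause computable by the partition. The other conditions concern only ground terms
below `l`. -/
theorem defines_of_computable (hgt : IsPartitionedSimplificationOrder c gt)
    {G G' : Set (Clause S)} (hG : ∀ C ∈ G, C.vars = ∅)
    (h : ∀ C : Clause S, C.Computable c → C ∈ G → C ∈ G') {g g' : TermMap S} {s : S.Srt}
    {l r : Term S s} (hl : l.Ground) (hlc : l.Computable c)
    (hg : ∀ b (u : Term S b), u.Ground → gt ⟨s, l⟩ ⟨b, u⟩ → g b u = g' b u)
    (hd : Defines gt G g l r) : Defines gt G' g' l r := by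
  obtain ⟨hr, hlr, D, hD, hK⟩ := hd
  have hground : ∀ K ∈ D, ∀ w ∈ K.bag, w.2.Ground := fun K hK =>
    Lit.ground_iff_bag.1 (Clause.ground_of_mem (hG _ hD) (Multiset.mem_cons_of_mem hK))
  have hcomp : ∀ w : STerm S, w.2.Ground → gt ⟨s, l⟩ w → w.2.Computable c := fun w hw hlw =>
    hgt.computable_of_gt hl hw hlc hlw
  refine ⟨hr, hlr, D, h _ ?_ hD, fun K hKD => ?_⟩
  · intro K hKD
    rcases Multiset.mem_cons.1 hKD with rfl | hKD
    · exact Lit.computable_mk.2 ⟨hlc, hcomp ⟨s, r⟩ hr hlr⟩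
    · rcases hK K hKD with ⟨hw, _⟩ | ⟨t, rfl, hrt, _⟩
      · exact fun w hwK => hcomp w (hground K hKD w hwK) (hw w hwK)
      · exact Lit.computable_mk.2 ⟨hlc, hcomp ⟨s, t⟩
          (hground _ hKD ⟨s, t⟩ (Lit.mem_bag_mk.2 (.inr rfl))) (hgt.trans _ _ _ hlr hrt)⟩
  · rcases hK K hKD with ⟨hw, hf⟩ | ⟨t, rfl, hrt, hne⟩
    · refine .inl ⟨hw, fun hf' => hf ((trueUnder_congr fun w hwK => ?_).2 hf')⟩
      exact hg _ _ (hground K hKD w hwK) (hw w hwK)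
    · refine .inr ⟨t, rfl, hrt, ?_⟩
      rwa [← hg _ r hr hlr, ← hg _ t (hground _ hKD ⟨s, t⟩ (Lit.mem_bag_mk.2 (.inr rfl)))
        (hgt.trans _ _ _ hlr hrt)]

/-- Normal forms of computable ground terms depend only on the computable clauses. -/
theorem normalize_congr_of_computable (hgt : IsPartitionedSimplificationOrder c gt)
    {G G' : Set (Clause S)} (hG : ∀ C ∈ G, C.vars = ∅) (hG' : ∀ C ∈ G', C.vars = ∅)
    (h : ∀ C : Clause S, C.Computable c → (C ∈ G ↔ C ∈ G')) {s : S.Srt} {t : Term S s}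
    (ht : t.Ground) (htc : t.Computable c) : normalize hgt.wf G s t = normalize hgt.wf G' s t := by
  generalize hw : (⟨s, t⟩ : STerm S) = w
  induction w using hgt.wf.induction generalizing s t with
  | _ w ih =>
  subst hw
  have ih : ∀ b (u : Term S b), u.Ground → gt ⟨s, t⟩ ⟨b, u⟩ →
      normalize hgt.wf G b u = normalize hgt.wf G' b u := fun b u hu htu =>
    ih ⟨b, u⟩ htu hu (hgt.computable_of_gt ht hu htc htu) rfl
  cases t with
  | var s n => exact (Term.not_ground_var s n ht).elim
  | app f args =>
    have hargs := Term.ground_app_iff.1 ht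
    have he : (fun j => normalize hgt.wf G _ (args j)) =
        fun j => normalize hgt.wf G' _ (args j) :=
      funext fun j => ih _ _ (hargs j) (hgt.subterm f args j)
    by_cases h' : (fun j => normalize hgt.wf G _ (args j)) = args
    · have hR : Rule gt G (normalize hgt.wf G) (.app f args) =
          Rule gt G' (normalize hgt.wf G') (.app f args) := by
        refine funext fun r => propext (rule_congr (fun r => ⟨?_, ?_⟩) r)
        · exact hgt.defines_of_computable hG (fun C hC => (h C hC).1) ht htc ih
        · exact hgt.defines_of_computable hG' (fun C hC => (h C hC).2) ht htc
            fun b u hu htu => (ih b u hu htu).symm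
      rw [hgt.normalize_eq G, hgt.normalize_eq G', normalizeStep, normalizeStep,
        if_neg (not_not.2 h'), if_neg (not_not.2 (he ▸ h'))]
      by_cases hr : ∃ r, Rule gt G (normalize hgt.wf G) (.app f args) r
      · have hr' : ∃ r, Rule gt G' (normalize hgt.wf G') (.app f args) r := hR ▸ hr
        have hc : hr.choose = hr'.choose := by congr 1
        rw [dif_pos hr, dif_pos hr', ← hc]
        exact ih _ _ hr.choose_spec.1.1 hr.choose_spec.1.2.1
      · have hr' : ¬ ∃ r, Rule gt G' (normalize hgt.wf G') (.app f args) r := hR ▸ hr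
        rw [dif_neg hr, dif_neg hr']
    · rw [← hgt.normalize_app G, ← hgt.normalize_app G', ← he]
      exact ih _ _ (Term.ground_app_iff.2 fun j => hgt.normalize_ground G (hargs j))
        (hgt.gt_app (fun j => hgt.normalize_le G _) h')

/-! ### The model of normal forms -/

/-- The interpretation whose elements are the ground terms in normal form. -/
def normalModel (hgt : IsPartitionedSimplificationOrder c gt) (G : Set (Clause S))
    (hsorts : ∀ s : S.Srt, ∃ u : Term S s, u.Ground) : Interp S where
  carrier s := {t : Term S s // t.Ground ∧ normalize hgt.wf G s t = t}
  nonempty s := by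
    obtain ⟨u, hu⟩ := hsorts s
    exact ⟨⟨_, hgt.normalize_ground G hu, hgt.normalize_idem G u⟩⟩
  fn f args := ⟨normalize hgt.wf G _ (.app f fun j => (args j).1),
    hgt.normalize_ground G (Term.ground_app_iff.2 fun j => (args j).2.1), hgt.normalize_idem G _⟩

/-- The ground substitution given by a valuation. -/
def valSubst {hgt : IsPartitionedSimplificationOrder c gt} {G : Set (Clause S)}
    {hsorts : ∀ s : S.Srt, ∃ u : Term S s, u.Ground} (v : (hgt.normalModel G hsorts).Val) :
    Subst S :=
  fun s n => (v s n).1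

variable {hgt : IsPartitionedSimplificationOrder c gt} {G : Set (Clause S)}
    {hsorts : ∀ s : S.Srt, ∃ u : Term S s, u.Ground}

/-- Elements of the carriers are their own normal forms, so a valuation is a normalized ground
substitution, and evaluation is instantiation followed by normalization. -/
theorem normalModel_eval (v : (hgt.normalModel G hsorts).Val) {s : S.Srt} (t : Term S s) :
    ((hgt.normalModel G hsorts).eval v t).1 = normalize hgt.wf G s (t.subst (valSubst v)) := by
  induction t with
  | var s n => exact (v s n).2.2.symm
  | app f args ih =>
    rw [Term.subst, ← hgt.normalize_app]
    simp only [← ih]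
    rfl

theorem normalModel_holds (v : (hgt.normalModel G hsorts).Val) (L : Lit S) :
    L.Holds (hgt.normalModel G hsorts) v ↔
      (L.subst (valSubst v)).TrueUnder (normalize hgt.wf G) := by
  obtain ⟨a, b, u, w, rfl⟩ := L.exists_eq
  rw [Lit.subst_mk, Lit.trueUnder_mk, ← normalModel_eval, ← normalModel_eval]
  change (b = true ↔ s(_, _).IsDiag) ↔ _
  rw [Sym2.mk_isDiag_iff]
  exact iff_congr Iff.rfl Subtype.ext_iff

theorem normalModel_clause (v : (hgt.normalModel G hsorts).Val) (C : Clause S) :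
    (∃ L ∈ C, L.Holds (hgt.normalModel G hsorts) v) ↔
      (C.subst (valSubst v)).TrueUnder (normalize hgt.wf G) := by
  simp [Clause.TrueUnder, Clause.subst, normalModel_holds]

theorem _root_.SynSup.Clause.subst_eq_of_ground {C : Clause S} (h : C.vars = ∅) (σ : Subst S) :
    C.subst σ = C := by
  conv_rhs => rw [← C.subst_var]
  exact Clause.subst_congr fun x hx => by rw [h] at hx; exact hx.elim

theorem normalModel_trueIn {C : Clause S} (h : C.vars = ∅) :
    C.TrueIn (hgt.normalModel G hsorts) ↔ C.TrueUnder (normalize hgt.wf G) := by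
  simp only [Clause.TrueIn, normalModel_clause, Clause.subst_eq_of_ground h]
  have : ∀ s, Nonempty ((hgt.normalModel G hsorts).carrier s) := (hgt.normalModel G hsorts).nonempty
  have : Nonempty (hgt.normalModel G hsorts).Val := inferInstance
  exact forall_const _

theorem valSubst_ground (v : (hgt.normalModel G hsorts).Val) (s : S.Srt) (n : ℕ) :
    (valSubst v s n).Ground := (v s n).2.1

end IsPartitionedSimplificationOrder

end SynSup

end

noncomputable section

namespace SynSup

open scoped Classical

variable {S : Sig} {o : S.Srt} {c : Set S.Fn} {gt : STerm S → STerm S → Prop}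

/-! ## Completeness for ground instances -/

theorem Clause.ground_cons {L : Lit S} {C : Clause S} :
    vars (L ::ₘ C) = ∅ ↔ L.vars = ∅ ∧ C.vars = ∅ := by
  rw [vars_cons, Set.union_empty_iff]

theorem AnsClause.ground_mk {C : Clause S} {p : PTerm S o} :
    Ground ⟨C, p⟩ ↔ C.vars = ∅ ∧ p.Ground :=
  Set.union_empty_iff

theorem Clause.trueUnder_cons {g : TermMap S} {L : Lit S} {C : Clause S} :
    TrueUnder g (L ::ₘ C) ↔ L.TrueUnder g ∨ C.TrueUnder g := by
  simp [TrueUnder]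

theorem Clause.trueUnder_add {g : TermMap S} {C D : Clause S} :
    TrueUnder g (C + D) ↔ C.TrueUnder g ∨ D.TrueUnder g := by
  simp [TrueUnder, or_and_right, exists_or]

theorem Clause.Computable.of_subst {C : Clause S} {θ : Subst S} (h : (C.subst θ).Computable c)
    {x : Var S} (hx : x ∈ C.vars) : (θ x.1 x.2).Computable c := by
  obtain ⟨L, hL, hx⟩ := hx
  have h := h _ (Multiset.mem_map_of_mem _ hL)
  obtain ⟨a, b, u, v, rfl⟩ := L.exists_eq
  rw [Lit.vars_mk] at hx
  rw [Lit.subst_mk, Lit.computable_mk] at h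
  rcases hx with hx | hx
  · exact (Term.computable_subst_iff.1 h.1).2 x hx
  · exact (Term.computable_subst_iff.1 h.2).2 x hx

/-- The relevant ground answer clauses: those that are computable and those with an answer
in `U`. -/
def Admissible (c : Set S.Fn) (U : Set (Term S o)) (B : AnsClause S o) : Prop :=
  (B.cl.Computable c ∧ B.ans.Computable c) ∨ ∃ u ∈ U, B.ans = .simple u

/-- The relevant ground instances of non-redundant members of `N`, without their answers. -/
def admissibleClauses (c : Set S.Fn) (gt : STerm S → STerm S → Prop) (N : Set (AnsClause S o))
    (U : Set (Term S o)) : Set (Clause S) :=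
  {C | ∃ A ∈ N, ¬ Redundant gt N A ∧ ∃ θ : Subst S, (A.subst θ).Ground ∧
    Admissible c U (A.subst θ) ∧ C = A.cl.subst θ}

/-- All relevant ground instances of members of `N` below `C` are true under `g`. -/
def TrueBelow (c : Set S.Fn) (gt : STerm S → STerm S → Prop) (N : Set (AnsClause S o))
    (U : Set (Term S o)) (g : TermMap S) (C : Clause S) : Prop :=
  ∀ B ∈ groundInstances N, Admissible c U B → ClauseGt gt C B.cl → B.cl.TrueUnder g

theorem admissibleClauses_ground {N : Set (AnsClause S o)} {U : Set (Term S o)} :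
    ∀ C ∈ admissibleClauses c gt N U, C.vars = ∅ := by
  rintro _ ⟨A, _, _, θ, hg, _, rfl⟩
  exact (AnsClause.ground_mk.1 hg).1

namespace IsPartitionedSimplificationOrder

/-! ### Normal forms of instances -/

theorem normalize_subst_congr (hgt : IsPartitionedSimplificationOrder c gt) (G : Set (Clause S))
    {θ θ' : Subst S} (h : ∀ s n, normalize hgt.wf G s (θ' s n) = normalize hgt.wf G s (θ s n))
    {s : S.Srt} (t : Term S s) :
    normalize hgt.wf G s (t.subst θ') = normalize hgt.wf G s (t.subst θ) := by
  induction t with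
  | var s n => exact h s n
  | app f args ih =>
    simp only [Term.subst]
    rw [← hgt.normalize_app, ← hgt.normalize_app G f fun j => (args j).subst θ]
    simp only [ih]

theorem trueUnder_subst_congr (hgt : IsPartitionedSimplificationOrder c gt) (G : Set (Clause S))
    {θ θ' : Subst S} (h : ∀ s n, normalize hgt.wf G s (θ' s n) = normalize hgt.wf G s (θ s n))
    (C : Clause S) :
    (C.subst θ').TrueUnder (normalize hgt.wf G) ↔ (C.subst θ).TrueUnder (normalize hgt.wf G) := by
  simp only [Clause.TrueUnder, Clause.subst, Multiset.mem_map, exists_exists_and_eq_and]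
  refine exists_congr fun L => and_congr_right fun _ => ?_
  obtain ⟨a, b, u, v, rfl⟩ := L.exists_eq
  simp only [Lit.subst_mk, Lit.trueUnder_mk, hgt.normalize_subst_congr G h]

theorem normalize_replace (hgt : IsPartitionedSimplificationOrder c gt) (G : Set (Clause S))
    {θ : Subst S} {a : S.Srt} {k r : Term S a}
    (h : normalize hgt.wf G a (r.subst θ) = normalize hgt.wf G a (k.subst θ)) {b : S.Srt}
    (t : Term S b) :
    normalize hgt.wf G b ((Term.replace k r t).subst θ) = normalize hgt.wf G b (t.subst θ) := by
  refine Term.replace_induction (P := fun {b} t t' =>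
    normalize hgt.wf G b (t'.subst θ) = normalize hgt.wf G b (t.subst θ)) h (fun _ _ => rfl) ?_ t
  intro f args args' ih
  simp only [Term.subst]
  rw [← hgt.normalize_app, ← hgt.normalize_app G f fun j => (args j).subst θ]
  simp only [ih]

/-! ### Comparison of literals -/

theorem total_ground (hgt : IsPartitionedSimplificationOrder c gt) {a : S.Srt} {t u : Term S a}
    (ht : t.Ground) (hu : u.Ground) (hne : t ≠ u) : gt ⟨a, t⟩ ⟨a, u⟩ ∨ gt ⟨a, u⟩ ⟨a, t⟩ := by
  rcases hgt.total ⟨a, t⟩ ⟨a, u⟩ ht hu with h | h | h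
  · exact .inl h
  · cases h; exact (hne rfl).elim
  · exact .inr h

theorem litGt_asymm (hgt : IsPartitionedSimplificationOrder c gt) {L K : Lit S}
    (h : LitGt gt L K) : ¬ LitGt gt K L := fun h' =>
  hgt.litGt_irrefl L (BagGt.trans h h')

theorem litGt_of_side {a : S.Srt} {b : Bool} {u v : Term S a} {K : Lit S}
    (h : ∀ w ∈ K.bag, gt ⟨a, u⟩ w) : LitGt gt ⟨a, b, s(u, v)⟩ K := by
  refine bagGt_of_forall (fun h0 => ?_) fun w hw => ⟨⟨a, u⟩, Lit.mem_bag_mk.2 (.inl rfl), h w hw⟩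
  have : (⟨a, u⟩ : STerm S) ∈ (0 : Multiset (STerm S)) := h0 ▸ Lit.mem_bag_mk.2 (.inl rfl)
  exact Multiset.notMem_zero _ this

theorem litGt_left {a : S.Srt} {b : Bool} {u u' v : Term S a} (h : gt ⟨a, u⟩ ⟨a, u'⟩) :
    LitGt gt ⟨a, b, s(u, v)⟩ ⟨a, b, s(u', v)⟩ := by
  have key : BagGt gt (({⟨a, u⟩, ⟨a, v⟩} : Multiset (STerm S))) {⟨a, u'⟩, ⟨a, v⟩} :=
    bagGt_cons_of_forall (α := STerm S) (Y := {⟨a, u'⟩}) {⟨a, v⟩} (by simpa using h)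
  cases b
  · exact (key.add_left _).trans (key.add_right _)
  · exact key

theorem litGt_right {a : S.Srt} {b : Bool} {u v v' : Term S a} (h : gt ⟨a, v⟩ ⟨a, v'⟩) :
    LitGt gt ⟨a, b, s(u, v)⟩ ⟨a, b, s(u, v')⟩ := by
  rw [Sym2.eq_swap, Sym2.eq_swap (a := u)]
  exact litGt_left h

theorem litGt_neg_pos {a : S.Srt} {u v w : Term S a} (h : gt ⟨a, u⟩ ⟨a, w⟩) :
    LitGt gt ⟨a, false, s(u, v)⟩ ⟨a, true, s(u, w)⟩ := by
  have key : BagGt gt ({⟨a, v⟩, ⟨a, u⟩, ⟨a, v⟩} : Multiset (STerm S)) {⟨a, w⟩} :=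
    bagGt_of_forall Multiset.cons_ne_zero fun y hy =>
      ⟨⟨a, u⟩, by simp, by rw [Multiset.mem_singleton.1 hy]; exact h⟩
  exact key.add_left {⟨a, u⟩}

theorem litGt_pos_neg {a : S.Srt} {u v w w' : Term S a} (h : gt ⟨a, u⟩ ⟨a, w⟩)
    (h' : gt ⟨a, u⟩ ⟨a, w'⟩) : LitGt gt ⟨a, true, s(u, v)⟩ ⟨a, false, s(w, w')⟩ :=
  litGt_of_side fun y hy => by
    rcases Lit.mem_bag_mk.1 hy with rfl | rfl
    · exact h
    · exact h'

theorem _root_.SynSup.Inert.litGt {g : TermMap S} {a : S.Srt} {l r : Term S a} {K : Lit S}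
    (h : Inert gt g l r K) : LitGt gt ⟨a, true, s(l, r)⟩ K := by
  rcases h with ⟨h, _⟩ | ⟨t, rfl, h, _⟩
  · exact litGt_of_side h
  · exact litGt_right h

/-- In the second alternative the rule identifies `l` with `r`, so `l ≃ t` amounts to `r ≃ t`, which
fails by assumption. -/
theorem _root_.SynSup.Inert.not_trueUnder {g : TermMap S} {a : S.Srt} {l r : Term S a} {K : Lit S}
    (h : Inert gt g l r K) (hlr : g a l = g a r) : ¬ K.TrueUnder g := by
  rcases h with ⟨_, h⟩ | ⟨t, rfl, _, h⟩
  · exact h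
  · rw [Lit.trueUnder_mk, hlr]
    exact fun h' => h (h'.1 rfl)

theorem clauseGt_replace {L : Lit S} {Y : Clause S} (X : Clause S) (h : ∀ K ∈ Y, LitGt gt L K) :
    ClauseGt gt (L ::ₘ X) (Y + X) :=
  bagGt_cons_of_forall X h

theorem clauseGt_replace_one {L K : Lit S} (X : Clause S) (h : LitGt gt L K) :
    ClauseGt gt (L ::ₘ X) (K ::ₘ X) := by
  rw [← Multiset.singleton_add K]
  exact clauseGt_replace X (by simpa using h)

theorem clauseGt_replace_second {L K : Lit S} (M : Lit S) (X : Clause S) (h : LitGt gt L K) :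
    ClauseGt gt (M ::ₘ L ::ₘ X) (M ::ₘ K ::ₘ X) := by
  rw [Multiset.cons_swap M, Multiset.cons_swap M]
  exact clauseGt_replace_one _ h

theorem clauseGt_tail (L : Lit S) (X : Clause S) : ClauseGt gt (L ::ₘ X) X := by
  have := clauseGt_replace (gt := gt) (L := L) (Y := 0) X (by simp)
  rwa [zero_add] at this

/-! ### Redundancy -/

variable {N : Set (AnsClause S o)} {U : Set (Term S o)} {G : Set (Clause S)}

/-- Consequence only uses clauses with equal answers, so the answer part of relevance is inherited
for free; only computability of the clause needs the order. -/
theorem _root_.SynSup.Admissible.of_gt (hgt : IsPartitionedSimplificationOrder c gt)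
    {C : Clause S} {B : AnsClause S o} (hC : C.vars = ∅) (hB : B.Ground)
    (h : Admissible c U ⟨C, B.ans⟩) (hCB : ClauseGt gt C B.cl) : Admissible c U B :=
  h.imp_left fun h =>
    ⟨hgt.clause_computable_of_gt hC (AnsClause.ground_mk.1 hB).1 h.1 hCB, h.2⟩

theorem trueUnder_of_follows (hgt : IsPartitionedSimplificationOrder c gt)
    (hsorts : ∀ s : S.Srt, ∃ u : Term S s, u.Ground) {M : Set (AnsClause S o)}
    {B : AnsClause S o} (hB : B.cl.vars = ∅) (h : Follows M B)
    (hM : ∀ D ∈ M, D.ans = B.ans → D.cl.vars = ∅ ∧ D.cl.TrueUnder (normalize hgt.wf G)) :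
    B.cl.TrueUnder (normalize hgt.wf G) :=
  (normalModel_trueIn (hsorts := hsorts) hB).1 <| h (hgt.normalModel G hsorts) fun D hD hans =>
    (normalModel_trueIn (hM D hD hans).1).2 (hM D hD hans).2

/-- The conclusion of a redundant ground inference is true if all smaller clauses are true. -/
theorem conclusion_trueUnder (hgt : IsPartitionedSimplificationOrder c gt)
    (hsorts : ∀ s : S.Srt, ∃ u : Term S s, u.Ground) {Ps : List (AnsClause S o)} {σ τ : Subst S}
    {A : AnsClause S o} (hred : RedundantInference gt N Ps σ A) {C : Clause S} (hC : C.vars = ∅)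
    (hground : ∀ P ∈ Ps, ((P.subst σ).subst τ).Ground) (hA : (A.subst τ).Ground)
    (hmem : ∃ P ∈ Ps, ((P.subst σ).subst τ).cl = C)
    (hle : ∀ P ∈ Ps, ((P.subst σ).subst τ).cl = C ∨ ClauseGt gt C ((P.subst σ).subst τ).cl)
    (hlt : ClauseGt gt C (A.subst τ).cl) (hadm : Admissible c U ⟨C, (A.subst τ).ans⟩)
    (hbelow : TrueBelow c gt N U (normalize hgt.wf G) C) :
    (A.subst τ).cl.TrueUnder (normalize hgt.wf G) := by
  -- The first alternative would put the conclusion above a premise equal to `C`. In the second,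
  -- every premise is at most `C`, so the clauses used lie below `C` and are relevant.
  rcases hred τ hground hA with h | h
  · obtain ⟨P, hP, rfl⟩ := hmem
    exact (hgt.clauseGt_irrefl _ (BagGt.trans hlt (h P hP))).elim
  · refine hgt.trueUnder_of_follows hsorts (AnsClause.ground_mk.1 hA).1 h ?_
    rintro D ⟨hD, P, hP, hPD⟩ hans
    have hCD : ClauseGt gt C D.cl := by
      rcases hle P hP with he | he
      · exact he ▸ hPD
      · exact BagGt.trans he hPD
    exact ⟨(AnsClause.ground_mk.1 hD.1).1,
      hbelow D hD (Admissible.of_gt hgt hC hD.1 (hans ▸ hadm) hCD) hCD⟩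

theorem subst_subst_of_factor {θ σ τ : Subst S} (h : ∀ s n, θ s n = (σ s n).subst τ)
    (A : AnsClause S o) : (A.subst σ).subst τ = A.subst θ := by
  rw [AnsClause.subst_subst]
  exact AnsClause.subst_congr fun x _ => (h x.1 x.2).symm

theorem term_subst_subst_of_factor {θ σ τ : Subst S} (h : ∀ s n, θ s n = (σ s n).subst τ)
    {a : S.Srt} (t : Term S a) : (t.subst σ).subst τ = t.subst θ := by
  rw [Term.subst_subst]
  exact Term.subst_congr fun x _ => (h x.1 x.2).symm

theorem computable_of_factor {θ σ τ : Subst S} (h : ∀ s n, θ s n = (σ s n).subst τ)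
    {p : PTerm S o} (hp : (p.subst θ).Computable c) : (p.subst σ).Computable c := by
  refine PTerm.Computable.of_subst (σ := τ) ?_
  rw [PTerm.subst_subst]
  rwa [← show θ = fun s n => (σ s n).subst τ from funext fun s => funext fun n => h s n]

theorem not_termGe_of_gt (hgt : IsPartitionedSimplificationOrder c gt) {τ : Subst S} {a : S.Srt}
    {t u : Term S a} (h : gt ⟨a, t.subst τ⟩ ⟨a, u.subst τ⟩) : ¬ TermGe gt u t := by
  rintro (h' | rfl)
  · exact hgt.asymm h (hgt.subst τ _ _ _ _ h')
  · exact hgt.irrefl _ h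

/-! ### Inferences with false conclusions -/

/-- The conclusion drops one literal of a false clause, so it is smaller and still false, while
saturation makes it true. -/
theorem eqRes_false (hgt : IsPartitionedSimplificationOrder c gt)
    (hsorts : ∀ s : S.Srt, ∃ u : Term S s, u.Ground) (hsat : SaturatedUpToRedundancy c gt N)
    {a : S.Srt} {s t : Term S a} {C : Clause S} {p : PTerm S o} {θ : Subst S}
    (hN : (⟨⟨a, false, s(s, t)⟩ ::ₘ C, p⟩ : AnsClause S o) ∈ N)
    (hnr : ¬ Redundant gt N (⟨⟨a, false, s(s, t)⟩ ::ₘ C, p⟩ : AnsClause S o))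
    (hground : (AnsClause.subst θ ⟨⟨a, false, s(s, t)⟩ ::ₘ C, p⟩).Ground)
    (hadm : Admissible c U (AnsClause.subst θ ⟨⟨a, false, s(s, t)⟩ ::ₘ C, p⟩))
    (hp : (p.subst θ).Computable c)
    (hsel : ∀ K ∈ C.subst θ, ¬ LitGt gt K (Lit.subst θ ⟨a, false, s(s, t)⟩))
    (hst : s.subst θ = t.subst θ)
    (hbelow : TrueBelow c gt N U (normalize hgt.wf G)
      (Clause.subst θ (⟨a, false, s(s, t)⟩ ::ₘ C)))
    (hfalse : ¬ (Clause.subst θ (⟨a, false, s(s, t)⟩ ::ₘ C)).TrueUnder (normalize hgt.wf G)) :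
    False := by
  obtain ⟨σ, hσ⟩ := exists_mgu_term hst
  obtain ⟨τ, hτ⟩ := hσ.2.2 θ hst
  have hinf : Inference c gt [⟨⟨a, false, s(s, t)⟩ ::ₘ C, p⟩] σ (AnsClause.subst σ ⟨C, p⟩) :=
    .eqRes s t C p σ (hgt.selected_of_subst hsel) hσ (computable_of_factor hτ hp)
  have hred := hsat _ _ _ hinf (by
    simp only [List.mem_singleton, forall_eq]
    exact ⟨_, hN, AnsClause.isVariant_refl _, hnr⟩)
  have hg := AnsClause.ground_mk.1 hground
  have hg' : Lit.vars _ = ∅ ∧ Clause.vars _ = ∅ := Clause.ground_cons.1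
    (Clause.subst_cons θ _ _ ▸ hg.1)
  have := hgt.conclusion_trueUnder (G := G) (U := U) hsorts hred (τ := τ) hg.1
    (by simpa only [List.mem_singleton, forall_eq, subst_subst_of_factor hτ] using hground)
    (by rw [subst_subst_of_factor hτ]; exact AnsClause.ground_mk.2 ⟨hg'.2, hg.2⟩)
    (by simp only [List.mem_singleton, exists_eq_left, subst_subst_of_factor hτ]; rfl)
    (by simp only [List.mem_singleton, forall_eq, subst_subst_of_factor hτ]; exact .inl rfl)
    (by
      rw [subst_subst_of_factor hτ]
      rw [Clause.subst_cons]
      exact clauseGt_tail _ _)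
    (by rw [subst_subst_of_factor hτ]; exact hadm) hbelow
  rw [subst_subst_of_factor hτ] at this
  rw [Clause.subst_cons] at hfalse
  exact hfalse (Clause.trueUnder_cons.2 (.inr this))

/-- The new literal `t ≄ r` is false, as its sides have the same normal form, and it is smaller than
the literal `l ≃ r` it replaces, as both sides are below `s`. So the conclusion is a smaller false
clause. -/
theorem eqFac_false (hgt : IsPartitionedSimplificationOrder c gt)
    (hsorts : ∀ s : S.Srt, ∃ u : Term S s, u.Ground) (hsat : SaturatedUpToRedundancy c gt N)
    {a : S.Srt} {s t l r : Term S a} {C : Clause S} {p : PTerm S o} {θ : Subst S}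
    (hN : (⟨⟨a, true, s(s, t)⟩ ::ₘ ⟨a, true, s(l, r)⟩ ::ₘ C, p⟩ : AnsClause S o) ∈ N)
    (hnr : ¬ Redundant gt N
      (⟨⟨a, true, s(s, t)⟩ ::ₘ ⟨a, true, s(l, r)⟩ ::ₘ C, p⟩ : AnsClause S o))
    (hground : (AnsClause.subst θ
      ⟨⟨a, true, s(s, t)⟩ ::ₘ ⟨a, true, s(l, r)⟩ ::ₘ C, p⟩).Ground)
    (hadm : Admissible c U (AnsClause.subst θ
      ⟨⟨a, true, s(s, t)⟩ ::ₘ ⟨a, true, s(l, r)⟩ ::ₘ C, p⟩))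
    (hp : (p.subst θ).Computable c)
    (hsel : ∀ K ∈ Clause.subst θ (⟨a, true, s(l, r)⟩ ::ₘ C),
      ¬ LitGt gt K (Lit.subst θ ⟨a, true, s(s, t)⟩))
    (hsl : s.subst θ = l.subst θ) (hst : gt ⟨a, s.subst θ⟩ ⟨a, t.subst θ⟩)
    (hsr : gt ⟨a, s.subst θ⟩ ⟨a, r.subst θ⟩) (hrt : ¬ gt ⟨a, r.subst θ⟩ ⟨a, t.subst θ⟩)
    (hnf : normalize hgt.wf G a (t.subst θ) = normalize hgt.wf G a (r.subst θ))
    (hbelow : TrueBelow c gt N U (normalize hgt.wf G)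
      (Clause.subst θ (⟨a, true, s(s, t)⟩ ::ₘ ⟨a, true, s(l, r)⟩ ::ₘ C)))
    (hfalse : ¬ (Clause.subst θ (⟨a, true, s(s, t)⟩ ::ₘ ⟨a, true, s(l, r)⟩ ::ₘ C)).TrueUnder
      (normalize hgt.wf G)) : False := by
  obtain ⟨σ, hσ⟩ := exists_mgu_term hsl
  obtain ⟨τ, hτ⟩ := hσ.2.2 θ hsl
  have hord : ¬ TermGe gt (t.subst σ) (s.subst σ) := hgt.not_termGe_of_gt (τ := τ) (by
    simpa only [term_subst_subst_of_factor hτ] using hst)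
  have hord' : ¬ gt ⟨a, r.subst σ⟩ ⟨a, t.subst σ⟩ := fun h => hrt (by
    simpa only [term_subst_subst_of_factor hτ] using hgt.subst τ _ _ _ _ h)
  have hinf := Inference.eqFac (c := c) (gt := gt) s t l r C p σ (hgt.selected_of_subst hsel) hσ
    hord hord' (computable_of_factor hτ hp)
  have hred := hsat _ _ _ hinf (by
    simp only [List.mem_singleton, forall_eq]
    exact ⟨_, hN, AnsClause.isVariant_refl _, hnr⟩)
  have hg := AnsClause.ground_mk.1 hground
  have hg' := hg.1
  simp only [Clause.subst_cons, Clause.ground_cons, Lit.subst_mk, Lit.ground_mk] at hg'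
  have := hgt.conclusion_trueUnder (G := G) (U := U) hsorts hred (τ := τ) hg.1
    (by simpa only [List.mem_singleton, forall_eq, subst_subst_of_factor hτ] using hground)
    (by
      rw [subst_subst_of_factor hτ]
      refine AnsClause.ground_mk.2 ⟨?_, hg.2⟩
      simp only [Clause.subst_cons, Clause.ground_cons, Lit.subst_mk, Lit.ground_mk]
      tauto)
    (by simp only [List.mem_singleton, exists_eq_left, subst_subst_of_factor hτ]; rfl)
    (by simp only [List.mem_singleton, forall_eq, subst_subst_of_factor hτ]; exact .inl rfl)
    (by
      rw [subst_subst_of_factor hτ]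
      simp only [AnsClause.subst, Clause.subst_cons, Lit.subst_mk]
      exact clauseGt_replace_second _ _ (litGt_pos_neg (hsl ▸ hst) (hsl ▸ hsr)))
    (by rw [subst_subst_of_factor hτ]; exact hadm) hbelow
  rw [subst_subst_of_factor hτ] at this
  simp only [AnsClause.subst, Clause.subst_cons, Lit.subst_mk, Clause.trueUnder_cons,
    Lit.trueUnder_mk] at this hfalse
  tauto

end IsPartitionedSimplificationOrder

end SynSup

end

/-! ### Superposition inferences and abstracted premises -/

noncomputable section

namespace SynSup

open scoped Classical

variable {S : Sig} {o : S.Srt} {c : Set S.Fn} {gt : STerm S → STerm S → Prop}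

namespace IsPartitionedSimplificationOrder

variable {N : Set (AnsClause S o)} {U : Set (Term S o)} {G : Set (Clause S)}

/-- Rewriting with the rule preserves normal forms, so the conclusion stays false; by `hlow` all
that replaces the main literal is smaller than it. Relevance is kept in one of two ways: for
computable premises the new `ite` is computable, and for a common simple answer in `U` that answer
is retained. -/
theorem superposition_false (hgt : IsPartitionedSimplificationOrder c gt)
    (hsorts : ∀ s : S.Srt, ∃ u : Term S s, u.Ground) (hsat : SaturatedUpToRedundancy c gt N)
    {a b : S.Srt} {l r k : Term S a} {s t : Term S b} {pos : Bool} {C D : Clause S}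
    {p q : PTerm S o} {θ : Subst S}
    (hN₁ : ∃ Q ∈ N, AnsClause.IsVariant ⟨⟨a, true, s(l, r)⟩ ::ₘ C, p⟩ Q ∧ ¬ Redundant gt N Q)
    (hN₂ : ∃ Q ∈ N, AnsClause.IsVariant ⟨⟨b, pos, s(s, t)⟩ ::ₘ D, q⟩ Q ∧ ¬ Redundant gt N Q)
    (disj : Disjoint (AnsClause.vars ⟨⟨a, true, s(l, r)⟩ ::ₘ C, p⟩)
      (AnsClause.vars ⟨⟨b, pos, s(s, t)⟩ ::ₘ D, q⟩))
    (hg₁ : (AnsClause.subst θ ⟨⟨a, true, s(l, r)⟩ ::ₘ C, p⟩).Ground)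
    (hg₂ : (AnsClause.subst θ ⟨⟨b, pos, s(s, t)⟩ ::ₘ D, q⟩).Ground)
    (occ : k.IsSubterm s) (nonvar : ¬ k.IsVar) (hlk : l.subst θ = k.subst θ)
    (hlr : gt ⟨a, l.subst θ⟩ ⟨a, r.subst θ⟩) (hst : gt ⟨b, s.subst θ⟩ ⟨b, t.subst θ⟩)
    (hsel₁ : ∀ K ∈ C.subst θ, ¬ LitGt gt K (Lit.subst θ ⟨a, true, s(l, r)⟩))
    (hsel₂ : ∀ K ∈ D.subst θ, ¬ LitGt gt K (Lit.subst θ ⟨b, pos, s(s, t)⟩))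
    (hlow : ∀ K ∈ Clause.subst θ (⟨a, true, s(l, r)⟩ ::ₘ C),
      LitGt gt (Lit.subst θ ⟨b, pos, s(s, t)⟩) K)
    (hnf : normalize hgt.wf G a (l.subst θ) = normalize hgt.wf G a (r.subst θ))
    (hf₁ : ¬ (C.subst θ).TrueUnder (normalize hgt.wf G))
    (hf₂ : ¬ (Clause.subst θ (⟨b, pos, s(s, t)⟩ ::ₘ D)).TrueUnder (normalize hgt.wf G))
    (hp : (p.subst θ).Computable c) (hq : (q.subst θ).Computable c)
    (hadm : (Clause.subst θ (⟨a, true, s(l, r)⟩ ::ₘ C)).Computable c ∧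
        (Clause.subst θ (⟨b, pos, s(s, t)⟩ ::ₘ D)).Computable c ∨
      ∃ u ∈ U, p.subst θ = .simple u ∧ q.subst θ = .simple u)
    (hbelow : TrueBelow c gt N U (normalize hgt.wf G)
      (Clause.subst θ (⟨b, pos, s(s, t)⟩ ::ₘ D))) : False := by
  -- The two superposition rules yield the same clause before instantiation and differ only in
  -- unifier and answer. This is their common part.
  have hclause : ∀ (A : AnsClause S o) (σ τ : Subst S),
      (∀ s n, θ s n = (σ s n).subst τ) → A.cl = ⟨b, pos, s(Term.replace k r s, t)⟩ ::ₘ (C + D) →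
      Inference c gt [⟨⟨a, true, s(l, r)⟩ ::ₘ C, p⟩, ⟨⟨b, pos, s(s, t)⟩ ::ₘ D, q⟩] σ
        (A.subst σ) → (A.subst θ).ans.Ground →
      Admissible c U ⟨Clause.subst θ (⟨b, pos, s(s, t)⟩ ::ₘ D), (A.subst θ).ans⟩ → False := by
    intro A σ τ hτ hA hinf hans hadm
    have hred := hsat _ _ _ hinf (by
      simp only [List.mem_cons, List.not_mem_nil, or_false, forall_eq_or_imp, forall_eq]
      exact ⟨hN₁, hN₂⟩)
    have hg₁' := (AnsClause.ground_mk.1 hg₁).1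
    have hg₂' := (AnsClause.ground_mk.1 hg₂).1
    simp only [Clause.subst_cons, Clause.ground_cons, Lit.subst_mk, Lit.ground_mk] at hg₁' hg₂'
    have hs' : ((Term.replace k r s).subst θ).Ground := by
      rw [Term.ground_subst_iff]
      intro y hy
      rcases Term.vars_replace_subset k r s hy with hy | hy
      · exact Term.ground_subst_iff.1 hg₂'.1.1 y hy
      · exact Term.ground_subst_iff.1 hg₁'.1.2 y hy
    have hlt : ClauseGt gt (Clause.subst θ (⟨b, pos, s(s, t)⟩ ::ₘ D)) (A.subst θ).cl := by
      simp only [AnsClause.subst, hA, Clause.subst_cons, Clause.subst_add]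
      rw [← Multiset.cons_add]
      refine clauseGt_replace _ fun K hK => ?_
      rcases Multiset.mem_cons.1 hK with rfl | hK
      · exact litGt_left (hgt.replace_gt (hlk ▸ hlr) occ)
      · exact hlow K (by rw [Clause.subst_cons]; exact Multiset.mem_cons_of_mem hK)
    have := hgt.conclusion_trueUnder (G := G) (U := U) hsorts hred (τ := τ)
      (C := Clause.subst θ (⟨b, pos, s(s, t)⟩ ::ₘ D)) (AnsClause.ground_mk.1 hg₂).1
      (by
        simp only [List.mem_cons, List.not_mem_nil, or_false, forall_eq_or_imp, forall_eq,
          subst_subst_of_factor hτ]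
        exact ⟨hg₁, hg₂⟩)
      (by
        rw [subst_subst_of_factor hτ]
        refine AnsClause.ground_mk.2 ⟨?_, hans⟩
        rw [hA]
        simp only [Clause.subst_cons, Clause.ground_cons, Lit.subst_mk, Lit.ground_mk,
          Clause.subst_add, Clause.vars_add, Set.union_empty_iff]
        exact ⟨⟨hs', hg₂'.1.2⟩, hg₁'.2, hg₂'.2⟩)
      ⟨_, List.mem_cons_of_mem _ List.mem_cons_self, by rw [subst_subst_of_factor hτ]; rfl⟩
      (by
        simp only [List.mem_cons, List.not_mem_nil, or_false, forall_eq_or_imp, forall_eq,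
          subst_subst_of_factor hτ]
        refine ⟨.inr ?_, .inl rfl⟩
        refine bagGt_of_forall (by rw [Clause.subst_cons]; exact Multiset.cons_ne_zero) ?_
        exact fun K hK => ⟨_, by rw [Clause.subst_cons]; exact Multiset.mem_cons_self _ _,
          hlow K hK⟩)
      (by rwa [subst_subst_of_factor hτ])
      (by rwa [subst_subst_of_factor hτ]) hbelow
    rw [subst_subst_of_factor hτ] at this
    have hrep := hgt.normalize_replace G (θ := θ) (k := k) (r := r) (by rw [← hnf, hlk]) s
    simp only [AnsClause.subst, hA, Clause.subst_cons, Clause.subst_add, Clause.trueUnder_cons,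
      Clause.trueUnder_add, Lit.subst_mk, Lit.trueUnder_mk, hrep] at this hf₂
    tauto
  have hord : ∀ (σ τ : Subst S), (∀ s n, θ s n = (σ s n).subst τ) →
      ¬ TermGe gt (r.subst σ) (l.subst σ) ∧ ¬ TermGe gt (t.subst σ) (s.subst σ) := by
    intro σ τ hτ
    exact ⟨hgt.not_termGe_of_gt (τ := τ) (by simpa only [term_subst_subst_of_factor hτ] using hlr),
      hgt.not_termGe_of_gt (τ := τ) (by simpa only [term_subst_subst_of_factor hτ] using hst)⟩
  have hsel₁ := hgt.selected_of_subst hsel₁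
  have hsel₂ := hgt.selected_of_subst hsel₂
  rcases hadm with ⟨h₁, h₂⟩ | ⟨u, hu, hpu, hqu⟩
  · obtain ⟨σ, hσ⟩ := exists_mgu_term hlk
    obtain ⟨τ, hτ⟩ := hσ.2.2 θ hlk
    have hlr' := Lit.computable_mk.1 (h₁ (Lit.subst θ ⟨a, true, s(l, r)⟩)
      (by rw [Clause.subst_cons]; exact Multiset.mem_cons_self _ _))
    have hcomp : ((PTerm.ite l r q p).subst θ).Computable c := by
      simp only [PTerm.subst, PTerm.Computable]
      exact ⟨hlr'.1, hlr'.2, hq, hp⟩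
    refine hclause ⟨_, .ite l r q p⟩ σ τ hτ rfl
      (.supC l r k s t pos C D p q σ disj hsel₁ hsel₂ occ nonvar hσ (hord σ τ hτ).1
        (hord σ τ hτ).2 (computable_of_factor hτ hcomp)) ?_ (.inl ⟨h₂, hcomp⟩)
    have hp' := (AnsClause.ground_mk.1 hg₁).2
    have hq' := (AnsClause.ground_mk.1 hg₂).2
    have hg₁' := (AnsClause.ground_mk.1 hg₁).1
    simp only [Clause.subst_cons, Clause.ground_cons, Lit.subst_mk, Lit.ground_mk] at hg₁'
    simp only [PTerm.Ground, AnsClause.subst, PTerm.subst, PTerm.vars,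
      Set.union_empty_iff] at hp' hq' ⊢
    exact ⟨⟨⟨hg₁'.1.1, hg₁'.1.2⟩, hq'⟩, hp'⟩
  -- Only a simple program term has a simple instance, so the answers can be unified as terms.
  · cases p with
    | ite => simp [PTerm.subst] at hpu
    | simple p =>
    cases q with
    | ite => simp [PTerm.subst] at hqu
    | simple q =>
    have hpq : (PTerm.simple p).subst θ = (PTerm.simple q).subst θ := hpu.trans hqu.symm
    obtain ⟨σ, hσ⟩ := exists_mgu_term_simple hlk (by simpa only [PTerm.subst, PTerm.simple.injEq]
      using hpq)
    obtain ⟨τ, hτ⟩ := hσ.2.2 θ ⟨hlk, hpq⟩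
    refine hclause ⟨_, .simple p⟩ σ τ hτ rfl
      (.supU l r k s t pos C D (.simple p) (.simple q) σ disj hsel₁ hsel₂ occ nonvar hσ
        (hord σ τ hτ).1 (hord σ τ hτ).2 (computable_of_factor hτ hp) ⟨_, by rw [PTerm.subst]⟩)
      (AnsClause.ground_mk.1 hg₁).2 (.inr ⟨u, hu, hpu⟩)

/-- In an abstracted set, only uncomputable non-variable subterms occur in uncomputable instances
of greater sides of maximal literals. -/
theorem not_computable_of_abstracted (hgt : IsPartitionedSimplificationOrder c gt)
    (habs : Abstracted c gt N) {a b : S.Srt} {k : Term S a} {s t : Term S b} {pos : Bool}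
    {C : Clause S} {p : PTerm S o} {θ : Subst S}
    (hN : (⟨⟨b, pos, s(s, t)⟩ ::ₘ C, p⟩ : AnsClause S o) ∈ N)
    (hsel : Selected gt ⟨b, pos, s(s, t)⟩ C) (occ : k.IsSubterm s) (nonvar : ¬ k.IsVar)
    (hst : gt ⟨b, s.subst θ⟩ ⟨b, t.subst θ⟩) (hs : ¬ (s.subst θ).Computable c) :
    ¬ (k.subst θ).Computable c := by
  intro hk
  let P : Set (STerm S) := {u | u.2.IsSubterm s ∧ k.IsSubterm u.2 ∧ Separable c s u.2}
  -- A largest separable superterm of `k` in `s`; `k` itself is separable by `θ`. No proper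
  -- superterm of the chosen one is separable, so `Abs` would apply to it.
  obtain ⟨⟨a', k'⟩, ⟨h₁, h₂, h₃⟩, hmax⟩ :=
    (measure fun u : STerm S => s.size - u.2.size).wf.has_min P
      ⟨⟨a, k⟩, occ, .refl, θ, hs, hk⟩
  obtain ⟨x, hx⟩ : ∃ x : ℕ, (a', x) ∉ AnsClause.vars ⟨⟨b, pos, s(s, t)⟩ ::ₘ C, p⟩ := by
    by_contra hcon
    push Not at hcon
    refine Set.infinite_of_injective_forall_mem (f := fun x : ℕ => ((a', x) : Var S))
      (fun x y h => (Prod.mk.inj h).2) hcon (AnsClause.vars_finite _)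
  refine habs _ hN _ (.mk k' s t pos C p x hsel h₁ (hgt.not_termGe_of_gt hst) h₃ ?_
    (h₂.not_isVar nonvar) hx)
  intro d u hu hku hne hsep
  rcases hku.eq_or_size_lt with h | h
  · exact hne h.symm
  · refine hmax ⟨d, u⟩ ⟨hu, h₂.trans hku, hsep⟩ ?_
    have := hu.size_le
    change s.size - u.size < s.size - k'.size
    omega

end IsPartitionedSimplificationOrder

end SynSup

end

/-! ### False instances with a reducible maximal literal -/

noncomputable section

namespace SynSup

open scoped Classical

variable {S : Sig} {o : S.Srt} {c : Set S.Fn} {gt : STerm S → STerm S → Prop}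

theorem Clause.exists_cons_of_subst {C D : Clause S} {θ : Subst S} {L : Lit S}
    (h : C.subst θ = L ::ₘ D) : ∃ (L₀ : Lit S) (D₀ : Clause S), C = L₀ ::ₘ D₀ ∧ L₀.subst θ = L ∧
      D₀.subst θ = D := by
  have hL : L ∈ C.subst θ := h ▸ Multiset.mem_cons_self L D
  obtain ⟨L₀, hL₀, rfl⟩ := Multiset.mem_map.1 hL
  obtain ⟨D₀, rfl⟩ := Multiset.exists_cons_of_mem hL₀
  rw [subst_cons] at h
  exact ⟨L₀, D₀, rfl, rfl, (Multiset.cons_inj_right _).1 h⟩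

theorem Lit.exists_of_subst {L : Lit S} {θ : Subst S} {a : S.Srt} {b : Bool} {u v : Term S a}
    (h : L.subst θ = ⟨a, b, s(u, v)⟩) :
    ∃ u₀ v₀ : Term S a, L = ⟨a, b, s(u₀, v₀)⟩ ∧ u₀.subst θ = u ∧ v₀.subst θ = v := by
  obtain ⟨a', b', u₀, v₀, rfl⟩ := L.exists_eq
  rw [subst_mk, Lit.mk.injEq] at h
  obtain ⟨rfl, rfl, h⟩ := h
  rcases Sym2.eq_iff.1 (eq_of_heq h) with ⟨h₁, h₂⟩ | ⟨h₁, h₂⟩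
  · exact ⟨u₀, v₀, rfl, h₁, h₂⟩
  · exact ⟨v₀, u₀, by rw [Sym2.eq_swap], h₂, h₁⟩

namespace IsPartitionedSimplificationOrder

variable {N : Set (AnsClause S o)} {U : Set (Term S o)}

theorem _root_.SynSup.Admissible.ans_computable {B : AnsClause S o} (hU : ∀ u ∈ U, u.Computable c)
    (h : Admissible c U B) : B.ans.Computable c := by
  rcases h with h | ⟨u, hu, h⟩
  · exact h.2
  · rw [h, PTerm.Computable]; exact hU u hu

/-- A single uncomputable side exceeds all sides of a computable literal. -/
theorem litGt_of_not_computable (hgt : IsPartitionedSimplificationOrder c gt) {L K : Lit S}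
    (hL : L.vars = ∅) (hK : K.vars = ∅) (hLc : L.Computable c) (hKc : ¬ K.Computable c) :
    LitGt gt K L := by
  simp only [Lit.Computable, not_forall] at hKc
  obtain ⟨w, hw, hwc⟩ := hKc
  exact bagGt_of_forall (fun h0 => by rw [h0] at hw; exact Multiset.notMem_zero _ hw) fun y hy =>
    ⟨w, hw, hgt.partitioned w y (Lit.ground_iff_bag.1 hK w hw) (Lit.ground_iff_bag.1 hL y hy) hwc
      (hLc y hy)⟩

/-- A false relevant instance whose maximal literal is reducible contradicts saturation. -/
theorem reducible_false (hgt : IsPartitionedSimplificationOrder c gt)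
    (hsorts : ∀ s : S.Srt, ∃ u : Term S s, u.Ground) (hsat : SaturatedUpToRedundancy c gt N)
    (habs : Abstracted c gt N) (hU : ∀ u ∈ U, u.Computable c) (hU' : U.Subsingleton)
    {b : S.Srt} {s t : Term S b} {pos : Bool} {C : Clause S} {q : PTerm S o} {θ : Subst S}
    (hN : (⟨⟨b, pos, s(s, t)⟩ ::ₘ C, q⟩ : AnsClause S o) ∈ N)
    (hnr : ¬ Redundant gt N (⟨⟨b, pos, s(s, t)⟩ ::ₘ C, q⟩ : AnsClause S o))
    (hground : (AnsClause.subst θ ⟨⟨b, pos, s(s, t)⟩ ::ₘ C, q⟩).Ground)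
    (hadm : Admissible c U (AnsClause.subst θ ⟨⟨b, pos, s(s, t)⟩ ::ₘ C, q⟩))
    (hsel : ∀ K ∈ C.subst θ, ¬ LitGt gt K (Lit.subst θ ⟨b, pos, s(s, t)⟩))
    (hst : gt ⟨b, s.subst θ⟩ ⟨b, t.subst θ⟩)
    (hθ : ∀ x ∈ s.vars, normalize hgt.wf (admissibleClauses c gt N U) x.1 (θ x.1 x.2) =
      θ x.1 x.2)
    (hred : pos = false ∧
        normalize hgt.wf (admissibleClauses c gt N U) b (s.subst θ) ≠ s.subst θ ∨
      pos = true ∧ Defines gt (admissibleClauses c gt N U)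
        (normalize hgt.wf (admissibleClauses c gt N U)) (s.subst θ) (t.subst θ))
    (hbelow : TrueBelow c gt N U (normalize hgt.wf (admissibleClauses c gt N U))
      (Clause.subst θ (⟨b, pos, s(s, t)⟩ ::ₘ C)))
    (hfalse : ¬ (Clause.subst θ (⟨b, pos, s(s, t)⟩ ::ₘ C)).TrueUnder
      (normalize hgt.wf (admissibleClauses c gt N U))) : False := by
  set G := admissibleClauses c gt N U with hG
  have hg := (AnsClause.ground_mk.1 hground).1
  simp only [Clause.subst_cons, Clause.ground_cons, Lit.subst_mk, Lit.ground_mk] at hg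
  obtain ⟨⟨hsg, htg⟩, hCg⟩ := hg
  obtain ⟨a, l, r, hl, hrule, hnf⟩ := hgt.exists_redex G hsg
    (hred.imp And.right fun h => ⟨_, h.2⟩)
  -- The redex cannot lie inside a substituted term: that term is normal, whereas the normal form of
  -- a redex is at most `r` and so below `l`.
  obtain ⟨k, hk, hknv, rfl⟩ : ∃ k : Term S a, k.IsSubterm s ∧ ¬ k.IsVar ∧ k.subst θ = l := by
    rcases hl.of_subst with h | ⟨x, hx, hlx⟩
    · exact h
    · have h₁ := hgt.normalize_eq_of_isSubterm G hlx (hθ x hx)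
      rw [hnf] at h₁
      rcases hgt.normalize_le G r with h | h
      · rw [h₁] at h
        have := hrule.1.2.1
        rw [h] at this
        exact (hgt.irrefl _ this).elim
      · rw [h₁] at h
        exact (hgt.asymm h hrule.1.2.1).elim
  obtain ⟨⟨hrg, hlr, D', hD', hinert⟩, hmin⟩ := hrule
  obtain ⟨A, hA, hAnr, θ₁, hAg, hAadm, hAD⟩ := hD'
  obtain ⟨L₀, D, hAcl, hL₀, rfl⟩ := Clause.exists_cons_of_subst hAD.symm
  obtain ⟨l₀, r₀, rfl, hl₀, rfl⟩ := Lit.exists_of_subst hL₀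
  obtain ⟨Acl, p⟩ := A
  obtain rfl : Acl = _ := hAcl
  -- Below the root the greater side alone dominates the rule. At the root a negative literal wins
  -- by multiplicity, and a positive one because the rule has a least right-hand side.
  have hLlr : LitGt gt (Lit.subst θ ⟨b, pos, s(s, t)⟩)
      ⟨a, true, s(k.subst θ, r₀.subst θ₁)⟩ := by
    rcases hgt.gt_of_isSubterm hl with he | hlt
    · obtain rfl : a = b := congrArg Sigma.fst he
      have he : k.subst θ = s.subst θ := eq_of_heq (Sigma.mk.inj he).2
      rw [he] at hlr hmin hnf ⊢
      rcases hred with ⟨rfl, _⟩ | ⟨rfl, hdef⟩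
      · exact litGt_neg_pos hlr
      · refine litGt_right ?_
        have hf := hfalse
        rw [Clause.subst_cons, Clause.trueUnder_cons, Lit.subst_mk, Lit.trueUnder_mk] at hf
        -- Equal right-hand sides would make the main clause true. As the main clause also provides
        -- a rule for `s`, minimality excludes a greater `r₀`.
        have hne : t.subst θ ≠ r₀.subst θ₁ := fun he =>
          hf (.inl ⟨fun _ => by rw [he]; exact hnf, fun _ => rfl⟩)
        exact (hgt.total_ground htg hrg hne).resolve_right (hmin _ hdef)
    · refine litGt_of_side fun w hw => ?_
      rcases Lit.mem_bag_mk.1 hw with rfl | rfl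
      · exact hlt
      · exact hgt.trans _ _ _ hlt hlr
  have hlow : ∀ K ∈ Clause.subst θ₁ (⟨a, true, s(l₀, r₀)⟩ ::ₘ D),
      LitGt gt (Lit.subst θ ⟨b, pos, s(s, t)⟩) K := by
    intro K hK
    rw [Clause.subst_cons, Lit.subst_mk, hl₀] at hK
    rcases Multiset.mem_cons.1 hK with rfl | hK
    · exact hLlr
    · exact BagGt.trans hLlr (hinert K hK).litGt
  have hcc : ClauseGt gt (Clause.subst θ (⟨b, pos, s(s, t)⟩ ::ₘ C))
      (Clause.subst θ₁ (⟨a, true, s(l₀, r₀)⟩ ::ₘ D)) :=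
    bagGt_of_forall (by rw [Clause.subst_cons]; exact Multiset.cons_ne_zero) fun K hK =>
      ⟨_, by rw [Clause.subst_cons]; exact Multiset.mem_cons_self _ _, hlow K hK⟩
  have hp := hAadm.ans_computable hU
  have hq := hadm.ans_computable hU
  -- This decides between `supC` and `supU`.
  have hlabel : (Clause.subst θ₁ (⟨a, true, s(l₀, r₀)⟩ ::ₘ D)).Computable c ∧
      (Clause.subst θ (⟨b, pos, s(s, t)⟩ ::ₘ C)).Computable c ∨
      ∃ u ∈ U, p.subst θ₁ = .simple u ∧ q.subst θ = .simple u := by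
    by_cases hc : (Clause.subst θ (⟨b, pos, s(s, t)⟩ ::ₘ C)).Computable c
    · exact .inl ⟨hgt.clause_computable_of_gt (AnsClause.ground_mk.1 hground).1
        (AnsClause.ground_mk.1 hAg).1 hc hcc, hc⟩
    · obtain ⟨u, hu, hqu⟩ := hadm.resolve_left fun h => hc h.1
      -- A computable `s` would make the maximal literal computable, and any uncomputable literal of
      -- the clause would then be greater.
      have hsc : ¬ (s.subst θ).Computable c := by
        intro hsc
        have hLc : Lit.Computable c ⟨b, pos, s(s.subst θ, t.subst θ)⟩ :=
          Lit.computable_mk.2 ⟨hsc, hgt.computable_of_gt (t := ⟨b, s.subst θ⟩) hsg htg hsc hst⟩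
        refine hc fun K hK => ?_
        rw [Clause.subst_cons] at hK
        rcases Multiset.mem_cons.1 hK with rfl | hK
        · exact hLc
        · by_contra hKc
          exact hsel K hK (hgt.litGt_of_not_computable (Lit.ground_mk.2 ⟨hsg, htg⟩)
            (Clause.ground_of_mem hCg hK) hLc hKc)
      have hkc := hgt.not_computable_of_abstracted habs hN (hgt.selected_of_subst hsel) hk hknv
        hst hsc
      -- The left-hand side of the rule is uncomputable, so the rule clause is relevant only through
      -- its answer in `U`, which has at most one element.
      rcases hAadm with ⟨h, _⟩ | ⟨u', hu', hpu⟩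
      · refine (hkc ?_).elim
        have := h (Lit.subst θ₁ ⟨a, true, s(l₀, r₀)⟩) (Multiset.mem_map_of_mem _
          (Multiset.mem_cons_self _ _))
        rw [Lit.subst_mk, Lit.computable_mk, hl₀] at this
        exact this.1
      · exact .inr ⟨u, hu, hU' hu' hu ▸ hpu, hqu⟩
  -- The premises are renamed apart, and `θ₁` and `θ` are merged into one substitution.
  obtain ⟨π, ϑ, hdisj, hϑ₁, hϑ⟩ := AnsClause.exists_variant ⟨⟨a, true, s(l₀, r₀)⟩ ::ₘ D, p⟩
    ⟨⟨b, pos, s(s, t)⟩ ::ₘ C, q⟩ θ₁ θ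
  set ρ : Subst S := fun s n => .var s (π s n) with hρ
  have hA₁ : ((⟨⟨a, true, s(l₀, r₀)⟩ ::ₘ D, p⟩ : AnsClause S o).subst ρ).subst ϑ =
      (⟨⟨a, true, s(l₀, r₀)⟩ ::ₘ D, p⟩ : AnsClause S o).subst θ₁ := by
    rw [AnsClause.subst_subst]
    exact AnsClause.subst_congr fun x hx => hϑ₁ x hx
  have hA₂ : (⟨⟨b, pos, s(s, t)⟩ ::ₘ C, q⟩ : AnsClause S o).subst ϑ =
      (⟨⟨b, pos, s(s, t)⟩ ::ₘ C, q⟩ : AnsClause S o).subst θ := AnsClause.subst_congr hϑ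
  have hcl₂ := congrArg AnsClause.cl hA₂
  have hans₂ := congrArg AnsClause.ans hA₂
  have hcl₁ := congrArg AnsClause.cl hA₁
  have hans₁ := congrArg AnsClause.ans hA₁
  simp only [AnsClause.subst] at hcl₁ hcl₂ hans₁ hans₂
  have hv : ∀ x, x ∈ l₀.vars ∨ x ∈ r₀.vars ∨ x ∈ D.vars →
      x ∈ AnsClause.vars (⟨⟨a, true, s(l₀, r₀)⟩ ::ₘ D, p⟩ : AnsClause S o) := by
    intro x hx
    simp only [AnsClause.vars, Clause.vars_cons, Lit.vars_mk, Set.mem_union]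
    rcases hx with hx | hx | hx <;> simp only [hx, true_or, or_true]
  have hv₂ : ∀ x, x ∈ s.vars ∨ x ∈ t.vars ∨ x ∈ C.vars →
      x ∈ AnsClause.vars (⟨⟨b, pos, s(s, t)⟩ ::ₘ C, q⟩ : AnsClause S o) := by
    intro x hx
    simp only [AnsClause.vars, Clause.vars_cons, Lit.vars_mk, Set.mem_union]
    rcases hx with hx | hx | hx <;> simp only [hx, true_or, or_true]
  have hl₁ : (l₀.subst ρ).subst ϑ = k.subst θ := by
    rw [← hl₀, Term.subst_subst]
    exact Term.subst_congr fun x hx => hϑ₁ x (hv x (.inl hx))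
  have hr₁ : (r₀.subst ρ).subst ϑ = r₀.subst θ₁ := by
    rw [Term.subst_subst]
    exact Term.subst_congr fun x hx => hϑ₁ x (hv x (.inr (.inl hx)))
  have hD₁ : (D.subst ρ).subst ϑ = D.subst θ₁ := by
    rw [Clause.subst_subst]
    exact Clause.subst_congr fun x hx => hϑ₁ x (hv x (.inr (.inr hx)))
  have hs₂ : s.subst ϑ = s.subst θ := Term.subst_congr fun x hx => hϑ x (hv₂ x (.inl hx))
  have ht₂ : t.subst ϑ = t.subst θ := Term.subst_congr fun x hx => hϑ x (hv₂ x (.inr (.inl hx)))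
  have hC₂ : C.subst ϑ = C.subst θ := Clause.subst_congr fun x hx => hϑ x (hv₂ x (.inr (.inr hx)))
  have hk₂ : k.subst ϑ = k.subst θ :=
    Term.subst_congr fun x hx => hϑ x (hv₂ x (.inl (hk.vars_subset hx)))
  refine hgt.superposition_false (G := G) (U := U) hsorts hsat (l := l₀.subst ρ) (r := r₀.subst ρ)
    (k := k) (s := s) (t := t) (pos := pos) (C := D.subst ρ) (D := C) (p := p.subst ρ) (q := q)
    (θ := ϑ) ⟨_, hA, ⟨π, ?_⟩, hAnr⟩ ⟨_, hN, AnsClause.isVariant_refl _, hnr⟩ ?_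
    ?_ ?_ hk hknv ?_ ?_ ?_ ?_ ?_ ?_ ?_ ?_ ?_ ?_ ?_ ?_ ?_
  · simp only [AnsClause.subst, Clause.subst_cons, Lit.subst_mk, hρ]
  · simpa only [AnsClause.subst, Clause.subst_cons, Lit.subst_mk] using hdisj
  · rw [← hA₁] at hAg
    simpa only [AnsClause.subst, Clause.subst_cons, Lit.subst_mk] using hAg
  · rwa [hA₂]
  · rw [hl₁, hk₂]
  · rwa [hl₁, hr₁]
  · rwa [hs₂, ht₂]
  · rw [hD₁, Lit.subst_mk, hl₁, hr₁]
    exact fun K hK => hgt.litGt_asymm (hinert K hK).litGt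
  · rwa [hC₂, Lit.subst_mk, hs₂, ht₂]
  · rw [Lit.subst_mk, hs₂, ht₂, Clause.subst_cons, Lit.subst_mk, hl₁, hr₁, hD₁]
    rwa [Clause.subst_cons, Lit.subst_mk, hl₀] at hlow
  · rwa [hl₁, hr₁]
  · rw [hD₁]
    rintro ⟨K, hK, hKt⟩
    exact (hinert K hK).not_trueUnder hnf hKt
  · rwa [hcl₂]
  · rwa [hans₁]
  · rwa [hans₂]
  · rw [hcl₂, hans₁, hans₂, ← Lit.subst_mk, ← Clause.subst_cons, hcl₁]
    exact hlabel
  · rwa [hcl₂]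

end IsPartitionedSimplificationOrder

end SynSup

end

/-! ### Truth of all relevant instances -/

noncomputable section

namespace SynSup

open scoped Classical

variable {S : Sig} {o : S.Srt} {c : Set S.Fn} {gt : STerm S → STerm S → Prop}

namespace IsPartitionedSimplificationOrder

variable {N : Set (AnsClause S o)} {U : Set (Term S o)}

/-- The literals of a ground clause that lie not above its positive literal `s ≃ t` and are false
are inert, unless equality factoring applies. -/
theorem inert_of_maximal (hgt : IsPartitionedSimplificationOrder c gt) {g : TermMap S} {a : S.Srt}
    {s t : Term S a} {K : Lit S} (hK : K.vars = ∅) (hs : s.Ground) (ht : t.Ground)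
    (hst : gt ⟨a, s⟩ ⟨a, t⟩) (hmax : ¬ LitGt gt K ⟨a, true, s(s, t)⟩) (hf : ¬ K.TrueUnder g)
    (hfac : ∀ r, K = ⟨a, true, s(s, r)⟩ → gt ⟨a, s⟩ ⟨a, r⟩ → ¬ gt ⟨a, r⟩ ⟨a, t⟩ →
      g a t ≠ g a r) : Inert gt g s t K := by
  -- A side greater than `s` would dominate both `s` and `t` and thus make `K` greater than `s ≃ t`.
  have hside : ∀ w ∈ K.bag, w = ⟨a, s⟩ ∨ gt ⟨a, s⟩ w := by
    intro w hw
    rcases hgt.total w ⟨a, s⟩ (Lit.ground_iff_bag.1 hK w hw) hs with h | h | h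
    · refine (hmax (bagGt_of_forall (fun h0 => ?_) fun y hy => ⟨w, hw, ?_⟩)).elim
      · rw [h0] at hw; exact Multiset.notMem_zero _ hw
      · rcases Lit.mem_bag_mk.1 hy with rfl | rfl
        · exact h
        · exact hgt.trans _ _ _ h hst
    · exact .inl h
    · exact .inr h
  by_cases hsK : (⟨a, s⟩ : STerm S) ∈ K.bag
  · obtain ⟨b, r, rfl⟩ : ∃ (b : Bool) (r : Term S a), K = ⟨a, b, s(s, r)⟩ := by
      obtain ⟨a', b, u, v, rfl⟩ := K.exists_eq
      rcases Lit.mem_bag_mk.1 hsK with h | h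
      · cases h; exact ⟨b, v, rfl⟩
      · cases h; exact ⟨b, u, by rw [Sym2.eq_swap]⟩
    cases b with
    -- The literal `s ≄ r` exceeds `s ≃ t`: the second copy of `s` in its bag dominates `t`.
    | false => exact (hmax (litGt_neg_pos hst)).elim
    | true =>
      rw [Lit.trueUnder_mk] at hf
      have hsr : gt ⟨a, s⟩ ⟨a, r⟩ := by
        refine (hside ⟨a, r⟩ (Lit.mem_bag_mk.2 (.inr rfl))).resolve_left fun h => ?_
        cases h
        simp at hf
      have hrt : ¬ gt ⟨a, r⟩ ⟨a, t⟩ := fun h => hmax (litGt_right h)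
      have hne := hfac r rfl hsr hrt
      refine .inr ⟨r, rfl, ?_, hne⟩
      exact (hgt.total_ground ht (Lit.ground_mk.1 hK).2 fun h => hne (by rw [h])).resolve_right hrt
  · exact .inl ⟨fun w hw => (hside w hw).resolve_left fun h => hsK (h ▸ hw), hf⟩

theorem exists_sides (hgt : IsPartitionedSimplificationOrder c gt) {L : Lit S} {θ : Subst S}
    (hL : (L.subst θ).vars = ∅) :
    ∃ (b : S.Srt) (pos : Bool) (s t : Term S b), L = ⟨b, pos, s(s, t)⟩ ∧
      (s.subst θ = t.subst θ ∨ gt ⟨b, s.subst θ⟩ ⟨b, t.subst θ⟩) := by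
  obtain ⟨b, pos, s, t, rfl⟩ := L.exists_eq
  rw [Lit.subst_mk, Lit.ground_mk] at hL
  by_cases he : s.subst θ = t.subst θ
  · exact ⟨b, pos, s, t, rfl, .inl he⟩
  · rcases hgt.total_ground hL.1 hL.2 he with h | h
    · exact ⟨b, pos, s, t, rfl, .inr h⟩
    · exact ⟨b, pos, t, s, by rw [Sym2.eq_swap], .inr h⟩

/-- All relevant ground instances of an abstracted saturated set are true in the model of normal
forms. -/
theorem trueUnder_of_admissible (hgt : IsPartitionedSimplificationOrder c gt)
    (hsorts : ∀ s : S.Srt, ∃ u : Term S s, u.Ground) (hsat : SaturatedUpToRedundancy c gt N)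
    (habs : Abstracted c gt N) (hno : ∀ p : PTerm S o, p.Computable c → ⟨0, p⟩ ∉ N)
    (hU : ∀ u ∈ U, u.Computable c) (hU' : U.Subsingleton)
    (hUn : ∀ u ∈ U, normalize hgt.wf (admissibleClauses c gt N U) o u = u) :
    ∀ B ∈ groundInstances N, Admissible c U B →
      B.cl.TrueUnder (normalize hgt.wf (admissibleClauses c gt N U)) := by
  set G := admissibleClauses c gt N U with hG
  intro B
  generalize hC : B.cl = C
  induction C using hgt.clauseGt_wf.induction generalizing B with
  | _ C ih =>
  subst hC
  intro hB hadm
  have hbelow : TrueBelow c gt N U (normalize hgt.wf G) B.cl :=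
    fun D hD hDa hlt => ih D.cl hlt D rfl hD hDa
  clear ih
  obtain ⟨hground, A, hA, θ, rfl⟩ := hB
  by_contra hfalse
  have hg := AnsClause.ground_mk.1 hground
  have hgv := AnsClause.ground_subst_iff.1 hground
  have hp := hadm.ans_computable hU
  -- An instance of a redundant member follows from smaller instances with the same answer, which
  -- are relevant and so true by induction.
  have hnr : ¬ Redundant gt N A := by
    intro hred
    refine hfalse (hgt.trueUnder_of_follows hsorts hg.1 (hred θ hground) ?_)
    rintro D ⟨hD, hlt⟩ hans
    exact ⟨(AnsClause.ground_mk.1 hD.1).1,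
      hbelow D hD (Admissible.of_gt hgt hg.1 hD.1 (hans ▸ hadm) hlt) hlt⟩
  -- Otherwise normalizing the value of `x` would give a smaller relevant instance with the same
  -- truth value.
  have hθ : ∀ x ∈ A.cl.vars, normalize hgt.wf G x.1 (θ x.1 x.2) = θ x.1 x.2 := by
    intro x hx
    by_contra hne
    have hxlt := (hgt.normalize_le G (θ x.1 x.2)).resolve_left hne
    set θ' : Subst S := updateVar θ x.1 x.2 (normalize hgt.wf G x.1 (θ x.1 x.2)) with hθ'
    have hsame : θ' x.1 x.2 = normalize hgt.wf G x.1 (θ x.1 x.2) := updateVar_same _ _ _ _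
    have hother : ∀ y : Var S, y ≠ x → θ' y.1 y.2 = θ y.1 y.2 :=
      fun y hy => updateVar_of_ne _ _ hy
    have hground' : (A.subst θ').Ground := by
      refine AnsClause.ground_subst_iff.2 fun y hy => ?_
      by_cases hyx : y = x
      · subst hyx; rw [hsame]; exact hgt.normalize_ground G (hgv y hy)
      · rw [hother y hyx]; exact hgv y hy
    have hlt : ClauseGt gt (A.cl.subst θ) (A.cl.subst θ') := by
      refine hgt.clauseGt_subst (fun y _ => ?_) ⟨x, hx, by rw [hsame]; exact hxlt⟩
      by_cases hyx : y = x
      · subst hyx; rw [hsame]; exact .inr hxlt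
      · exact .inl (hother y hyx)
    refine hfalse ((hgt.trueUnder_subst_congr G (θ' := θ') (fun s n => ?_) A.cl).1
      (hbelow (A.subst θ') ⟨hground', A, hA, θ', rfl⟩ ?_ hlt))
    · by_cases hyx : ((s, n) : Var S) = x
      · subst hyx; rw [hsame, hgt.normalize_idem]
      · rw [hother (s, n) hyx]
    · rcases hadm with ⟨h₁, h₂⟩ | ⟨u, hu, hans⟩
      -- Here the answer may change, since every computable answer of a computable clause is
      -- relevant.
      · refine .inl ⟨hgt.clause_computable_of_gt hg.1 (AnsClause.ground_mk.1 hground').1 h₁ hlt,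
          PTerm.computable_subst_iff.2 ⟨h₂.of_subst, fun y hy => ?_⟩⟩
        by_cases hyx : y = x
        · subst hyx
          rw [hsame]
          exact hgt.computable_of_gt (t := ⟨_, θ y.1 y.2⟩) (hgv y (.inl hx))
            (hgt.normalize_ground G (hgv y (.inl hx))) (h₁.of_subst hx) hxlt
        · rw [hother y hyx]
          exact (PTerm.computable_subst_iff.1 h₂).2 y hy
      · refine .inr ⟨u, hu, ?_⟩
        obtain ⟨C, p⟩ := A
        cases p with
        | ite => simp [AnsClause.subst, PTerm.subst] at hans
        | simple p =>
        simp only [AnsClause.subst, PTerm.subst, PTerm.simple.injEq] at hans ⊢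
        rw [← hans, hθ']
        -- The label is preserved: if `x` occurred in the answer, its value would be a subterm of
        -- the irreducible `u` and hence normal.
        refine Term.subst_updateVar_of_notMem fun hxp => hne ?_
        refine hgt.normalize_eq_of_isSubterm G ((Term.isSubterm_of_mem_vars hxp).subst θ) ?_
        rw [hans, hUn u hu]
  have hne : A.cl.subst θ ≠ 0 := by
    intro h0
    obtain ⟨C, p⟩ := A
    obtain rfl : C = 0 := Multiset.map_eq_zero.1 h0
    exact hno p (PTerm.Computable.of_subst hp) hA
  obtain ⟨L', hL', hmax⟩ := exists_maximal_mem hgt.litGt_irrefl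
    (fun _ _ _ h h' => BagGt.trans h h') hne
  obtain ⟨L, hL, rfl⟩ := Multiset.mem_map.1 hL'
  obtain ⟨b, pos, s, t, rfl, hst⟩ := hgt.exists_sides
    (Clause.ground_of_mem (L := L.subst θ) hg.1 hL')
  obtain ⟨Acl, p⟩ := A
  obtain ⟨C, rfl⟩ : ∃ C : Clause S, Acl = _ ::ₘ C := Multiset.exists_cons_of_mem hL
  have hsel : ∀ K ∈ C.subst θ, ¬ LitGt gt K (Lit.subst θ ⟨b, pos, s(s, t)⟩) := fun K hK =>
    hmax K (by rw [Clause.subst_cons]; exact Multiset.mem_cons_of_mem hK)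
  have hg₁ := hg.1
  simp only [Clause.subst_cons, Clause.ground_cons, Lit.subst_mk,
    Lit.ground_mk] at hg₁
  have hθs : ∀ x ∈ s.vars, normalize hgt.wf G x.1 (θ x.1 x.2) = θ x.1 x.2 := fun x hx =>
    hθ x (by rw [Clause.vars_cons, Lit.vars_mk]; exact .inl (.inl hx))
  have hf := hfalse
  simp only [AnsClause.subst, Clause.subst_cons, Clause.trueUnder_cons, Lit.subst_mk,
    Lit.trueUnder_mk, not_or] at hf
  cases pos with
  | false =>
    by_cases he : s.subst θ = t.subst θ
    · exact hgt.eqRes_false hsorts hsat hA hnr hground hadm hp hsel he hbelow hfalse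
    · have hst := hst.resolve_left he
      refine hgt.reducible_false hsorts hsat habs hU hU' hA hnr hground hadm hsel hst hθs
        (.inl ⟨rfl, fun hs => ?_⟩) hbelow hfalse
      have hnf : normalize hgt.wf G b (s.subst θ) = normalize hgt.wf G b (t.subst θ) := by
        simpa using hf.1
      -- If `s` were normal, it would be the normal form of `t`, which is never above `t`.
      rw [hs] at hnf
      rcases hgt.normalize_le G (t.subst θ) with h | h
      · exact he (hnf.trans h)
      · rw [← hnf] at h; exact hgt.asymm h hst
  | true =>
    have hnf : normalize hgt.wf G b (s.subst θ) ≠ normalize hgt.wf G b (t.subst θ) := by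
      simpa using hf.1
    have hst := hst.resolve_left fun he => hnf (by rw [he])
    -- The clause itself defines the rule `s → t` unless one of its other literals fails to be
    -- inert, and in that case equality factoring applies.
    refine hgt.reducible_false hsorts hsat habs hU hU' hA hnr hground hadm hsel hst hθs
      (.inr ⟨rfl, hg₁.1.2, hst, C.subst θ,
        ⟨_, hA, hnr, θ, hground, hadm, (Clause.subst_cons θ ⟨b, true, s(s, t)⟩ C).symm⟩,
          fun K hK => ?_⟩)
      hbelow hfalse
    refine hgt.inert_of_maximal (Clause.ground_of_mem hg₁.2 hK) hg₁.1.1 hg₁.1.2 hst (hsel K hK)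
      (fun hKt => hf.2 ⟨K, hK, hKt⟩) ?_
    rintro r' rfl hsr hrt hnf'
    obtain ⟨K₀, hK₀, hK₀s⟩ := Multiset.mem_map.1 hK
    obtain ⟨l, r, rfl, hl, rfl⟩ := Lit.exists_of_subst hK₀s
    obtain ⟨C, rfl⟩ : ∃ C' : Clause S, C = _ ::ₘ C' := Multiset.exists_cons_of_mem hK₀
    exact hgt.eqFac_false hsorts hsat hA hnr hground hadm hp hsel hl.symm hst hsr hrt hnf' hbelow
      hfalse

end IsPartitionedSimplificationOrder

end SynSup

end

noncomputable section

namespace SynSup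

open scoped Classical

variable {S : Sig} {o : S.Srt} {c : Set S.Fn} {gt : STerm S → STerm S → Prop}

/-! ## Limits of runs -/

/-- The sum of the squares of the sizes of the sides. -/
def Lit.weight (L : Lit S) : ℕ := (L.atom.toMultiset.map fun u => u.size ^ 2).sum

theorem Lit.weight_mk {a : S.Srt} {b : Bool} {u v : Term S a} :
    weight ⟨a, b, s(u, v)⟩ = u.size ^ 2 + v.size ^ 2 := by
  have : (s(u, v) : Sym2 (Term S a)).toMultiset = {u, v} := rfl
  simp [weight, this]

/-- The sum of the weights of the literals; it decreases in abstraction steps. -/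
def AnsClause.weight (A : AnsClause S o) : ℕ := (A.cl.map Lit.weight).sum

/-- The total size need not decrease, since splitting off `k` may only redistribute it. Squares do:
the two parts have sizes `m`, `n` with `m + n ≤ l`, `0 < n < l`, whence `m² + n² < l²`. The fresh
variable counts 0. -/
theorem Abs.weight_lt {A B : AnsClause S o} (h : Abs c gt A B) : B.weight < A.weight := by
  obtain ⟨k, s, t, pos, C, p, x, _, occ, _, ⟨θ, h₁, h₂⟩, _, nonvar, _⟩ := h
  have hlt : k.size < s.size := by
    rcases occ.eq_or_size_lt with h | h
    · cases h; exact (h₁ h₂).elim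
    · exact h
  have hk := Term.size_pos nonvar
  have hr := occ.size_replace_add_le x
  have key : (Term.replace k (.var _ x) s).size ^ 2 + k.size ^ 2 < s.size ^ 2 := by
    generalize (Term.replace k (.var _ x) s).size = m at *
    generalize k.size = n at *
    generalize s.size = l at *
    nlinarith [Nat.mul_le_mul hr hr, Nat.zero_le m]
  simp only [AnsClause.weight, Multiset.map_cons, Multiset.sum_cons, Lit.weight_mk, Term.size]
  omega

/-- The conclusion of an abstraction has an instance that entails a given instance of the
premise and has the same answer. -/
theorem Abs.exists_instance {A B : AnsClause S o} (h : Abs c gt A B) {θ : Subst S}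
    (hg : (A.subst θ).Ground) : ∃ θ' : Subst S, (B.subst θ').Ground ∧
      (B.subst θ').ans = (A.subst θ).ans ∧
      ∀ I : Interp S, (B.subst θ').cl.TrueIn I → (A.subst θ).cl.TrueIn I := by
  obtain @⟨a, b, k, s, t, pos, C, p, x, _, occ, _, _, _, _, fresh⟩ := h
  -- With this value for `x`, the side `s` is restored and the added literal becomes the
  -- unsatisfiable `k ≄ k`.
  set θ' : Subst S := updateVar θ a x (k.subst θ) with hθ'
  have hv : ∀ y ∈ AnsClause.vars (⟨⟨b, pos, s(s, t)⟩ ::ₘ C, p⟩ : AnsClause S o),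
      θ' y.1 y.2 = θ y.1 y.2 := by
    intro y hy
    exact updateVar_of_ne _ _ fun he => fresh ((show y = (a, x) from he) ▸ hy)
  have hx : θ' a x = k.subst θ := updateVar_same _ _ _ _
  have hsub := AnsClause.subst_congr hv
  have hs : s.subst θ' = s.subst θ := Term.subst_congr fun y hy => hv y
    (.inl (by rw [Clause.vars_cons, Lit.vars_mk]; exact .inl (.inl hy)))
  have ht : t.subst θ' = t.subst θ := Term.subst_congr fun y hy => hv y
    (.inl (by rw [Clause.vars_cons, Lit.vars_mk]; exact .inl (.inr hy)))
  have hC : C.subst θ' = C.subst θ := Clause.subst_congr fun y hy => hv y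
    (.inl (by rw [Clause.vars_cons]; exact .inr hy))
  have hp : p.subst θ' = p.subst θ := PTerm.subst_congr fun y hy => hv y (.inr hy)
  have hk : k.subst θ' = k.subst θ := Term.subst_congr fun y hy => hv y
    (.inl (by rw [Clause.vars_cons, Lit.vars_mk]; exact .inl (.inl (occ.vars_subset hy))))
  have hrep : (Term.replace k (.var a x) s).subst θ' = s.subst θ := by
    rw [Term.replace_subst_eq (by rw [hk]; exact hx), hs]
  have hcl : Clause.subst θ' (⟨b, pos, s(Term.replace k (.var a x) s, t)⟩ ::ₘ
      ⟨a, false, s(.var a x, k)⟩ ::ₘ C) = ⟨b, pos, s(s.subst θ, t.subst θ)⟩ ::ₘ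
      ⟨a, false, s(k.subst θ, k.subst θ)⟩ ::ₘ C.subst θ := by
    simp only [Clause.subst_cons, Lit.subst_mk, hrep, ht, hC, hk]
    simp only [Term.subst, hx]
  have hg' := AnsClause.ground_mk.1 hg
  have hgc := hg'.1
  simp only [Clause.subst_cons, Clause.ground_cons, Lit.subst_mk, Lit.ground_mk] at hgc
  refine ⟨θ', AnsClause.ground_mk.2 ⟨?_, ?_⟩, hp, fun I hI v => ?_⟩
  · rw [hcl]
    simp only [Clause.ground_cons, Lit.ground_mk, and_self]
    exact ⟨hgc.1, (occ.subst θ).ground hgc.1.1, hgc.2⟩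
  · rw [hp]; exact hg'.2
  · simp only [AnsClause.subst] at hI ⊢
    rw [hcl] at hI
    obtain ⟨L, hL, hLv⟩ := hI v
    rw [Clause.subst_cons]
    rcases Multiset.mem_cons.1 hL with rfl | hL
    · exact ⟨_, Multiset.mem_cons_self _ _, hLv⟩
    · rcases Multiset.mem_cons.1 hL with rfl | hL
      · simp [Lit.Holds] at hLv
      · exact ⟨L, Multiset.mem_cons_of_mem hL, hLv⟩

theorem Follows.trans {M M' : Set (AnsClause S o)} {A : AnsClause S o} (h : Follows M A)
    (h' : ∀ B ∈ M, B.ans = A.ans → Follows M' B) : Follows M' A := fun I hI =>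
  h I fun B hB hans => h' B hB hans I fun D hD hD' => hI D hD (hD'.trans hans)

/-- A clause of a run persists, or is abstracted, or is deleted. -/
theorem persists_or_removed {run : ℕ → Set (AnsClause S o)}
    (hstep : ∀ i, Step c gt (run i) (run (i + 1))) {i : ℕ} {A : AnsClause S o} (hA : A ∈ run i) :
    A ∈ {A | ∃ i, ∀ j, i ≤ j → A ∈ run j} ∨
      (∃ j B, Abs c gt A B ∧ B ∈ run j) ∨
      ∃ j, A ∈ run j ∧ Abstracted c gt (run j) ∧ Redundant gt (run j) A := by
  by_cases hper : ∀ j, i ≤ j → A ∈ run j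
  · exact .inl ⟨i, hper⟩
  · refine .inr ?_
    -- The step before the first absence after `i` is the one that removed `A`.
    have hex : ∃ j, i ≤ j ∧ A ∉ run j := by push Not at hper; exact hper
    obtain ⟨hj₁, hj₂⟩ := Nat.find_spec hex
    have hmin := fun m => Nat.find_min (m := m) hex
    generalize Nat.find hex = j at hj₁ hj₂ hmin
    obtain ⟨j, rfl⟩ : ∃ m, j = m + 1 := by
      rcases j with _ | m
      · obtain rfl : i = 0 := by omega
        exact (hj₂ hA).elim
      · exact ⟨m, rfl⟩
    have hAj : A ∈ run j := by
      rcases Nat.lt_or_ge j i with h | h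
      · obtain rfl : i = j + 1 := by omega
        exact (hj₂ hA).elim
      · by_contra hcon
        exact hmin j (Nat.lt_succ_self j) ⟨h, hcon⟩
    have hs := hstep j
    generalize hM : run (j + 1) = M at hs
    cases hs with
    | abs A' B hA' h =>
      by_cases hAA : A = A'
      · subst hAA
        exact .inl ⟨j + 1, B, h, by rw [hM]; exact Set.mem_insert _ _⟩
      · exact (hj₂ (by rw [hM]; exact Set.mem_insert_of_mem _ ⟨hAj, hAA⟩)).elim
    | infer Ps σ A' habs hPs h =>
      exact (hj₂ (by rw [hM]; exact Set.mem_insert_of_mem _ hAj)).elim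
    | delete A' habs hA' h =>
      by_cases hAA : A = A'
      · subst hAA
        exact .inr ⟨j, hAj, habs, h⟩
      · exact (hj₂ (by rw [hM]; exact ⟨hAj, hAA⟩)).elim
    | idle => exact (hj₂ (by rw [hM]; exact hAj)).elim

/-- The ground instances of the clauses of a run follow from those of its limit. -/
theorem IsLimitFrom.follows {N₀ N : Set (AnsClause S o)}
    (hgt : IsPartitionedSimplificationOrder c gt) (h : IsLimitFrom c gt N₀ N) {A : AnsClause S o}
    (hA : A ∈ N₀) {θ : Subst S} (hg : (A.subst θ).Ground) :
    Follows (groundInstances N) (A.subst θ) := by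
  obtain ⟨run, h0, hstep, rfl⟩ := h
  set N : Set (AnsClause S o) := {A | ∃ i, ∀ j, i ≤ j → A ∈ run j} with hN
  have hmem : ∀ A ∈ N, ∀ θ : Subst S, (A.subst θ).Ground →
      Follows (groundInstances N) (A.subst θ) :=
    fun A hA θ hg I hI => hI _ ⟨hg, A, hA, θ, rfl⟩ rfl
  -- For clauses that cannot be abstracted, induction on the clause order works: deletion happens
  -- only in abstracted sets, so the smaller clauses that justify it cannot be abstracted either.
  have habs : ∀ (C : Clause S) (i : ℕ) (A : AnsClause S o), A ∈ run i → (∀ B, ¬ Abs c gt A B) →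
      ∀ θ : Subst S, (A.subst θ).Ground → (A.subst θ).cl = C →
      Follows (groundInstances N) (A.subst θ) := by
    intro C
    induction C using hgt.clauseGt_wf.induction with
    | _ C ih =>
    rintro i A hA hAa θ hg rfl
    rcases persists_or_removed hstep hA with h | ⟨j, B, hB, _⟩ | ⟨j, _, hja, hred⟩
    · exact hmem A h θ hg
    · exact (hAa B hB).elim
    · refine (hred θ hg).trans ?_
      rintro _ ⟨⟨hBg, B, hB, θ', rfl⟩, hlt⟩ _
      exact ih _ hlt j B hB (hja B hB) θ' hBg rfl
  subst h0
  generalize (0 : ℕ) = i at hA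
  -- The clause order is useless here, as the instance after abstraction has an additional literal;
  -- the weight decreases instead. A deleted clause belongs to an abstracted set and is covered by
  -- `habs`.
  induction hw : A.weight using Nat.strong_induction_on generalizing A i θ with
  | _ w ih =>
  subst hw
  rcases persists_or_removed hstep hA with h | ⟨j, B, hB, hBj⟩ | ⟨j, hAj, hja, _⟩
  · exact hmem A h θ hg
  · obtain ⟨θ', hg', hans, himp⟩ := hB.exists_instance hg
    have := ih _ hB.weight_lt hg' j hBj rfl
    exact fun I hI => himp I (this I fun D hD hD' => hI D hD (hD'.trans hans))
  · exact habs _ j A hAj (hja A hAj) θ hg rfl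

end SynSup

end

noncomputable section

namespace SynSup

open scoped Classical

variable {S : Sig}

/-! ## Clausal normal forms -/

namespace Interp

theorem eval_congr (I : Interp S) {v w : I.Val} {s : S.Srt} {t : Term S s}
    (h : ∀ x ∈ t.vars, v x.1 x.2 = w x.1 x.2) : I.eval v t = I.eval w t := by
  induction t with
  | var s n => exact h (s, n) rfl
  | app f args ih =>
    simp only [eval]
    congr 1
    funext j
    exact ih j fun x hx => h x (Set.mem_iUnion.2 ⟨j, hx⟩)

end Interp

theorem Lit.holds_mk {I : Interp S} {v : I.Val} {a : S.Srt} {b : Bool} {t u : Term S a} :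
    Holds I v ⟨a, b, s(t, u)⟩ ↔ (b = true ↔ I.eval v t = I.eval v u) := by
  change (b = true ↔ s(_, _).IsDiag) ↔ _
  rw [Sym2.mk_isDiag_iff]

theorem Lit.holds_congr {I : Interp S} {v w : I.Val} {L : Lit S}
    (h : ∀ x ∈ L.vars, v x.1 x.2 = w x.1 x.2) : L.Holds I v ↔ L.Holds I w := by
  obtain ⟨a, b, t, u, rfl⟩ := L.exists_eq
  rw [vars_mk] at h
  rw [holds_mk, holds_mk, I.eval_congr fun x hx => h x (.inl hx),
    I.eval_congr fun x hx => h x (.inr hx)]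

theorem Formula.sat_congr {I : Interp S} {φ : Formula S} {v w : I.Val}
    (h : ∀ x ∈ φ.fv, v x.1 x.2 = w x.1 x.2) : φ.Sat I v ↔ φ.Sat I w := by
  induction φ generalizing v w with
  | falsum => exact Iff.rfl
  | eq l r =>
    simp only [Sat]
    rw [I.eval_congr fun x hx => h x (.inl hx), I.eval_congr fun x hx => h x (.inr hx)]
  | neg φ ih => exact not_congr (ih h)
  | and φ ψ ih₁ ih₂ =>
    exact and_congr (ih₁ fun x hx => h x (.inl hx)) (ih₂ fun x hx => h x (.inr hx))
  | or φ ψ ih₁ ih₂ =>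
    exact or_congr (ih₁ fun x hx => h x (.inl hx)) (ih₂ fun x hx => h x (.inr hx))
  | imp φ ψ ih₁ ih₂ =>
    exact imp_congr (ih₁ fun x hx => h x (.inl hx)) (ih₂ fun x hx => h x (.inr hx))
  | all s n φ ih =>
    refine forall_congr' fun a => ih fun x hx => ?_
    by_cases hxs : x = (s, n)
    · subst hxs; rw [updateVar_same, updateVar_same]
    · rw [updateVar_of_ne _ _ hxs, updateVar_of_ne _ _ hxs]; exact h x ⟨hx, hxs⟩
  | ex s n φ ih =>
    refine exists_congr fun a => ih fun x hx => ?_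
    by_cases hxs : x = (s, n)
    · subst hxs; rw [updateVar_same, updateVar_same]
    · rw [updateVar_of_ne _ _ hxs, updateVar_of_ne _ _ hxs]; exact h x ⟨hx, hxs⟩

section Clausify

variable {A : Type} {dA : A → List S.Srt} {cA : A → S.Srt}

/-- The restriction of an interpretation of an extended signature. -/
abbrev Interp.restrict (I : Interp (S.extend A dA cA)) : Interp S where
  carrier := I.carrier
  nonempty := I.nonempty
  fn f args := I.fn (Sum.inl f) args

/-- The valuation that interprets each variable by the value of the term that replaces it. -/
def Interp.pull (I : Interp (S.extend A dA cA)) (v : I.Val) (ρ : Subst (S.extend A dA cA)) :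
    I.restrict.Val :=
  fun s n => I.eval v (ρ s n)

theorem Interp.eval_lift (I : Interp (S.extend A dA cA)) (v : I.Val)
    (ρ : Subst (S.extend A dA cA)) {s : S.Srt} (t : Term S s) :
    I.eval v (t.lift ρ) = I.restrict.eval (I.pull v ρ) t := by
  induction t with
  | var s n => rfl
  | app f args ih =>
    exact congrArg (I.fn (Sum.inl f)) (funext ih)

theorem Term.vars_lift {ρ : Subst (S.extend A dA cA)} {s : S.Srt} {t : Term S s}
    {x : Var (S.extend A dA cA)} (h : x ∈ (t.lift ρ).vars) :
    ∃ y ∈ t.vars, x ∈ (ρ y.1 y.2).vars := by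
  induction t with
  | var s n => exact ⟨(s, n), rfl, h⟩
  | app f args ih =>
    simp only [Term.lift, Term.vars] at h
    obtain ⟨j, hj⟩ := Set.mem_iUnion.1 h
    obtain ⟨y, hy, hx⟩ := ih j hj
    exact ⟨y, Set.mem_iUnion.2 ⟨j, hy⟩, hx⟩

theorem Interp.pull_updateVar (I : Interp (S.extend A dA cA)) (v : I.Val)
    (ρ : Subst (S.extend A dA cA)) (s : S.Srt) (n : ℕ) (t : Term (S.extend A dA cA) s) :
    I.pull v (updateVar ρ s n t) = updateVar (I.pull v ρ) s n (I.eval v t) := by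
  funext s' n'
  by_cases h : ((s', n') : Var S) = (s, n)
  · cases h
    exact (congrArg (I.eval v) (updateVar_same _ _ _ _)).trans (updateVar_same _ _ _ _).symm
  · exact (congrArg (I.eval v) (updateVar_of_ne ρ t h)).trans
      (updateVar_of_ne (A := I.restrict.carrier) (I.pull v ρ) (I.eval v t) h).symm

/-- All variables of the term have names below `k`. -/
def Term.NamesBelow {s : S.Srt} (t : Term S s) (k : ℕ) : Prop := ∀ x ∈ t.vars, x.2 < k

/-- The formula has truth value `b`. -/
def Formula.HasTruth (I : Interp S) (v : I.Val) (φ : Formula S) (b : Bool) : Prop :=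
  if b = true then φ.Sat I v else ¬ φ.Sat I v

/-- Valuations that differ at most at variables with names in `[k, k')`. -/
def AgreeOutside (I : Interp S) (v w : I.Val) (k k' : ℕ) : Prop :=
  ∀ s n, n < k ∨ k' ≤ n → v s n = w s n

/-- The clauses with fresh names in `[k, k')` contain one that is falsified by changing the values
of the fresh variables. -/
def Falsifiable (I : Interp S) (v : I.Val) (cs : List (Clause S)) (k k' : ℕ) : Prop :=
  ∃ w : I.Val, AgreeOutside I v w k k' ∧ ∃ C ∈ cs, ∀ L ∈ C, ¬ L.Holds I w

theorem Falsifiable.mono {I : Interp S} {v : I.Val} {cs ds : List (Clause S)} {k k' m m' : ℕ}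
    (h : Falsifiable I v cs k k') (hsub : ∀ C ∈ cs, C ∈ ds) (hm : m ≤ k) (hm' : k' ≤ m') :
    Falsifiable I v ds m m' := by
  obtain ⟨w, hw, C, hC, hf⟩ := h
  refine ⟨w, fun s n hn => hw s n ?_, C, hsub C hC, hf⟩
  omega

/-- `X` consists of clauses with names below a new counter, and the universal closure of the
clauses with respect to the fresh names entails `T`. -/
def Clausifies (T : ∀ I : Interp S, I.Val → Prop) (k : ℕ) (X : List (Clause S) × ℕ) : Prop :=
  k ≤ X.2 ∧ (∀ C ∈ X.1, ∀ x ∈ C.vars, x.2 < X.2) ∧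
    ∀ (I : Interp S) (v : I.Val), ¬ T I v → Falsifiable I v X.1 k X.2

namespace Clausifies

variable {T T' : ∀ I : Interp S, I.Val → Prop} {k : ℕ} {X Y : List (Clause S) × ℕ}

theorem imp (h : Clausifies T k X) (hT : ∀ I v, T I v → T' I v) : Clausifies T' k X :=
  ⟨h.1, h.2.1, fun I v hv => h.2.2 I v fun hT' => hv (hT I v hT')⟩

theorem append (h : Clausifies T k X) (h' : Clausifies T' X.2 Y) :
    Clausifies (fun I v => T I v ∧ T' I v) k (X.1 ++ Y.1, Y.2) := by
  refine ⟨h.1.trans h'.1, fun C hC x hx => ?_, fun I v hv => ?_⟩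
  · rcases List.mem_append.1 hC with hC | hC
    · exact (h.2.1 C hC x hx).trans_le h'.1
    · exact h'.2.1 C hC x hx
  · by_cases hT : T I v
    · exact (h'.2.2 I v fun hT' => hv ⟨hT, hT'⟩).mono (fun C hC => List.mem_append.2 (.inr hC))
        h.1 le_rfl
    · exact (h.2.2 I v hT).mono (fun C hC => List.mem_append.2 (.inl hC)) le_rfl h'.1

/-- A clause of the first set is falsified first. `T'` stays false because it ignores those fresh
names, so a clause of the second set can be falsified by changing later names only, which do not
occur in the first clause. -/
theorem prod (h : Clausifies T k X) (h' : Clausifies T' X.2 Y)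
    (hT' : ∀ I v w, AgreeOutside I v w k X.2 → T' I w → T' I v) :
    Clausifies (fun I v => T I v ∨ T' I v) k (clauseProd X.1 Y.1, Y.2) := by
  have hk := h.1
  have hk' := h'.1
  refine ⟨hk.trans hk', fun E hE x hx => ?_, fun I v hv => ?_⟩
  · obtain ⟨C, hC, hE⟩ := List.mem_flatMap.1 hE
    obtain ⟨D, hD, rfl⟩ := List.mem_map.1 hE
    rw [Clause.vars_add] at hx
    rcases hx with hx | hx
    · exact (h.2.1 C hC x hx).trans_le hk'
    · exact h'.2.1 D hD x hx
  · rw [not_or] at hv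
    obtain ⟨w, hw, C, hC, hf⟩ := h.2.2 I v hv.1
    obtain ⟨w', hw', D, hD, hf'⟩ := h'.2.2 I w fun hw' => hv.2 (hT' I v w hw hw')
    refine ⟨w', fun s n hn => ?_, C + D, ?_, fun L hL => ?_⟩
    · rw [hw s n (by omega), hw' s n (by omega)]
    · exact List.mem_flatMap.2 ⟨C, hC, List.mem_map.2 ⟨D, hD, rfl⟩⟩
    · rcases Multiset.mem_add.1 hL with hL | hL
      · rw [← Lit.holds_congr (v := w) fun x hx => hw' x.1 x.2 (.inl (h.2.1 C hC x ⟨L, hL, hx⟩))]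
        exact hf L hL
      · exact hf' L hL

/-- A counterexample to the quantified statement is assigned to the name `k`, which lies in the
interval of names that may be changed. -/
theorem fresh (h : Clausifies T (k + 1) X) {s : S.Srt}
    (hT : ∀ I v, (∀ a : I.carrier s, T I (updateVar v s k a)) → T' I v) : Clausifies T' k X := by
  have hk := h.1
  refine ⟨(Nat.le_succ k).trans hk, h.2.1, fun I v hv => ?_⟩
  obtain ⟨a, ha⟩ : ∃ a : I.carrier s, ¬ T I (updateVar v s k a) := by
    by_contra hcon
    push Not at hcon
    exact hv (hT I v hcon)
  obtain ⟨w, hw, C, hC, hf⟩ := h.2.2 I _ ha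
  refine ⟨w, fun s' n hn => ?_, C, hC, hf⟩
  rw [← hw s' n (by omega), updateVar_of_ne]
  rintro ⟨⟩
  omega

end Clausifies

theorem Term.NamesBelow.mono {s : S.Srt} {t : Term S s} {k k' : ℕ} (h : t.NamesBelow k)
    (hk : k ≤ k') : t.NamesBelow k' := fun x hx => (h x hx).trans_le hk

theorem Formula.hasTruth_congr {I : Interp (S.extend A dA cA)} {φ : Formula S} {b : Bool}
    {v w : I.Val} {ρ ρ' : Subst (S.extend A dA cA)}
    (h : ∀ x ∈ φ.fv, I.eval v (ρ x.1 x.2) = I.eval w (ρ' x.1 x.2)) :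
    φ.HasTruth I.restrict (I.pull v ρ) b ↔ φ.HasTruth I.restrict (I.pull w ρ') b := by
  have := Formula.sat_congr (I := I.restrict) (φ := φ) (v := I.pull v ρ) (w := I.pull w ρ') h
  simp only [HasTruth, this]

theorem Term.NamesBelow.eval_eq {I : Interp S} {v w : I.Val} {s : S.Srt} {t : Term S s} {k k' : ℕ}
    (ht : t.NamesBelow k) (h : AgreeOutside I v w k k') : I.eval v t = I.eval w t :=
  I.eval_congr fun x hx => h x.1 x.2 (.inl (ht x hx))

theorem namesBelow_updateVar {ρ : Subst (S.extend A dA cA)} {φ : Formula S} {s : S.Srt} {n k : ℕ}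
    {t : Term (S.extend A dA cA) s} (hρ : ∀ x ∈ φ.fv \ {(s, n)}, (ρ x.1 x.2).NamesBelow k)
    (ht : t.NamesBelow k) : ∀ x ∈ φ.fv, (updateVar ρ s n t x.1 x.2).NamesBelow k := by
  intro x hx
  by_cases hxs : x = (s, n)
  · subst hxs; rw [updateVar_same]; exact ht
  · rw [updateVar_of_ne _ _ hxs]; exact hρ x ⟨hx, hxs⟩

theorem sat_pull_updateVar {I : Interp (S.extend A dA cA)} {v : I.Val}
    {ρ : Subst (S.extend A dA cA)} {φ : Formula S} {s : S.Srt} {n : ℕ}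
    (t : Term (S.extend A dA cA) s) :
    φ.Sat I.restrict (I.pull v (updateVar ρ s n t)) ↔
      φ.Sat I.restrict (updateVar (I.pull v ρ) s n (I.eval v t)) := by
  rw [Interp.pull_updateVar]

/-- The value of a formula under a fresh name for its bound variable. -/
theorem sat_updateVar_fresh {I : Interp (S.extend A dA cA)} {v : I.Val}
    {ρ : Subst (S.extend A dA cA)} {φ : Formula S} {s : S.Srt} {n k : ℕ}
    (hρ : ∀ x ∈ φ.fv \ {(s, n)}, (ρ x.1 x.2).NamesBelow k) (a : I.carrier s) :
    φ.Sat I.restrict (I.pull (updateVar v s k a)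
      (updateVar ρ s n (Term.var (S := S.extend A dA cA) s k))) ↔
    φ.Sat I.restrict (updateVar (I.pull v ρ) s n a) := by
  refine Formula.sat_congr fun x hx => ?_
  rw [Interp.pull_updateVar]
  by_cases hxs : x = (s, n)
  · subst hxs
    rw [updateVar_same, updateVar_same]
    exact updateVar_same _ _ _ _
  · rw [updateVar_of_ne _ _ hxs, updateVar_of_ne _ _ hxs]
    refine I.eval_congr fun y hy => updateVar_of_ne _ _ ?_
    intro h
    exact (hρ x ⟨hx, hxs⟩ y hy).ne (congrArg Prod.snd h)

/-- The clausal normal form of a formula entails the formula. -/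
theorem clausifies_clausify (φ : Formula S) : ∀ (b : Bool) (Γ : List S.Srt)
    (args : ∀ j : Fin Γ.length, Term (S.extend A dA cA) (Γ.get j))
    (sk : ∀ i : SkSym S b Γ φ,
      (∀ j : Fin i.dom.length, Term (S.extend A dA cA) (i.dom.get j)) →
        Term (S.extend A dA cA) i.cod)
    (ρ : Subst (S.extend A dA cA)) (k : ℕ),
    (∀ i args k, (∀ j, (args j).NamesBelow k) → (sk i args).NamesBelow k) →
    (∀ j, (args j).NamesBelow k) → (∀ x ∈ φ.fv, (ρ x.1 x.2).NamesBelow k) →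
    Clausifies (fun I v => φ.HasTruth I.restrict (I.pull v ρ) b) k
      (clausify φ b Γ args sk ρ k) := by
  induction φ with
  | falsum =>
    intro b Γ args sk ρ k _ _ _
    refine ⟨le_rfl, ?_, fun I v h => ?_⟩
    · cases b <;> simp [clausify, Clause.vars]
    · cases b
      · simp [Formula.HasTruth, Formula.Sat] at h
      · exact ⟨v, fun _ _ _ => rfl, 0, by simp [clausify], by simp⟩
  | @eq s l r =>
    intro b Γ args sk ρ k _ _ hρ
    refine ⟨le_rfl, ?_, fun I v h => ?_⟩
    · intro C hC x hx
      simp only [clausify, List.mem_singleton] at hC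
      subst hC
      obtain ⟨L, hL, hx⟩ := hx
      rw [Multiset.mem_singleton] at hL
      subst hL
      rw [Lit.vars_mk] at hx
      rcases hx with hx | hx
      · obtain ⟨y, hy, hx⟩ := Term.vars_lift hx
        exact hρ y (.inl hy) x hx
      · obtain ⟨y, hy, hx⟩ := Term.vars_lift hx
        exact hρ y (.inr hy) x hx
    · refine ⟨v, fun _ _ _ => rfl, {⟨s, b, s(l.lift ρ, r.lift ρ)⟩},
        by simp only [clausify, List.mem_singleton], ?_⟩
      simp only [Multiset.mem_singleton, forall_eq]
      rw [Lit.holds_mk, Interp.eval_lift, Interp.eval_lift]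
      cases b <;> simpa [Formula.HasTruth, Formula.Sat] using h
  | neg φ ih =>
    intro b Γ args sk ρ k hsk hargs hρ
    refine (ih (!b) Γ args (fun i => sk (.neg i)) ρ k (fun i => hsk (.neg i)) hargs hρ).imp
      fun I v h => ?_
    cases b <;> simpa [Formula.HasTruth, Formula.Sat] using h
  | and φ ψ ih₁ ih₂ =>
    intro b Γ args sk ρ k hsk hargs hρ
    have X := ih₁ b Γ args (fun i => sk (.andL i)) ρ k (fun i => hsk (.andL i)) hargs
      fun x hx => hρ x (.inl hx)
    have Y := ih₂ b Γ args (fun i => sk (.andR i)) ρ _ (fun i => hsk (.andR i))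
      (fun j => (hargs j).mono X.1) fun x hx => (hρ x (.inr hx)).mono X.1
    cases b with
    | true =>
      refine (X.append Y).imp fun I v h => ?_
      simpa [Formula.HasTruth, Formula.Sat] using h
    | false =>
      refine (X.prod Y fun I v w hvw h => ?_).imp fun I v h => ?_
      -- The terms replacing the free variables of `ψ` only use names below `k`, so the fresh names
      -- of `φ` do not affect it.
      · exact (Formula.hasTruth_congr fun x hx => (hρ x (.inr hx)).eval_eq hvw).2 h
      · simp only [Formula.HasTruth, Formula.Sat, Bool.false_eq_true, if_false] at h ⊢
        tauto
  | or φ ψ ih₁ ih₂ =>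
    intro b Γ args sk ρ k hsk hargs hρ
    have X := ih₁ b Γ args (fun i => sk (.orL i)) ρ k (fun i => hsk (.orL i)) hargs
      fun x hx => hρ x (.inl hx)
    have Y := ih₂ b Γ args (fun i => sk (.orR i)) ρ _ (fun i => hsk (.orR i))
      (fun j => (hargs j).mono X.1) fun x hx => (hρ x (.inr hx)).mono X.1
    cases b with
    | true =>
      refine (X.prod Y fun I v w hvw h => ?_).imp fun I v h => ?_
      · exact (Formula.hasTruth_congr fun x hx => (hρ x (.inr hx)).eval_eq hvw).2 h
      · simpa [Formula.HasTruth, Formula.Sat] using h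
    | false =>
      refine (X.append Y).imp fun I v h => ?_
      simp only [Formula.HasTruth, Formula.Sat, Bool.false_eq_true, if_false] at h ⊢
      tauto
  | imp φ ψ ih₁ ih₂ =>
    intro b Γ args sk ρ k hsk hargs hρ
    have X := ih₁ (!b) Γ args (fun i => sk (.impL i)) ρ k (fun i => hsk (.impL i)) hargs
      fun x hx => hρ x (.inl hx)
    have Y := ih₂ b Γ args (fun i => sk (.impR i)) ρ _ (fun i => hsk (.impR i))
      (fun j => (hargs j).mono X.1) fun x hx => (hρ x (.inr hx)).mono X.1
    cases b with
    | true =>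
      refine (X.prod Y fun I v w hvw h => ?_).imp fun I v h => ?_
      · exact (Formula.hasTruth_congr fun x hx => (hρ x (.inr hx)).eval_eq hvw).2 h
      · simp only [Formula.HasTruth, Formula.Sat, Bool.not_true, Bool.false_eq_true, if_false,
          if_true] at h ⊢
        tauto
    | false =>
      refine (X.append Y).imp fun I v h => ?_
      simp only [Formula.HasTruth, Formula.Sat, Bool.not_false, Bool.false_eq_true, if_false,
        if_true] at h ⊢
      tauto
  | all s n φ ih =>
    intro b Γ args sk ρ k hsk hargs hρ
    cases b with
    | true =>
      refine (ih true (s :: Γ) _ (fun i => sk (.underAll i)) _ (k + 1)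
        (fun i => hsk (.underAll i)) (fun j => ?_)
        (namesBelow_updateVar (fun x hx => (hρ x hx).mono (Nat.le_succ k)) ?_)).fresh
          (s := s) fun I v h => ?_
      · refine Fin.cases ?_ (fun j => (hargs j).mono (Nat.le_succ k)) j
        rintro x rfl
        exact Nat.lt_succ_self k
      · rintro x rfl
        exact Nat.lt_succ_self k
      · intro a
        exact (sat_updateVar_fresh hρ a).1 (h a)
    | false =>
      refine (ih false Γ args (fun i => sk (.inAll i)) _ k (fun i => hsk (.inAll i)) hargs
        (namesBelow_updateVar hρ (hsk .hereAll args k hargs))).imp fun I v h => ?_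
      simp only [Formula.HasTruth, Formula.Sat, Bool.false_eq_true, if_false] at h ⊢
      -- The quantifier is instantiated with the value of the Skolem term. Only this direction of
      -- skolemization is needed, so the interpretation of the Skolem functions is arbitrary.
      exact fun h' => h ((sat_pull_updateVar (sk .hereAll args)).2 (h' _))
  | ex s n φ ih =>
    intro b Γ args sk ρ k hsk hargs hρ
    cases b with
    | true =>
      refine (ih true Γ args (fun i => sk (.inEx i)) _ k (fun i => hsk (.inEx i)) hargs
        (namesBelow_updateVar hρ (hsk .hereEx args k hargs))).imp fun I v h => ?_
      simp only [Formula.HasTruth, Formula.Sat, if_true] at h ⊢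
      exact ⟨_, (sat_pull_updateVar (sk .hereEx args)).1 h⟩
    | false =>
      refine (ih false (s :: Γ) _ (fun i => sk (.underEx i)) _ (k + 1)
        (fun i => hsk (.underEx i)) (fun j => ?_)
        (namesBelow_updateVar (fun x hx => (hρ x hx).mono (Nat.le_succ k)) ?_)).fresh
          (s := s) fun I v h => ?_
      · refine Fin.cases ?_ (fun j => (hargs j).mono (Nat.le_succ k)) j
        rintro x rfl
        exact Nat.lt_succ_self k
      · rintro x rfl
        exact Nat.lt_succ_self k
      · simp only [Formula.HasTruth, Formula.Sat, Bool.false_eq_true, if_false] at h ⊢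
        rintro ⟨a, ha⟩
        exact h a ((sat_updateVar_fresh hρ a).2 ha)

end Clausify

end SynSup

end

noncomputable section

namespace SynSup

open scoped Classical

variable {S : Sig} {o : S.Srt} {c : Set S.Fn} {gt : STerm S → STerm S → Prop}

/-! ## Program terms in the models of normal forms -/

namespace IsPartitionedSimplificationOrder

/-- In all models of normal forms that agree on computable terms, a ground computable program term
has the value of one and the same computable term. -/
theorem exists_term_eval_eq (hgt : IsPartitionedSimplificationOrder c gt)
    (hsorts : ∀ s : S.Srt, ∃ u : Term S s, u.Ground) {G₀ : Set (Clause S)}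
    (hG₀ : ∀ C ∈ G₀, C.vars = ∅) {s : S.Srt} (t : PTerm S s) (htg : t.Ground)
    (htc : t.Computable c) :
    ∃ u : Term S s, u.Ground ∧ u.Computable c ∧ ∀ G : Set (Clause S), (∀ C ∈ G, C.vars = ∅) →
      (∀ C : Clause S, C.Computable c → (C ∈ G ↔ C ∈ G₀)) →
      ∀ v : (hgt.normalModel G hsorts).Val,
        (t.eval (hgt.normalModel G hsorts) v).1 = normalize hgt.wf G s u := by
  induction t with
  | simple t =>
    have ht : t.Ground := by simpa only [PTerm.Ground, PTerm.vars, Term.Ground] using htg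
    refine ⟨t, ht, by simpa only [PTerm.Computable] using htc, fun G _ _ v => ?_⟩
    rw [PTerm.eval, normalModel_eval, ht.subst_eq]
  | @ite a l r p q ihp ihq =>
    simp only [PTerm.Computable] at htc
    obtain ⟨hlc, hrc, hpc, hqc⟩ := htc
    simp only [PTerm.Ground, PTerm.vars, Set.union_empty_iff] at htg
    obtain ⟨⟨⟨hl, hr⟩, hp⟩, hq⟩ := htg
    obtain ⟨u, hug, huc, hu⟩ := ihp hp hpc
    obtain ⟨w, hwg, hwc, hw⟩ := ihq hq hqc
    -- The condition compares computable terms, so the normal forms for `G₀` decide it for every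
    -- `G`. The branch is thus fixed before `G`, which will depend on the resulting term.
    have key : ∀ G : Set (Clause S), (∀ C ∈ G, C.vars = ∅) →
        (∀ C : Clause S, C.Computable c → (C ∈ G ↔ C ∈ G₀)) →
        ∀ v : (hgt.normalModel G hsorts).Val,
          ((hgt.normalModel G hsorts).eval v l = (hgt.normalModel G hsorts).eval v r ↔
            normalize hgt.wf G₀ a l = normalize hgt.wf G₀ a r) := by
      intro G hG h v
      rw [← hgt.normalize_congr_of_computable hG hG₀ h hl hlc,
        ← hgt.normalize_congr_of_computable hG hG₀ h hr hrc]
      refine Subtype.ext_iff.trans ?_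
      rw [normalModel_eval, normalModel_eval, Term.Ground.subst_eq hl, Term.Ground.subst_eq hr]
    by_cases hlr : normalize hgt.wf G₀ a l = normalize hgt.wf G₀ a r
    · refine ⟨u, hug, huc, fun G hG h v => ?_⟩
      rw [PTerm.eval, if_pos ((key G hG h v).2 hlr)]
      exact hu G hG h v
    · refine ⟨w, hwg, hwc, fun G hG h v => ?_⟩
      rw [PTerm.eval, if_neg (mt (key G hG h v).1 hlr)]
      exact hw G hG h v

/-- A computable clause with a computable label is relevant without any label set; so the label can
be chosen after the computable part of the model is known. -/
theorem mem_admissibleClauses_iff {N : Set (AnsClause S o)} {u : Term S o}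
    (hu : u.Computable c) {C : Clause S} (hC : C.Computable c) :
    C ∈ admissibleClauses c gt N {u} ↔ C ∈ admissibleClauses c gt N ∅ := by
  constructor
  · rintro ⟨A, hA, hred, θ, hg, hadm, rfl⟩
    refine ⟨A, hA, hred, θ, hg, .inl ⟨hC, ?_⟩, rfl⟩
    rcases hadm with h | ⟨_, rfl, h⟩
    · exact h.2
    · simpa only [h, PTerm.Computable] using hu
  · rintro ⟨A, hA, hred, θ, hg, h | ⟨_, h, _⟩, rfl⟩
    · exact ⟨A, hA, hred, θ, hg, .inl h, rfl⟩
    · exact h.elim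

end IsPartitionedSimplificationOrder

/-! ### The clausal normal form of a specification -/

namespace Spec

variable {Λ : Spec}

/-- If the clauses of the clausal normal form are true whenever `y` has the value given by `v`,
then `¬ F[ᾱ, y]` is true under `v`. -/
theorem not_sat_of_cnf {I : Interp Λ.sig} {v : I.Val}
    (hv : ∀ x : {x : Var Λ.base // x ∈ Λ.inputs}, v x.1.1 x.1.2 = I.eval v (Λ.inputConst x))
    (h : ∀ C ∈ Λ.cnf, ∀ w : I.Val, w Λ.output.1 Λ.output.2 = v Λ.output.1 Λ.output.2 →
      ∃ L ∈ C, L.Holds I w) : ¬ Λ.F.Sat (Λ.reduct I) v := by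
  intro hF
  have henv : ∀ x ∈ Λ.F.fv, (Λ.env x.1 x.2).NamesBelow (Λ.output.2 + 1) ∧
      I.eval v (Λ.env x.1 x.2) = v x.1 x.2 := by
    intro x hx
    by_cases hi : x ∈ Λ.inputs
    · have he : Λ.env x.1 x.2 = Λ.inputConst ⟨x, hi⟩ := dif_pos hi
      rw [he]
      refine ⟨fun y hy => ?_, (hv ⟨x, hi⟩).symm⟩
      obtain ⟨j, _⟩ := Set.mem_iUnion.1 hy
      exact j.elim0
    · have he : Λ.env x.1 x.2 = Term.var (S := Λ.sig) x.1 x.2 := dif_neg hi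
      rw [he]
      refine ⟨fun y hy => ?_, rfl⟩
      cases hy
      rcases Λ.closed hx with rfl | hx
      · exact Nat.lt_succ_self _
      · exact (hi hx).elim
  have hcl := clausifies_clausify (A := Λ.NewFn) (dA := Λ.newDom) (cA := Λ.newCod) Λ.F false
    [Λ.osort] (Fin.cases Λ.outputTerm (fun j => j.elim0))
    (fun i args => Term.app (S := Λ.sig) (Sum.inr (Sum.inr i)) args) Λ.env (Λ.output.2 + 1)
    (fun i args k hargs x hx => by
      obtain ⟨j, hj⟩ := Set.mem_iUnion.1 hx
      exact hargs j x hj)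
    (Fin.cases (fun x hx => by cases hx; exact Nat.lt_succ_self _) (fun j => j.elim0))
    fun x hx => (henv x hx).1
  obtain ⟨w, hw, C, hC, hf⟩ := hcl.2.2 I v fun hT => by
    simp only [Formula.HasTruth, Bool.false_eq_true, if_false] at hT
    exact hT ((Formula.sat_congr (I := I.restrict) fun x hx => (henv x hx).2).2 hF)
  -- Fresh names start at `Λ.output.2 + 1`, so the falsifying valuation keeps the value of `y`.
  obtain ⟨L, hL, hLw⟩ := h C hC w (hw _ _ (.inl (Nat.lt_succ_self _))).symm
  exact hf L hL hLw

end Spec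

end SynSup

end

/-! ### The model for a given program term -/

theorem mainTheorem2 (Λ : SynSup.Spec)
    (gt : SynSup.STerm Λ.sig → SynSup.STerm Λ.sig → Prop)
    (hgt : SynSup.IsPartitionedSimplificationOrder Λ.comp gt)
    (hsorts : ∀ s : Λ.sig.Srt, ∃ u : SynSup.Term Λ.sig s, u.Ground)
    (N : Set (SynSup.AnsClause Λ.sig Λ.osort))
    (hfrom : SynSup.IsLimitFrom Λ.comp gt Λ.initial N)
    (hsat : SynSup.SaturatedUpToRedundancy Λ.comp gt N)
    (habs : SynSup.Abstracted Λ.comp gt N)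
    (hno : ∀ p : SynSup.PTerm Λ.sig Λ.osort, p.Computable Λ.comp → ⟨0, p⟩ ∉ N)
    (t : SynSup.PTerm Λ.sig Λ.osort) (htg : t.Ground) (htc : t.Computable Λ.comp) :
    Λ.NegSatisfiable t := by
  open SynSup in
  obtain ⟨u, hug, huc, hu⟩ := hgt.exists_term_eval_eq hsorts
    (admissibleClauses_ground (c := Λ.comp) (gt := gt) (N := N) (U := ∅)) t htg htc
  set G₀ := admissibleClauses Λ.comp gt N ∅ with hG₀
  -- The label has to be irreducible, hence the normal form instead of `u` itself.
  set z : Term Λ.sig Λ.osort := normalize hgt.wf G₀ _ u with hz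
  have hzg : z.Ground := hgt.normalize_ground G₀ hug
  have hzc : z.Computable Λ.comp := by
    rcases hgt.normalize_le G₀ u with h | h
    · rw [hz, h]; exact huc
    · exact hgt.computable_of_gt (t := ⟨_, u⟩) (u := ⟨_, z⟩) hug hzg huc h
  set G := admissibleClauses Λ.comp gt N {z} with hG
  have hmem : ∀ C : Clause Λ.sig, C.Computable Λ.comp → (C ∈ G ↔ C ∈ G₀) := fun C hC =>
    IsPartitionedSimplificationOrder.mem_admissibleClauses_iff hzc hC
  have hcongr : ∀ {s : Λ.sig.Srt} {w : Term Λ.sig s}, w.Ground → w.Computable Λ.comp →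
      normalize hgt.wf G s w = normalize hgt.wf G₀ s w := fun hw hwc =>
    hgt.normalize_congr_of_computable admissibleClauses_ground admissibleClauses_ground hmem hw hwc
  have hzn : normalize hgt.wf G _ z = z := by
    rw [hcongr hzg hzc, hz, hgt.normalize_idem]
  have htrue := hgt.trueUnder_of_admissible hsorts hsat habs hno (U := {z})
    (by rintro _ rfl; exact hzc) Set.subsingleton_singleton (by rintro _ rfl; exact hzn)
  let I := hgt.normalModel G hsorts
  -- The default values are irrelevant: the input constants are ground, and the output variable is
  -- set separately.
  let v₀ : I.Val := fun s _ => (I.nonempty s).some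
  let v : I.Val := updateVar (fun s n => I.eval v₀ (Λ.env s n)) Λ.output.1 Λ.output.2 ⟨z, hzg, hzn⟩
  have hvi : ∀ x : {x : Var Λ.base // x ∈ Λ.inputs},
      v x.1.1 x.1.2 = I.eval v (Λ.inputConst x) := by
    intro x
    have hx : x.1 ≠ Λ.output := fun h => Λ.output_notMem (h ▸ x.2)
    have he : Λ.env x.1.1 x.1.2 = Λ.inputConst x := dif_pos x.2
    refine (updateVar_of_ne (fun s n => I.eval v₀ (Λ.env s n)) _ hx).trans ?_
    simp only [he]
    refine I.eval_congr fun y hy => ?_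
    obtain ⟨j, _⟩ := Set.mem_iUnion.1 hy
    exact j.elim0
  have hvo : v Λ.output.1 Λ.output.2 = ⟨z, hzg, hzn⟩ := updateVar_same _ _ _ _
  refine ⟨I, v, hvi, ?_, Spec.not_sat_of_cnf hvi fun C hC w hw => ?_⟩
  · rw [hvo]
    refine Subtype.ext ?_
    rw [hu G admissibleClauses_ground hmem v, hcongr hug huc]
  · rw [hvo] at hw
    -- As a ground substitution, `w` sends `y` to `z`, so the corresponding instance of the initial
    -- answer clause has label `z`.
    refine (IsPartitionedSimplificationOrder.normalModel_clause w C).2 ?_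
    have hans : (AnsClause.mk C (.simple Λ.outputTerm) : AnsClause Λ.sig Λ.osort).subst
        (IsPartitionedSimplificationOrder.valSubst w) =
        ⟨C.subst (IsPartitionedSimplificationOrder.valSubst w), .simple z⟩ := by
      refine congrArg (AnsClause.mk _) ?_
      simp only [PTerm.subst]
      exact congrArg PTerm.simple (congrArg Subtype.val hw)
    have hground : ((AnsClause.mk C (.simple Λ.outputTerm) : AnsClause Λ.sig Λ.osort).subst
        (IsPartitionedSimplificationOrder.valSubst w)).Ground :=
      AnsClause.ground_subst_iff.2 fun x _ =>
        IsPartitionedSimplificationOrder.valSubst_ground w x.1 x.2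
    have hfol := hfrom.follows hgt (A := ⟨C, .simple Λ.outputTerm⟩) ⟨hC, rfl⟩ hground
    rw [hans] at hfol hground
    exact hgt.trueUnder_of_follows hsorts (AnsClause.ground_mk.1 hground).1 hfol fun B hB hBz =>
      ⟨(AnsClause.ground_mk.1 hB.1).1, htrue B hB (.inr ⟨z, rfl, hBz⟩)⟩
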